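/- All functions are real-valued on $\mathbb T=\mathbb R/2\pi\mathbb Z$ and have mean zero; $H^k=H^k(\mathbb T)$ denotes the Sobolev space of such functions, $L^2=H^0$, and $H$ is the Hilbert transform, $\widehat{Hf}(n)=-i\,\mathrm{sgn}(n)\hat f(n)$. There is a curve $\epsilon\mapsto(u_\epsilon,v_\epsilon)$, $|\epsilon|<\delta$, with $(\epsilon,x)\mapsto u_\epsilon(x)$ and $\epsilon\mapsto v_\epsilon$ real analytic, such that $u_\epsilon$ is even in $x$, $Hu_\epsilon-v_\epsilon u_\epsilon'+u_\epsilon u_\epsilon'=0$ (so that $u_\epsilon(x+v_\epsilon t)$ is a traveling wave of the Burgers–Hilbert equation $f_t=Hf+ff_x$), $u_0=0$, $v_0=-1$, and the coefficient of $\cos x$ in the Fourier series of $u_\epsilon$ is $\epsilon$. Let $(u_\epsilon,v_\epsilon)$ be any such curve. Let $L_\epsilon g=-v_\epsilon g_x+Hg+(u_\epsilon g)_x$ be the linearized operator on $L^2$. For all sufficiently small $\epsilon\ne0$, say $0<|\epsilon|<\rho$, there are spectral projections $P_0^\pm(\epsilon)$ of $L_\epsilon$ for the eigenvalue $0$: bounded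 projections of $L^2$ onto the lines spanned by $\varphi_0^+(\epsilon)=\partial_\epsilon u_\epsilon$ and $\varphi_0^-(\epsilon)=-\epsilon^{-1}u_\epsilon'$ respectively, with $P_0^+P_0^-=P_0^-P_0^+=0$ and with $P_0^++P_0^-$ commuting with $L_\epsilon$. Let $k\ge2$ be an integer. Then there are $r=r(k)\in(0,\rho]$ and $C=C(k)$ such that for every $\epsilon_0$ with $|\epsilon_0|<r$ and every $f\in H^k$ with $\|f-u_{\epsilon_0}\|_{H^k}<r|\epsilon_0|$ there are $\epsilon\in\mathbb R$ with $0<|\epsilon|<\rho$, $a\in\mathbb R$ (giving a class in $\mathbb R/2\pi\mathbb Z$) and $g\in H^k$ with $$f(x)=u_\epsilon(x+a)+g(x+a),\qquad P_0^\pm(\epsilon)g=0,$$ $$|\epsilon-\epsilon_0|+\|g\|_{H^2}\le C\|f-u_{\epsilon_0}\|_{H^2},\qquad |\epsilon-\epsilon_0|+\|g\|_{H^k}\le C\|f-u_{\epsilon_0}\|_{H^k}.$$ Moreover, for each $\epsilon_0$, $\epsilon$, $a$ and $g$ can be chosen to depend smoothly on $f$ in the ball $\{\|f-u_{\epsilon_0}\|_{H^k}<r|\epsilon_0|\}$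 of $H^k$, in the following sense: $\epsilon$ and $a$ are $C^\infty$ functions of $f$, and $f\mapsto g$ is of class $C^j$ as a map into $H^{k-j}$ for every $0\le j\le k$. -/

import Mathlib

open Real Set MeasureTheory
open scoped ContDiff ENNReal

noncomputable section

namespace BurgersHilbert

instance fact_two_pi_pos : Fact (0 < 2 * π) := ⟨Real.two_pi_pos⟩

/-- The torus `ℝ / 2πℤ`. -/
abbrev Torus : Type := AddCircle (2 * π)

/-- The invariant probability measure `dx / 2π` on the torus. -/
abbrev torusMeasure : Measure Torus := AddCircle.haarAddCircle

/-- The `n`-th Fourier coefficient `(1 / 2π) ∫ f(x) e^{-inx} dx` of a real function on the torus. -/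
def coef (f : Torus → ℝ) (n : ℤ) : ℂ := fourierCoeff (fun x => (f x : ℂ)) n

lemma coef_congr_ae {f g : Torus → ℝ} (h : f =ᵐ[torusMeasure] g) (n : ℤ) :
    coef f n = coef g n := by
  unfold coef
  exact congrFun (fourierCoeff_congr_ae (h.mono fun x hx => by simp [hx])) n

lemma coef_add {f g : Torus → ℝ} (hf : Integrable f torusMeasure)
    (hg : Integrable g torusMeasure) (n : ℤ) :
    coef (f + g) n = coef f n + coef g n := by
  have := congrFun (fourierCoeff.add (T := 2 * π) (E := ℂ) hf.ofReal hg.ofReal) n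
  simp only [Pi.add_apply] at this
  rw [coef, coef, coef]
  erw [← this]
  congr 1
  funext x
  simp

lemma coef_smul (c : ℝ) (f : Torus → ℝ) (n : ℤ) : coef (c • f) n = c * coef f n := by
  have := fourierCoeff.const_mul (T := 2 * π) (fun x => (f x : ℂ)) (c : ℂ) n
  rw [coef, coef, ← this]
  congr 1
  funext x
  simp

/-! ### Real `L²` functions of mean zero and Sobolev spaces on the torus -/

/-- Real square integrable functions on the torus with mean zero. -/
def L2Zero : Submodule ℝ (Lp ℝ 2 torusMeasure) where
  carrier := {f | ∫ x, f x ∂torusMeasure = 0}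
  zero_mem' := by
    change ∫ x, (0 : Lp ℝ 2 torusMeasure) x ∂torusMeasure = 0
    rw [integral_congr_ae (Lp.coeFn_zero ℝ 2 torusMeasure)]
    simp
  add_mem' := by
    intro f g hf hg
    change ∫ x, (f + g) x ∂torusMeasure = 0
    rw [integral_congr_ae (Lp.coeFn_add f g)]
    simp only [Pi.add_apply]
    rw [integral_add ((Lp.memLp f).integrable (by norm_num))
      ((Lp.memLp g).integrable (by norm_num))]
    rw [mem_ofPred_eq] at hf hg
    rw [hf, hg, add_zero]
  smul_mem' := by
    intro c f hf
    change ∫ x, (c • f) x ∂torusMeasure = 0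
    rw [integral_congr_ae (Lp.coeFn_smul c f)]
    simp only [Pi.smul_apply, integral_smul]
    rw [mem_ofPred_eq] at hf
    rw [hf, smul_zero]

/-- A representative of an element of `L2Zero`, as a function on the torus. -/
def l2fn (f : L2Zero) : Torus → ℝ := (f : Lp ℝ 2 torusMeasure)

/-- `f'` is the weak derivative of `f`, expressed by Fourier coefficients. -/
def IsWeakDeriv (f f' : L2Zero) : Prop :=
  ∀ n : ℤ, coef (l2fn f') n = Complex.I * n * coef (l2fn f) n

lemma L2Zero.coef_add (f g : L2Zero) (n : ℤ) :
    coef (l2fn (f + g)) n = coef (l2fn f) n + coef (l2fn g) n := by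
  have h := BurgersHilbert.coef_add ((Lp.memLp f.1).integrable (by norm_num))
    ((Lp.memLp g.1).integrable (by norm_num)) n
  exact (coef_congr_ae (Lp.coeFn_add f.1 g.1) n).trans h

lemma L2Zero.coef_smul (c : ℝ) (f : L2Zero) (n : ℤ) :
    coef (l2fn (c • f)) n = c * coef (l2fn f) n := by
  rw [← BurgersHilbert.coef_smul]
  exact coef_congr_ae (Lp.coeFn_smul c f.1) n

lemma L2Zero.coef_zero (n : ℤ) : coef (l2fn (0 : L2Zero)) n = 0 := by
  have := L2Zero.coef_smul 0 (0 : L2Zero) n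
  simpa using this

/-- The Sobolev space `H^k` of real mean zero functions on the torus. An element is the tuple
`(f, f', …, f^{(k)})` of a function and its weak derivatives, so that the norm inherited from the
`ℓ²` product is `‖f‖² = ∑_{j ≤ k} ‖f^{(j)}‖²_{L²}`. -/
def Sob (k : ℕ) : Submodule ℝ (PiLp 2 (fun _ : Fin (k + 1) => L2Zero)) where
  carrier := {F | ∀ j : Fin k, IsWeakDeriv (F j.castSucc) (F j.succ)}
  zero_mem' := by
    intro j n
    change coef (l2fn 0) n = Complex.I * n * coef (l2fn 0) n
    rw [L2Zero.coef_zero, mul_zero]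
  add_mem' := by
    intro F G hF hG j n
    rw [PiLp.add_apply, PiLp.add_apply, L2Zero.coef_add, L2Zero.coef_add, hF j n, hG j n]
    ring
  smul_mem' := by
    intro c F hF j n
    rw [PiLp.smul_apply, PiLp.smul_apply, L2Zero.coef_smul, L2Zero.coef_smul, hF j n]
    ring

/-- The function in `L²` underlying an element of `H^k`. -/
def sobToL2 {k : ℕ} (F : Sob k) : L2Zero := F.1 0

/-- The function on the torus underlying an element of `H^k`. -/
def sobFn {k : ℕ} (F : Sob k) : Torus → ℝ := l2fn (sobToL2 F)

/-- The inclusion `H^k ⊆ H^j` for `j ≤ k`. -/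
def sobIncl {j k : ℕ} (h : j ≤ k) (F : Sob k) : Sob j :=
  ⟨WithLp.toLp 2 fun i => F.1 (i.castLE (Nat.succ_le_succ h)), fun i =>
    F.2 (i.castLE h)⟩

/-! ### Smooth periodic functions -/

/-- Smooth `2π`-periodic real functions with mean zero. -/
structure SmoothZero where
  toFun : ℝ → ℝ
  smooth : ContDiff ℝ ∞ toFun
  periodic : Function.Periodic toFun (2 * π)
  mean_zero : ∫ x in (0 : ℝ)..(2 * π), toFun x = 0

instance : CoeFun SmoothZero (fun _ => ℝ → ℝ) := ⟨SmoothZero.toFun⟩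

/-- The derivative `w'`. -/
def SmoothZero.diff (w : SmoothZero) : SmoothZero where
  toFun := deriv w
  smooth := (contDiff_infty_iff_deriv.1 w.smooth).2
  periodic := fun x => by
    have h : (fun y => w (y + 2 * π)) = w := funext w.periodic
    rw [← deriv_comp_add_const, h]
  mean_zero := by
    rw [intervalIntegral.integral_deriv_eq_sub
      (fun x _ => (w.smooth.differentiable (by simp)).differentiableAt)
      ((contDiff_infty_iff_deriv.1 w.smooth).2.continuous.intervalIntegrable _ _)]
    have := w.periodic 0
    rw [zero_add] at this
    rw [this, sub_self]

/-- `w` as a function on the torus. -/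
def SmoothZero.fn (w : SmoothZero) : Torus → ℝ := w.periodic.lift

lemma SmoothZero.continuous_fn (w : SmoothZero) : Continuous w.fn :=
  continuous_coinduced_dom.mpr w.smooth.continuous

lemma SmoothZero.memLp (w : SmoothZero) : MemLp w.fn 2 torusMeasure :=
  (w.continuous_fn.memLp_of_hasCompactSupport (HasCompactSupport.of_compactSpace _))

/-- `w` as an element of `L²`. -/
def SmoothZero.toL2 (w : SmoothZero) : L2Zero :=
  ⟨w.memLp.toLp, by
    change ∫ x, (w.memLp.toLp : Lp ℝ 2 torusMeasure) x ∂torusMeasure = 0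
    rw [integral_congr_ae w.memLp.coeFn_toLp, AddCircle.integral_haarAddCircle,
      ← AddCircle.intervalIntegral_preimage (2 * π) 0]
    have : (∫ a in (0 : ℝ)..0 + 2 * π, w.fn a) = ∫ x in (0 : ℝ)..(2 * π), w x := by
      rw [zero_add]; rfl
    rw [this, w.mean_zero, smul_zero]⟩

lemma SmoothZero.coef_diff (w : SmoothZero) (n : ℤ) :
    coef w.diff.fn n = Complex.I * n * coef w.fn n := by
  have hw : ∀ x : ℝ, HasDerivAt (fun y : ℝ => (w y : ℂ)) ((deriv w x : ℝ) : ℂ) x := fun x =>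
    ((w.smooth.differentiable (by simp)).differentiableAt.hasDerivAt).ofReal_comp
  have he : ∀ x : ℝ, HasDerivAt (fun y : ℝ => fourier (-n) (y : Torus))
      (-2 * π * Complex.I * n / (2 * π : ℝ) * fourier (-n) (x : Torus)) x := fun x =>
    hasDerivAt_fourier_neg (2 * π) n x
  have hc : Continuous fun y : ℝ => (fourier (-n) (y : Torus) : ℂ) :=
    continuous_iff_continuousAt.2 fun x => (he x).continuousAt
  have hd : Continuous (deriv w) := (contDiff_infty_iff_deriv.1 w.smooth).2.continuous
  have key := intervalIntegral.integral_mul_deriv_eq_deriv_mul (a := 0) (b := 2 * π)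
    (fun x _ => he x) (fun x _ => hw x)
    ((continuous_const.mul hc).intervalIntegrable _ _)
    ((Complex.continuous_ofReal.comp hd).intervalIntegrable _ _)
  have hb : (w (2 * π) : ℂ) = w 0 := by
    have := w.periodic 0
    rw [zero_add] at this
    rw [this]
  have hp : ((2 * π : ℝ) : Torus) = ((0 : ℝ) : Torus) := AddCircle.coe_period (2 * π)
  rw [hb, hp, sub_self, zero_sub] at key
  rw [coef, coef, fourierCoeff_eq_intervalIntegral _ n 0, fourierCoeff_eq_intervalIntegral _ n 0,
    zero_add]
  simp only [smul_eq_mul]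
  change (1 / (2 * π) : ℝ) • (∫ x in (0 : ℝ)..(2 * π), fourier (-n) (x : Torus) *
      ((deriv w x : ℝ) : ℂ)) = Complex.I * n * ((1 / (2 * π) : ℝ) •
      ∫ x in (0 : ℝ)..(2 * π), fourier (-n) (x : Torus) * (w x : ℂ))
  rw [key]
  simp only [mul_assoc]
  simp only [intervalIntegral.integral_const_mul, Complex.real_smul]
  have hpi : (π : ℂ) ≠ 0 := by exact_mod_cast Real.pi_ne_zero
  push_cast
  field_simp

lemma SmoothZero.isWeakDeriv (w : SmoothZero) : IsWeakDeriv w.toL2 w.diff.toL2 := by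
  intro n
  have h1 : coef (l2fn w.diff.toL2) n = coef w.diff.fn n := coef_congr_ae w.diff.memLp.coeFn_toLp n
  have h2 : coef (l2fn w.toL2) n = coef w.fn n := coef_congr_ae w.memLp.coeFn_toLp n
  rw [h1, h2, w.coef_diff]

/-- `w` as an element of `H^k`. -/
def SmoothZero.toSob (k : ℕ) (w : SmoothZero) : Sob k :=
  ⟨WithLp.toLp 2 fun j => (SmoothZero.diff^[(j : ℕ)] w).toL2, fun j => by
    have := (SmoothZero.diff^[(j : ℕ)] w).isWeakDeriv
    rw [← Function.iterate_succ_apply' SmoothZero.diff (j : ℕ) w] at this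
    exact this⟩

/-! ### Traveling waves of the Burgers–Hilbert equation and the linearized operator -/

/-- `h = Hf` for the periodic Hilbert transform, the Fourier multiplier `-i sgn n`. -/
def IsHilbertTransform (f h : Torus → ℝ) : Prop :=
  ∀ n : ℤ, coef h n = -Complex.I * (n.sign : ℂ) * coef f n

/-- `u(x + vt)` solves `f_t = Hf + f f_x`, that is, `Hu - v u' + u u' = 0`. -/
def IsTravelingWave (u : SmoothZero) (v : ℝ) : Prop :=
  IsHilbertTransform u.fn (fun x => v * u.diff.fn x - u.fn x * u.diff.fn x)

/-- `ε ↦ (u_ε, v_ε)`, `|ε| < δ`, is the analytic curve of even traveling waves of mean zero that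
bifurcates from `(0, -1)` in the direction of `cos x`, parametrized by the coefficient of `cos x`
in `u_ε`. Comparing powers of `ε` shows that there is at most one such curve for each `δ`. -/
structure IsBifurcationCurve (δ : ℝ) (u : ℝ → SmoothZero) (v : ℝ → ℝ) : Prop where
  pos : 0 < δ
  analytic_u : AnalyticOnNhd ℝ (fun p : ℝ × ℝ => u p.1 p.2) (Ioo (-δ) δ ×ˢ univ)
  analytic_v : AnalyticOnNhd ℝ v (Ioo (-δ) δ)
  u_zero : ∀ x, u 0 x = 0
  v_zero : v 0 = -1
  wave : ∀ ε ∈ Ioo (-δ) δ, IsTravelingWave (u ε) (v ε)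
  even : ∀ ε ∈ Ioo (-δ) δ, ∀ x, u ε (-x) = u ε x
  amplitude : ∀ ε ∈ Ioo (-δ) δ, (1 / π) * ∫ x in (0 : ℝ)..(2 * π), u ε x * cos x = ε

/-- `w = L g` in `L²`, where `L g = -v g_x + H g + (u g)_x` is the linearization of the equation
around the traveling wave `(u, v)`, with the derivatives taken in the weak sense. This is the
graph of `L` as an unbounded operator on `L²` functions of mean zero, with its maximal domain. -/
def IsLinearization (u : SmoothZero) (v : ℝ) (g w : L2Zero) : Prop :=
  ∀ n : ℤ, coef (l2fn w) n =
    Complex.I * n * coef (fun x => (u.fn x - v) * l2fn g x) n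
      - Complex.I * (n.sign : ℂ) * coef (l2fn g) n

/-- `P⁺` and `P⁻` are the spectral projections `P₀^±(ε)` of `L_ε` belonging to the eigenvalue `0`:
bounded projections on `L²` functions of mean zero, onto the lines spanned by
`φ₀⁺ = ∂_ε u_ε` and `φ₀⁻ = -ε⁻¹ u_ε'` respectively, that annihilate each other's range and whose
sum commutes with `L_ε` (so that the kernel of the sum is the complementary spectral subspace).
For small `ε ≠ 0` the generalized kernel of `L_ε` is spanned by `φ₀^±`, and such `P^±` are then
unique. -/
structure IsZeroModeProjection (u : ℝ → SmoothZero) (v : ℝ → ℝ) (ε : ℝ)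
    (Pp Pm : L2Zero →L[ℝ] L2Zero) : Prop where
  idem_plus : ∀ g, Pp (Pp g) = Pp g
  idem_minus : ∀ g, Pm (Pm g) = Pm g
  plus_minus : ∀ g, Pp (Pm g) = 0
  minus_plus : ∀ g, Pm (Pp g) = 0
  range_plus : ∀ w : L2Zero, (∃ g, Pp g = w) ↔
    ∃ c : ℝ, ∀ᵐ x : ℝ, l2fn w (x : Torus) = c * deriv (fun e => u e x) ε
  range_minus : ∀ w : L2Zero, (∃ g, Pm g = w) ↔
    ∃ c : ℝ, ∀ᵐ x : ℝ, l2fn w (x : Torus) = c * (-ε⁻¹ * deriv (u ε) x)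
  commute : ∀ g w : L2Zero, IsLinearization (u ε) (v ε) g w →
    IsLinearization (u ε) (v ε) (Pp g + Pm g) (Pp w + Pm w)

end BurgersHilbert

end

/-!
Substituting `u = ε (cos x + w)` turns the wave equation into a fixed point equation `w = ε G(w)`
for the coefficients of `w` in a weighted `ℓ¹` space, on which `G` is a polynomial. The analytic
implicit function theorem gives the branch, and inverting `v + 1 / |n|` on the modes `|n| ≥ 2` shows
that it is locally unique. Differentiating the wave equation in `x` and in `ε` shows that `L_ε`
preserves the span of `u_ε'` and `∂_ε u_ε`; the functionals dual to this basis are given by the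
antiderivative of `∂_ε u_ε` and by `ε⁻¹ u_ε`, so the projections are explicit.

After division of `f` by `ε₀` the equations `P₀^±(ε) g = 0` for `(ε / ε₀, a)` are nondegenerate at
`ε₀ = 0`. The translation can be moved from `f` to the analytic waves, so `ε` and `a` depend
smoothly on `f ∈ L²`. One solution in `L²` therefore serves all `H^k`, and the loss of derivatives
in `g` comes only from the translation of `f`.
-/

noncomputable section

namespace BurgersHilbert

open Filter Topology ComplexConjugate

/-! ### Fourier coefficients of square integrable functions -/

/-- Complexification of real square integrable functions, which makes the Hilbert basis of
exponentials available for them. -/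
def toComplexL2 : Lp ℝ 2 torusMeasure →L[ℝ] Lp ℂ 2 torusMeasure :=
  Complex.ofRealCLM.compLpL 2 torusMeasure

lemma coeFn_toComplexL2 (f : Lp ℝ 2 torusMeasure) :
    toComplexL2 f =ᵐ[torusMeasure] fun x => (f x : ℂ) :=
  Complex.ofRealCLM.coeFn_compLpL f

lemma toComplexL2_injective : Function.Injective toComplexL2 := fun f g h => by
  refine Lp.ext ?_
  filter_upwards [coeFn_toComplexL2 f, coeFn_toComplexL2 g] with x hf hg
  rw [h] at hf
  exact_mod_cast hf.symm.trans hg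

lemma inner_toComplexL2 (f g : Lp ℝ 2 torusMeasure) :
    inner ℂ (toComplexL2 f) (toComplexL2 g) = ((inner ℝ f g : ℝ) : ℂ) := by
  rw [L2.inner_def, L2.inner_def, ← integral_complex_ofReal]
  refine integral_congr_ae ?_
  filter_upwards [coeFn_toComplexL2 f, coeFn_toComplexL2 g] with x hf hg
  rw [hf, hg]
  simp

lemma coef_eq_repr (f : Lp ℝ 2 torusMeasure) (n : ℤ) :
    coef f n = fourierBasis.repr (toComplexL2 f) n := by
  rw [fourierBasis_repr]
  exact (congrFun (fourierCoeff_congr_ae (coeFn_toComplexL2 f)) n).symm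

lemma hasSum_coef_mul_conj (f g : Lp ℝ 2 torusMeasure) :
    HasSum (fun n : ℤ => coef f n * conj (coef g n)) ((inner ℝ f g : ℝ) : ℂ) := by
  have h := (fourierBasis (T := 2 * π)).hasSum_inner_mul_inner (toComplexL2 g) (toComplexL2 f)
  rw [inner_toComplexL2, real_inner_comm] at h
  refine h.congr_fun fun n => ?_
  rw [coef_eq_repr, coef_eq_repr, HilbertBasis.repr_apply_apply, HilbertBasis.repr_apply_apply,
    inner_conj_symm, mul_comm]

lemma hasSum_norm_coef_sq (f : Lp ℝ 2 torusMeasure) :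
    HasSum (fun n : ℤ => ‖coef f n‖ ^ 2) (‖f‖ ^ 2) := by
  have h := Complex.hasSum_re (hasSum_coef_mul_conj f f)
  rw [Complex.ofReal_re, real_inner_self_eq_norm_sq] at h
  refine h.congr_fun fun n => ?_
  rw [Complex.mul_conj, Complex.ofReal_re, Complex.normSq_eq_norm_sq]

lemma norm_coef_le (f : Lp ℝ 2 torusMeasure) (n : ℤ) : ‖coef f n‖ ≤ ‖f‖ :=
  le_of_sq_le_sq (le_hasSum (hasSum_norm_coef_sq f) n fun _ _ => sq_nonneg _) (norm_nonneg _)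

lemma Lp_ext_coef {f g : Lp ℝ 2 torusMeasure} (h : ∀ n, coef f n = coef g n) : f = g := by
  refine toComplexL2_injective ((fourierBasis (T := 2 * π)).repr.injective ?_)
  ext n
  rw [← coef_eq_repr, ← coef_eq_repr, h]

/-- The `n`-th Fourier coefficient as a continuous linear map on `L²`. -/
def coefLp (n : ℤ) : Lp ℝ 2 torusMeasure →L[ℝ] ℂ :=
  LinearMap.mkContinuous
    { toFun := fun f => coef f n
      map_add' := fun f g => (coef_congr_ae (Lp.coeFn_add f g) n).trans
        (coef_add ((Lp.memLp f).integrable (by norm_num)) ((Lp.memLp g).integrable (by norm_num)) n)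
      map_smul' := fun c f => (coef_congr_ae (Lp.coeFn_smul c f) n).trans (coef_smul c f n) } 1
    fun f => by rw [one_mul]; exact norm_coef_le f n

/-- The `n`-th Fourier coefficient as a continuous linear map on `L²` functions of mean zero. -/
def L2Zero.coefL (n : ℤ) : L2Zero →L[ℝ] ℂ := (coefLp n).comp L2Zero.subtypeL

lemma L2Zero.ext_coef {f g : L2Zero} (h : ∀ n, coefL n f = coefL n g) : f = g :=
  Subtype.ext (Lp_ext_coef h)

/-- The `n`-th Fourier coefficient as a continuous linear map on continuous functions. -/
def coefC (n : ℤ) : C(Torus, ℝ) →L[ℝ] ℂ :=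
  (coefLp n).comp (ContinuousMap.toLp 2 torusMeasure ℝ)

lemma coefC_apply (n : ℤ) (f : C(Torus, ℝ)) : coefC n f = coef f n :=
  coef_congr_ae (ContinuousMap.coeFn_toLp torusMeasure f) n

lemma memLp_of_continuous {f : Torus → ℝ} (hf : Continuous f) : MemLp f 2 torusMeasure :=
  hf.memLp_of_hasCompactSupport (HasCompactSupport.of_compactSpace _)

lemma ae_eq_of_coef_eq {f g : Torus → ℝ} (hf : MemLp f 2 torusMeasure)
    (hg : MemLp g 2 torusMeasure) (h : ∀ n, coef f n = coef g n) : f =ᵐ[torusMeasure] g := by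
  have : hf.toLp = hg.toLp := Lp_ext_coef fun n => by
    rw [coef_congr_ae hf.coeFn_toLp, coef_congr_ae hg.coeFn_toLp, h]
  exact hf.coeFn_toLp.symm.trans ((EventuallyEq.of_eq (by rw [this])).trans hg.coeFn_toLp)

lemma eq_of_coef_eq {f g : Torus → ℝ} (hf : Continuous f) (hg : Continuous g)
    (h : ∀ n, coef f n = coef g n) : f = g :=
  (Continuous.ae_eq_iff_eq torusMeasure hf hg).1
    (ae_eq_of_coef_eq (memLp_of_continuous hf) (memLp_of_continuous hg) h)

lemma inner_toLp {f g : Torus → ℝ} (hf : MemLp f 2 torusMeasure) (hg : MemLp g 2 torusMeasure) :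
    inner ℝ hf.toLp hg.toLp = ∫ x, f x * g x ∂torusMeasure := by
  rw [L2.inner_def]
  refine integral_congr_ae ?_
  filter_upwards [hf.coeFn_toLp, hg.coeFn_toLp] with x h1 h2
  rw [h1, h2]
  simp [mul_comm]

lemma hasSum_coef_mul_conj_of_memLp {f g : Torus → ℝ} (hf : MemLp f 2 torusMeasure)
    (hg : MemLp g 2 torusMeasure) :
    HasSum (fun n : ℤ => coef f n * conj (coef g n)) ((∫ x, f x * g x ∂torusMeasure : ℝ) : ℂ) := by
  have h := hasSum_coef_mul_conj hf.toLp hg.toLp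
  rw [inner_toLp] at h
  refine h.congr_fun fun n => ?_
  rw [coef_congr_ae hf.coeFn_toLp, coef_congr_ae hg.coeFn_toLp]

lemma coef_zero_eq_integral (f : Torus → ℝ) :
    coef f 0 = ((∫ x, f x ∂torusMeasure : ℝ) : ℂ) := by
  rw [coef, fourierCoeff, ← integral_complex_ofReal]
  simp

lemma coef_comp_sub (f : Torus → ℝ) (a : Torus) (n : ℤ) :
    coef (fun x => f (x - a)) n = fourier (-n) a * coef f n := by
  rw [coef, coef, fourierCoeff, fourierCoeff, ← integral_const_mul,
    ← integral_sub_right_eq_self (μ := torusMeasure) _ (-a)]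
  congr 1
  funext x
  simp only [sub_neg_eq_add, add_sub_cancel_right, smul_eq_mul]
  rw [fourier_apply, fourier_apply, fourier_apply, smul_add, AddCircle.toCircle_add]
  push_cast
  ring

lemma coef_comp_neg (f : Torus → ℝ) (n : ℤ) :
    coef (fun x => f (-x)) n = coef f (-n) := by
  rw [coef, coef, fourierCoeff, fourierCoeff, ← integral_neg_eq_self (μ := torusMeasure)]
  congr 1
  funext x
  simp [fourier_apply]

/-! ### Bounded linear maps on `ℓ¹` -/

/-- Absolutely summable real sequences. -/
abbrev Ell : Type := lp (fun _ : ℕ => ℝ) 1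

namespace Ell

/-- The `n`-th unit vector of `ℓ¹`. -/
def unitVec (n : ℕ) : Ell := lp.single 1 n (1 : ℝ)

/-- The `n`-th coordinate on `ℓ¹`. -/
def coord (n : ℕ) : Ell →L[ℝ] ℝ := lp.evalCLM ℝ (fun _ : ℕ => ℝ) 1 n

lemma norm_unitVec (n : ℕ) : ‖unitVec n‖ = 1 := by
  rw [unitVec, lp.norm_single (by norm_num), norm_one]

lemma coord_unitVec (n m : ℕ) : coord n (unitVec m) = if m = n then 1 else 0 := by
  change unitVec m n = _
  rw [unitVec, lp.single_apply, Pi.single_apply]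
  exact if_congr eq_comm rfl rfl

lemma ext_coord {b c : Ell} (h : ∀ n, coord n b = coord n c) : b = c := lp.ext (funext h)

lemma hasSum_norm_coord (b : Ell) : HasSum (fun n => ‖coord n b‖) ‖b‖ := by
  simpa using! lp.hasSum_norm (p := 1) (by norm_num) b

lemma hom_ext {Y : Type*} [NormedAddCommGroup Y] [NormedSpace ℝ Y]
    {S T : Ell →L[ℝ] Y} (h : ∀ n, S (unitVec n) = T (unitVec n)) : S = T :=
  lp.ext_continuousLinearMap (by norm_num) fun n => by
    ext
    exact h n

lemma bilin_ext {Y : Type*} [NormedAddCommGroup Y] [NormedSpace ℝ Y]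
    {S T : Ell →L[ℝ] Ell →L[ℝ] Y}
    (h : ∀ m n, S (unitVec m) (unitVec n) = T (unitVec m) (unitVec n)) : S = T :=
  hom_ext fun m => hom_ext fun n => h m n

section Lift

variable {Y : Type*} [NormedAddCommGroup Y] [NormedSpace ℝ Y] [CompleteSpace Y]
  {v : ℕ → Y} {C : ℝ}

lemma summable_coord_smul (hv : ∀ n, ‖v n‖ ≤ C) (b : Ell) : Summable fun n => coord n b • v n :=
  Summable.of_norm_bounded ((hasSum_norm_coord b).summable.mul_right C) fun n => by
    rw [norm_smul]; exact mul_le_mul_of_nonneg_left (hv n) (norm_nonneg _)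

/-- The bounded linear map on `ℓ¹` that sends the `n`-th unit vector to `v n`, for a bounded
sequence `v`. -/
def lift (v : ℕ → Y) (C : ℝ) (hv : ∀ n, ‖v n‖ ≤ C) : Ell →L[ℝ] Y :=
  LinearMap.mkContinuous
    { toFun := fun b => ∑' n, coord n b • v n
      map_add' := fun b c => by
        simp only [map_add, add_smul]
        exact (summable_coord_smul hv b).tsum_add (summable_coord_smul hv c)
      map_smul' := fun r b => by
        simp only [map_smul, smul_assoc]
        exact (summable_coord_smul hv b).tsum_const_smul r } C
    fun b => tsum_of_norm_bounded ((hasSum_norm_coord b).mul_left C) fun n => by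
      rw [norm_smul, mul_comm]
      exact mul_le_mul_of_nonneg_right (hv n) (norm_nonneg _)

lemma norm_lift_le (hv : ∀ n, ‖v n‖ ≤ C) : ‖lift v C hv‖ ≤ C :=
  LinearMap.mkContinuous_norm_le _ ((norm_nonneg _).trans (hv 0)) _

lemma lift_unitVec (hv : ∀ n, ‖v n‖ ≤ C) (n : ℕ) : lift v C hv (unitVec n) = v n := by
  change ∑' m, coord m (unitVec n) • v m = v n
  rw [tsum_eq_single n fun m hm => by rw [coord_unitVec, if_neg hm.symm, zero_smul],
    coord_unitVec, if_pos rfl, one_smul]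

end Lift

/-- The diagonal operator `(bₙ) ↦ (cₙ bₙ)`, for a bounded sequence `c`. -/
def diag (c : ℕ → ℝ) (C : ℝ) (hc : ∀ n, |c n| ≤ C) : Ell →L[ℝ] Ell :=
  lift (fun n => c n • unitVec n) C fun n => by
    rw [norm_smul, norm_unitVec, mul_one]; exact hc n

lemma diag_unitVec {c : ℕ → ℝ} {C : ℝ} (hc : ∀ n, |c n| ≤ C) (n : ℕ) :
    diag c C hc (unitVec n) = c n • unitVec n := lift_unitVec _ n

lemma coord_diag {c : ℕ → ℝ} {C : ℝ} (hc : ∀ n, |c n| ≤ C) (n : ℕ) (b : Ell) :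
    coord n (diag c C hc b) = c n * coord n b := by
  have : (coord n).comp (diag c C hc) = c n • coord n := hom_ext fun m => by
    rw [ContinuousLinearMap.comp_apply, diag_unitVec, map_smul, smul_apply,
      coord_unitVec]
    split_ifs with h
    · rw [h]
    · rw [smul_zero, smul_zero]
  exact DFunLike.congr_fun this b

end Ell

open Ell

/-! ### Cosine and sine series with exponentially decaying coefficients -/

/-- The function `cos (n x)` on the torus. -/
def cosT (n : ℤ) : C(Torus, ℝ) := ⟨fun x => (fourier n x).re, by fun_prop⟩

/-- The function `sin (n x)` on the torus. -/
def sinT (n : ℤ) : C(Torus, ℝ) := ⟨fun x => (fourier n x).im, by fun_prop⟩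

lemma fourier_coe_torus (n : ℤ) (x : ℝ) :
    (fourier n (x : Torus) : ℂ) = Complex.exp (((n * x : ℝ) : ℂ) * Complex.I) := by
  rw [fourier_coe_apply]
  congr 1
  have : (π : ℂ) ≠ 0 := by exact_mod_cast Real.pi_ne_zero
  push_cast
  field_simp

lemma cosT_coe (n : ℤ) (x : ℝ) : cosT n (x : Torus) = cos (n * x) := by
  change (fourier n (x : Torus)).re = _
  rw [fourier_coe_torus, Complex.exp_ofReal_mul_I_re]

lemma sinT_coe (n : ℤ) (x : ℝ) : sinT n (x : Torus) = sin (n * x) := by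
  change (fourier n (x : Torus)).im = _
  rw [fourier_coe_torus, Complex.exp_ofReal_mul_I_im]

lemma Torus.funext {Y : Type*} {f g : Torus → Y} (h : ∀ x : ℝ, f (x : Torus) = g (x : Torus)) :
    f = g := by
  ext x
  induction x using QuotientAddGroup.induction_on with
  | H x => exact h x

lemma cosT_neg (n : ℤ) (x : Torus) : cosT n (-x) = cosT n x := by
  change (fourier n (-x)).re = (fourier n x).re
  rw [fourier_apply, fourier_apply, smul_neg, AddCircle.toCircle_neg, Circle.coe_inv_eq_conj,
    Complex.conj_re]

lemma norm_cosT_le (n : ℤ) : ‖cosT n‖ ≤ 1 :=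
  (ContinuousMap.norm_le _ zero_le_one).2 fun _ =>
    (Complex.abs_re_le_norm _).trans (Circle.norm_coe _).le

lemma norm_sinT_le (n : ℤ) : ‖sinT n‖ ≤ 1 :=
  (ContinuousMap.norm_le _ zero_le_one).2 fun _ =>
    (Complex.abs_im_le_norm _).trans (Circle.norm_coe _).le

lemma norm_smul_cosT_le {c : ℝ} (hc : |c| ≤ 1) (n : ℤ) : ‖c • cosT n‖ ≤ 1 := by
  rw [norm_smul]; exact mul_le_one₀ hc (norm_nonneg _) (norm_cosT_le n)

lemma norm_smul_sinT_le {c : ℝ} (hc : |c| ≤ 1) (n : ℤ) : ‖c • sinT n‖ ≤ 1 := by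
  rw [norm_smul]; exact mul_le_one₀ hc (norm_nonneg _) (norm_sinT_le n)

lemma fourierCoeff_add_mul (m n : ℤ) (a b : ℂ) (k : ℤ) :
    fourierCoeff (fun x : Torus => a * fourier m x + b * fourier n x) k =
      a * (if k = m then 1 else 0) + b * (if k = n then 1 else 0) := by
  have hint (j : ℤ) (c : ℂ) : Integrable (fun x : Torus => c * fourier j x) torusMeasure :=
    Continuous.integrable_of_hasCompactSupport (by fun_prop) (HasCompactSupport.of_compactSpace _)
  have hfourier (j : ℤ) :
      fourierCoeff (fun x : Torus => (fourier j x : ℂ)) k = if k = j then 1 else 0 :=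
    (congrFun (fourierCoeff_fourier (T := 2 * π) j) k).trans (Pi.single_apply ..)
  refine (congrFun (fourierCoeff.add (hint m a) (hint n b)) k).trans ?_
  rw [Pi.add_apply, fourierCoeff.const_mul, fourierCoeff.const_mul, hfourier, hfourier]

lemma coef_cosT (n k : ℤ) :
    coef (cosT n) k = ((if k = n then 1 else 0) + (if k = -n then 1 else 0)) / 2 := by
  have : (fun x => ((cosT n x : ℝ) : ℂ)) =
      fun x : Torus => (1 / 2 : ℂ) * fourier n x + (1 / 2) * fourier (-n) x := by
    funext x
    change (((fourier n x).re : ℝ) : ℂ) = _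
    rw [fourier_neg, Complex.re_eq_add_conj]
    ring
  rw [coef, this, fourierCoeff_add_mul]
  ring

lemma coef_sinT (n k : ℤ) :
    coef (sinT n) k =
      -Complex.I * ((if k = n then 1 else 0) - (if k = -n then 1 else 0)) / 2 := by
  have : (fun x => ((sinT n x : ℝ) : ℂ)) =
      fun x : Torus => (-Complex.I / 2 : ℂ) * fourier n x + (Complex.I / 2) * fourier (-n) x := by
    funext x
    change (((fourier n x).im : ℝ) : ℂ) = _
    rw [fourier_neg, Complex.im_eq_sub_conj]
    field_simp
    rw [Complex.I_sq]
    ring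
  rw [coef, this, fourierCoeff_add_mul]
  ring

lemma coef_continuousMap_smul (c : ℝ) (f : C(Torus, ℝ)) (k : ℤ) :
    coef (c • f : C(Torus, ℝ)) k = c * coef f k := by
  rw [ContinuousMap.coe_smul, coef_smul]

/-- The series `∑ cₙ bₙ cos (n x)`, for a bounded sequence `c`, as a bounded linear map of
`b ∈ ℓ¹`. -/
def cosineSeries (c : ℕ → ℝ) (hc : ∀ n, |c n| ≤ 1) : Ell →L[ℝ] C(Torus, ℝ) :=
  lift (fun n => c n • cosT n) 1 fun n => norm_smul_cosT_le (hc n) n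

/-- The series `∑ cₙ bₙ sin (n x)`, for a bounded sequence `c`, as a bounded linear map of
`b ∈ ℓ¹`. -/
def sineSeries (c : ℕ → ℝ) (hc : ∀ n, |c n| ≤ 1) : Ell →L[ℝ] C(Torus, ℝ) :=
  lift (fun n => c n • sinT n) 1 fun n => norm_smul_sinT_le (hc n) n

section MultiplierSeries

variable {c : ℕ → ℝ} (hc : ∀ n, |c n| ≤ 1)

lemma cosineSeries_unitVec (n : ℕ) : cosineSeries c hc (unitVec n) = c n • cosT n :=
  lift_unitVec _ n

lemma sineSeries_unitVec (n : ℕ) : sineSeries c hc (unitVec n) = c n • sinT n :=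
  lift_unitVec _ n

lemma coef_eq_mul_coord {S : Ell →L[ℝ] C(Torus, ℝ)} {k : ℤ} {m : ℕ} {z : ℂ}
    (h : ∀ n, coef (S (unitVec n)) k = if n = m then z else 0) (b : Ell) :
    coef (S b) k = z * coord m b := by
  have : (coefC k).comp S =
      (ContinuousLinearMap.mul ℝ ℂ z).comp (Complex.ofRealCLM.comp (coord m)) :=
    hom_ext fun n => by
      simp only [ContinuousLinearMap.comp_apply, ContinuousLinearMap.mul_apply', coefC_apply, h,
        Complex.ofRealCLM_apply, coord_unitVec]
      split_ifs <;> simp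
  simpa only [ContinuousLinearMap.comp_apply, ContinuousLinearMap.mul_apply', coefC_apply,
    Complex.ofRealCLM_apply] using DFunLike.congr_fun this b

lemma coef_cosineSeries (b : Ell) {k : ℤ} (hk : k ≠ 0) :
    coef (cosineSeries c hc b) k = c k.natAbs / 2 * coord k.natAbs b := by
  refine coef_eq_mul_coord (fun n => ?_) b
  rw [cosineSeries_unitVec, coef_continuousMap_smul, coef_cosT]
  by_cases hn : n = k.natAbs
  · subst hn
    rcases Int.natAbs_eq k with h | h
    · rw [if_pos h, if_neg (by omega), if_pos rfl]; ring
    · rw [if_neg (by omega), if_pos h, if_pos rfl]; ring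
  · rw [if_neg (by omega), if_neg (by omega), if_neg hn]; ring

lemma coef_cosineSeries_zero (b : Ell) : coef (cosineSeries c hc b) 0 = c 0 * coord 0 b := by
  refine coef_eq_mul_coord (fun n => ?_) b
  rw [cosineSeries_unitVec, coef_continuousMap_smul, coef_cosT]
  rcases eq_or_ne n 0 with rfl | hn
  · simp
  · rw [if_neg (by omega), if_neg (by omega), if_neg hn]; ring

lemma coef_sineSeries (b : Ell) (k : ℤ) :
    coef (sineSeries c hc b) k = -Complex.I * k.sign * c k.natAbs / 2 * coord k.natAbs b := by
  refine coef_eq_mul_coord (fun n => ?_) b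
  rw [sineSeries_unitVec, coef_continuousMap_smul, coef_sinT]
  by_cases hn : n = k.natAbs
  · subst hn
    rcases lt_trichotomy k 0 with hk | rfl | hk
    · rw [if_neg (by omega), if_pos (by omega), if_pos rfl, Int.sign_eq_neg_one_of_neg hk]
      push_cast; ring
    · simp
    · rw [if_pos (by omega), if_neg (by omega), if_pos rfl, Int.sign_eq_one_of_pos hk]
      push_cast; ring
  · rw [if_neg (by omega), if_neg (by omega), if_neg hn]; ring

end MultiplierSeries

/-- The decay rate `q` of the Fourier coefficients. It is chosen so small that `2 q + q ^ 2 < 1`,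
which makes the generating function in `shiftPoly` invertible. -/
def decay : ℝ := 1 / 4

lemma decay_pos : 0 < decay := by norm_num [decay]

lemma abs_decay_pow_le (n : ℕ) : |decay ^ n| ≤ 1 := by
  rw [abs_of_pos (pow_pos decay_pos n)]
  exact pow_le_one₀ decay_pos.le (by norm_num [decay])

lemma abs_neg_mul_decay_pow_le (n : ℕ) : |-(n * decay ^ n)| ≤ 1 := by
  have : (n : ℝ) ≤ 4 ^ n := by exact_mod_cast (Nat.lt_pow_self (by norm_num)).le
  rw [abs_neg, abs_of_nonneg (mul_nonneg n.cast_nonneg (pow_nonneg decay_pos.le n)), decay,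
    div_pow, one_pow, mul_one_div, div_le_one (by positivity)]
  exact this

lemma abs_inv_nat_le (n : ℕ) : |(n : ℝ)⁻¹| ≤ 1 := by
  rw [abs_of_nonneg (by positivity)]
  exact Nat.cast_inv_le_one n

lemma abs_inv_mul_decay_pow_le (n : ℕ) : |(n : ℝ)⁻¹ * decay ^ n| ≤ 1 := by
  rw [abs_mul]
  exact mul_le_one₀ (abs_inv_nat_le n) (abs_nonneg _) (abs_decay_pow_le n)

/-- The series `∑ bₙ qⁿ cos (n x)`. -/
def cosSeries : Ell →L[ℝ] C(Torus, ℝ) := cosineSeries (fun n => decay ^ n) abs_decay_pow_le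

/-- The termwise derivative `-∑ n bₙ qⁿ sin (n x)` of `cosSeries`. -/
def derivSeries : Ell →L[ℝ] C(Torus, ℝ) :=
  sineSeries (fun n => -(n * decay ^ n)) abs_neg_mul_decay_pow_le

/-- The series `∑ bₙ qⁿ sin (n x)`, the Hilbert transform of `cosSeries`. -/
def sinSeries : Ell →L[ℝ] C(Torus, ℝ) := sineSeries (fun n => decay ^ n) abs_decay_pow_le

/-- The termwise antiderivative `∑ n⁻¹ bₙ qⁿ sin (n x)` of `cosSeries`; the constant term is
dropped, since `0⁻¹ = 0`. -/
def antiderivSeries : Ell →L[ℝ] C(Torus, ℝ) :=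
  sineSeries (fun n => (n : ℝ)⁻¹ * decay ^ n) abs_inv_mul_decay_pow_le

lemma cosSeries_unitVec (n : ℕ) : cosSeries (unitVec n) = decay ^ n • cosT n :=
  cosineSeries_unitVec _ n

lemma derivSeries_unitVec (n : ℕ) : derivSeries (unitVec n) = (-(n * decay ^ n)) • sinT n :=
  sineSeries_unitVec _ n

lemma sinSeries_unitVec (n : ℕ) : sinSeries (unitVec n) = decay ^ n • sinT n :=
  sineSeries_unitVec _ n

lemma cosSeries_neg (b : Ell) (x : Torus) : cosSeries b (-x) = cosSeries b x := by
  have : (ContinuousMap.evalCLM ℝ (-x)).comp cosSeries =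
      (ContinuousMap.evalCLM ℝ x).comp cosSeries :=
    hom_ext fun n => by
      change cosSeries (unitVec n) (-x) = cosSeries (unitVec n) x
      rw [cosSeries_unitVec, ContinuousMap.smul_apply, ContinuousMap.smul_apply, cosT_neg]
  exact DFunLike.congr_fun this b

lemma coef_cosSeries (b : Ell) {k : ℤ} (hk : k ≠ 0) :
    coef (cosSeries b) k = (decay ^ k.natAbs : ℝ) / 2 * coord k.natAbs b :=
  coef_cosineSeries _ b hk

lemma coef_cosSeries_zero (b : Ell) : coef (cosSeries b) 0 = coord 0 b := by
  rw [cosSeries, coef_cosineSeries_zero, pow_zero, Complex.ofReal_one, one_mul]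

lemma coef_derivSeries (b : Ell) (k : ℤ) :
    coef (derivSeries b) k = Complex.I * k * coef (cosSeries b) k := by
  rw [derivSeries, coef_sineSeries]
  rcases eq_or_ne k 0 with rfl | hk
  · simp
  · have hsign : (k.sign : ℂ) * (k.natAbs : ℂ) = k := by
      rw [← Int.cast_natCast (R := ℂ) k.natAbs, ← Int.cast_mul, Int.sign_mul_natAbs]
    rw [coef_cosSeries b hk, ← hsign]
    push_cast
    ring

lemma coef_sinSeries (b : Ell) (k : ℤ) :
    coef (sinSeries b) k = -Complex.I * (k.sign : ℂ) * coef (cosSeries b) k := by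
  rw [sinSeries, coef_sineSeries]
  rcases eq_or_ne k 0 with rfl | hk
  · simp
  · rw [coef_cosSeries b hk]; ring

lemma coef_cosSeries_eq_coef_antiderivSeries (b : Ell) {k : ℤ} (hk : k ≠ 0) :
    coef (cosSeries b) k = Complex.I * k * coef (antiderivSeries b) k := by
  have hsign : (k.sign : ℂ) * k * (k.natAbs : ℂ)⁻¹ = 1 := by
    rw [← Int.cast_mul, Int.sign_mul_self_eq_natAbs, Int.cast_natCast,
      mul_inv_cancel₀ (by exact_mod_cast Int.natAbs_ne_zero.2 hk)]
  rw [antiderivSeries, coef_sineSeries, coef_cosSeries b hk]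
  push_cast
  linear_combination (-(decay ^ k.natAbs / 2 * coord k.natAbs b : ℂ)) *
    (hsign - (k.sign : ℂ) * k * (k.natAbs : ℂ)⁻¹ * Complex.I_sq)

lemma coef_antiderivSeries_zero (b : Ell) : coef (antiderivSeries b) 0 = 0 := by
  rw [antiderivSeries, coef_sineSeries]
  simp

/-- The Fourier multiplier `|n|⁻¹` on the coefficients of `cosSeries`; the constant term is
dropped, since `0⁻¹ = 0`. -/
def invLam : Ell →L[ℝ] Ell := diag (fun n => (n : ℝ)⁻¹) 1 abs_inv_nat_le

lemma coord_invLam (n : ℕ) (b : Ell) : coord n (invLam b) = (n : ℝ)⁻¹ * coord n b :=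
  coord_diag _ n b

lemma derivSeries_invLam (b : Ell) : derivSeries (invLam b) = -sinSeries b := by
  have : derivSeries.comp invLam = -sinSeries := hom_ext fun n => by
    rw [ContinuousLinearMap.comp_apply, invLam, diag_unitVec, map_smul, derivSeries_unitVec,
      neg_apply, sinSeries_unitVec, smul_smul, ← neg_smul]
    rcases eq_or_ne n 0 with rfl | hn
    · exact DFunLike.ext' (Torus.funext fun x => by simp [sinT_coe])
    · congr 1
      field_simp
  exact DFunLike.congr_fun this b

/-! ### Products of cosine series -/

/-- The product of two unit vectors in the algebra of coefficients of cosine series, from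
`cos m x cos n x = (cos (m + n) x + cos (m - n) x) / 2`. In natural numbers,
`m - n + (n - m)` is the distance `|m - n|`. -/
def unitProd (m n : ℕ) : Ell :=
  (1 / 2 : ℝ) • (unitVec (m + n) + decay ^ (2 * min m n) • unitVec (m - n + (n - m)))

lemma norm_unitProd_le (m n : ℕ) : ‖unitProd m n‖ ≤ 1 := by
  have hsum : ‖unitVec (m + n) + decay ^ (2 * min m n) • unitVec (m - n + (n - m))‖ ≤ 1 + 1 := by
    refine (norm_add_le _ _).trans ?_
    rw [norm_unitVec, norm_smul, norm_unitVec, mul_one]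
    gcongr
    exact abs_decay_pow_le _
  rw [unitProd, norm_smul, Real.norm_of_nonneg (by norm_num)]
  linarith

lemma unitProd_comm (m n : ℕ) : unitProd m n = unitProd n m := by
  rw [unitProd, unitProd, add_comm m n, min_comm, add_comm (m - n)]

/-- The product of cosine series, as a bounded bilinear map on `ℓ¹`. -/
def ellMul : Ell →L[ℝ] Ell →L[ℝ] Ell :=
  lift (fun m => lift (fun n => unitProd m n) 1 (norm_unitProd_le m)) 1
    fun m => norm_lift_le (norm_unitProd_le m)

lemma ellMul_unitVec (m n : ℕ) : ellMul (unitVec m) (unitVec n) = unitProd m n := by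
  rw [ellMul, lift_unitVec, lift_unitVec]

lemma ellMul_comm (b c : Ell) : ellMul b c = ellMul c b := by
  have : ellMul = ellMul.flip := bilin_ext fun m n => by
    rw [ContinuousLinearMap.flip_apply, ellMul_unitVec, ellMul_unitVec, unitProd_comm]
  exact DFunLike.congr_fun (DFunLike.congr_fun this b) c

lemma decay_pow_mul_decay_pow_sub {m n : ℕ} (h : m ≤ n) :
    decay ^ (2 * m) * decay ^ (n - m) = decay ^ (m + n) := by
  rw [← pow_add]; congr 1; omega

lemma cosSeries_unitProd (m n : ℕ) :
    cosSeries (unitProd m n) = (decay ^ m • cosT m) * (decay ^ n • cosT n) := by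
  wlog h : m ≤ n generalizing m n
  · rw [unitProd_comm, this n m (le_of_not_ge h)]; exact mul_comm _ _
  refine DFunLike.ext' (Torus.funext fun x => ?_)
  simp only [unitProd, min_eq_left h, Nat.sub_eq_zero_of_le h, zero_add, map_smul, map_add,
    cosSeries_unitVec, ContinuousMap.smul_apply, ContinuousMap.add_apply,
    ContinuousMap.mul_apply, smul_eq_mul, cosT_coe, Int.cast_natCast]
  rw [← mul_assoc (decay ^ (2 * m)), decay_pow_mul_decay_pow_sub h, Nat.cast_sub h, Nat.cast_add,
    add_mul, sub_mul, cos_add, cos_sub, pow_add]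
  ring

lemma derivSeries_unitProd (m n : ℕ) :
    derivSeries (unitProd m n) = ((-(m * decay ^ m)) • sinT m) * (decay ^ n • cosT n) +
      (decay ^ m • cosT m) * ((-(n * decay ^ n)) • sinT n) := by
  wlog h : m ≤ n generalizing m n
  · rw [unitProd_comm, this n m (le_of_not_ge h)]; ring
  refine DFunLike.ext' (Torus.funext fun x => ?_)
  simp only [unitProd, min_eq_left h, Nat.sub_eq_zero_of_le h, zero_add, map_smul, map_add,
    derivSeries_unitVec, ContinuousMap.smul_apply, ContinuousMap.add_apply,
    ContinuousMap.mul_apply, smul_eq_mul, cosT_coe, sinT_coe, Int.cast_natCast]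
  have hsplit : decay ^ (2 * m) * (-(((n - m : ℕ) : ℝ) * decay ^ (n - m)) * sin ((n - m : ℕ) * x)) =
      -((n - m : ℕ) : ℝ) * (decay ^ (2 * m) * decay ^ (n - m)) * sin ((n - m : ℕ) * x) := by ring
  rw [hsplit, decay_pow_mul_decay_pow_sub h, Nat.cast_sub h, Nat.cast_add, add_mul (m : ℝ) n x,
    sub_mul, sin_add, sin_sub, pow_add]
  ring

lemma cosSeries_ellMul (b c : Ell) : cosSeries (ellMul b c) = cosSeries b * cosSeries c := by
  have : (ContinuousLinearMap.compL ℝ Ell Ell _ cosSeries).comp ellMul =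
      (ContinuousLinearMap.mul ℝ C(Torus, ℝ)).bilinearComp cosSeries cosSeries :=
    bilin_ext fun m n => by
      change cosSeries (ellMul (unitVec m) (unitVec n)) =
        cosSeries (unitVec m) * cosSeries (unitVec n)
      rw [ellMul_unitVec, cosSeries_unitProd, cosSeries_unitVec, cosSeries_unitVec]
  exact DFunLike.congr_fun (DFunLike.congr_fun this b) c

lemma derivSeries_ellMul (b c : Ell) :
    derivSeries (ellMul b c) = derivSeries b * cosSeries c + cosSeries b * derivSeries c := by
  have : (ContinuousLinearMap.compL ℝ Ell Ell _ derivSeries).comp ellMul =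
      (ContinuousLinearMap.mul ℝ C(Torus, ℝ)).bilinearComp derivSeries cosSeries +
      (ContinuousLinearMap.mul ℝ C(Torus, ℝ)).bilinearComp cosSeries derivSeries :=
    bilin_ext fun m n => by
      change derivSeries (ellMul (unitVec m) (unitVec n)) =
        derivSeries (unitVec m) * cosSeries (unitVec n) +
        cosSeries (unitVec m) * derivSeries (unitVec n)
      simp only [ellMul_unitVec, derivSeries_unitProd, cosSeries_unitVec, derivSeries_unitVec]
  exact DFunLike.congr_fun (DFunLike.congr_fun this b) c

/-! ### Analyticity of cosine series -/

/-- The left shift on `ℓ¹`. -/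
def shift : Ell →L[ℝ] Ell :=
  lift (fun n => if n = 0 then 0 else unitVec (n - 1)) 1 fun n => by
    split_ifs <;> simp [norm_unitVec]

lemma shift_unitVec_zero : shift (unitVec 0) = 0 := by rw [shift, lift_unitVec, if_pos rfl]

lemma shift_unitVec_succ (n : ℕ) : shift (unitVec (n + 1)) = unitVec n := by
  rw [shift, lift_unitVec, if_neg n.succ_ne_zero, Nat.add_sub_cancel]

lemma norm_shift_le : ‖shift‖ ≤ 1 := norm_lift_le _

/-- The value of a cosine series at the point `x`. -/
def evalSeries (x : ℝ) : Ell →L[ℝ] ℝ := (ContinuousMap.evalCLM ℝ (x : Torus)).comp cosSeries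

lemma evalSeries_apply (x : ℝ) (b : Ell) : evalSeries x b = cosSeries b (x : Torus) := rfl

lemma evalSeries_unitVec (x : ℝ) (n : ℕ) : evalSeries x (unitVec n) = decay ^ n * cos (n * x) := by
  rw [evalSeries_apply, cosSeries_unitVec, ContinuousMap.smul_apply, cosT_coe, Int.cast_natCast,
    smul_eq_mul]

/-- The operator `1 - 2 q cos x T + q² T²`, where `q` is `decay` and `T` the left shift. By
`evalSeries_comp_shiftPoly` it turns the evaluation of cosine series at `x` into an explicit
functional. -/
def shiftPoly (x : ℝ) : Ell →L[ℝ] Ell :=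
  1 - ((2 * decay * cos x) • shift - decay ^ 2 • (shift * shift))

lemma isUnit_shiftPoly (x : ℝ) : IsUnit (shiftPoly x) := by
  refine isUnit_one_sub_of_norm_lt_one ?_
  have hlin : ‖(2 * decay * cos x) • shift‖ ≤ 1 / 2 := by
    have hd : ‖2 * decay‖ = 1 / 2 := by norm_num [decay]
    rw [norm_smul, norm_mul, norm_eq_abs (cos x), hd, mul_assoc]
    linarith [mul_le_one₀ (abs_cos_le_one x) (norm_nonneg shift) norm_shift_le]
  have hquad : ‖decay ^ 2 • (shift * shift)‖ ≤ 1 / 16 := by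
    have hd : ‖decay ^ 2‖ = 1 / 16 := by norm_num [decay]
    rw [norm_smul, hd]
    linarith [(norm_mul_le shift shift).trans
      (mul_le_one₀ norm_shift_le (norm_nonneg shift) norm_shift_le)]
  linarith [norm_sub_le ((2 * decay * cos x) • shift) (decay ^ 2 • (shift * shift))]

/- The Chebyshev recurrence `cos (n + 2) x = 2 cos x cos (n + 1) x - cos n x` kills all modes
`n ≥ 2`. -/
lemma evalSeries_comp_shiftPoly (x : ℝ) :
    (evalSeries x).comp (shiftPoly x) = (coord 0).comp (1 - (decay * cos x) • shift) := by
  refine hom_ext fun n => ?_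
  simp only [shiftPoly, ContinuousLinearMap.comp_apply, sub_apply, one_apply_eq_self,
    smul_apply, mul_apply_eq_comp, map_sub, map_smul, smul_eq_mul]
  rcases n with _ | _ | n
  · simp [shift_unitVec_zero, evalSeries_unitVec, coord_unitVec]
  · simp only [shift_unitVec_succ, shift_unitVec_zero, evalSeries_unitVec, coord_unitVec, map_zero]
    simp
    ring
  · simp only [shift_unitVec_succ, evalSeries_unitVec, coord_unitVec, Nat.add_eq_zero_iff,
      one_ne_zero, and_false, if_false]
    push_cast
    have hup : ((n : ℝ) + 1 + 1) * x = (n + 1) * x + x := by ring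
    have hdown : (n : ℝ) * x = (n + 1) * x - x := by ring
    rw [hup, hdown, cos_add, cos_sub]
    ring

lemma evalSeries_eq (x : ℝ) :
    evalSeries x = (coord 0).comp ((1 - (decay * cos x) • shift) * Ring.inverse (shiftPoly x)) := by
  have h := congrArg (fun S : Ell →L[ℝ] ℝ => S.comp (Ring.inverse (shiftPoly x)))
    (evalSeries_comp_shiftPoly x)
  have hinv : (shiftPoly x).comp (Ring.inverse (shiftPoly x)) = 1 :=
    Ring.mul_inverse_cancel _ (isUnit_shiftPoly x)
  simp only [ContinuousLinearMap.comp_assoc, hinv] at h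
  exact h

lemma contDiff_evalSeries : ContDiff ℝ ω evalSeries := by
  rw [show evalSeries = fun x => (coord 0).comp
    ((1 - (decay * cos x) • shift) * Ring.inverse (shiftPoly x)) from funext evalSeries_eq]
  have hpoly : ContDiff ℝ ω shiftPoly := by unfold shiftPoly; fun_prop
  have hinv : ContDiff ℝ ω fun x => Ring.inverse (shiftPoly x) :=
    contDiff_iff_contDiffAt.2 fun x => by
      obtain ⟨y, hy⟩ := isUnit_shiftPoly x
      exact ContDiffAt.comp x (by rw [← hy]; exact contDiffAt_ringInverse ℝ y) hpoly.contDiffAt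
  have hnum : ContDiff ℝ ω fun x => (1 : Ell →L[ℝ] Ell) - (decay * cos x) • shift := by fun_prop
  exact contDiff_const.clm_comp (hnum.mul hinv)

lemma intervalIntegral_coe_torus (f : Torus → ℝ) :
    ∫ x in (0 : ℝ)..(2 * π), f (x : Torus) = 2 * π * ∫ x, f x ∂torusMeasure := by
  have h := AddCircle.intervalIntegral_preimage (2 * π) 0 f
  rw [zero_add] at h
  rw [h, AddCircle.integral_haarAddCircle, smul_eq_mul, ← mul_assoc,
    mul_inv_cancel₀ Real.two_pi_pos.ne', one_mul]

lemma integral_cosSeries_sub_coord_zero (b : Ell) :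
    ∫ x, (cosSeries b x - coord 0 b) ∂torusMeasure = 0 := by
  have h := coef_cosSeries_zero b
  rw [coef_zero_eq_integral] at h
  rw [integral_sub ((memLp_of_continuous (cosSeries b).continuous).integrable (by norm_num))
    (integrable_const _), Complex.ofReal_inj.1 h, integral_const, probReal_univ,
    one_smul, sub_self]

/-- The cosine series of `b` without its constant term, as a smooth function of mean zero. -/
def seriesZero (b : Ell) : SmoothZero where
  toFun := fun x => evalSeries x b - coord 0 b
  smooth := ((contDiff_evalSeries.of_le le_top).clm_apply contDiff_const).sub contDiff_const
  periodic := fun x => by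
    simp only [evalSeries_apply]
    rw [AddCircle.coe_add_period]
  mean_zero := by
    have h := intervalIntegral_coe_torus fun x => cosSeries b x - coord 0 b
    rw [integral_cosSeries_sub_coord_zero, mul_zero] at h
    exact h

lemma seriesZero_fn (b : Ell) (x : Torus) : (seriesZero b).fn x = cosSeries b x - coord 0 b := by
  induction x using QuotientAddGroup.induction_on with
  | H x => rfl

lemma coef_sub_const (f : C(Torus, ℝ)) (c : ℝ) {n : ℤ} (hn : n ≠ 0) :
    coef (fun x => f x - c) n = coef f n := by
  have h : (fun x => f x - c) = (f - c • cosT 0 : C(Torus, ℝ)) := by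
    funext x
    change _ = f x - c * (fourier 0 x : ℂ).re
    rw [fourier_zero, Complex.one_re, mul_one]
  rw [h, ← coefC_apply, map_sub, map_smul, coefC_apply, coefC_apply, coef_cosT]
  simp [hn]

lemma SmoothZero.coef_zero (w : SmoothZero) : coef w.fn 0 = 0 := by
  have hint : ∫ x in (0 : ℝ)..(2 * π), w.fn (x : Torus) = 0 := w.mean_zero
  rw [intervalIntegral_coe_torus] at hint
  rw [coef_zero_eq_integral, (mul_eq_zero.1 hint).resolve_left Real.two_pi_pos.ne',
    Complex.ofReal_zero]

lemma coef_seriesZero (b : Ell) {n : ℤ} (hn : n ≠ 0) :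
    coef (seriesZero b).fn n = coef (cosSeries b) n := by
  rw [funext (seriesZero_fn b), coef_sub_const _ _ hn]

lemma seriesZero_diff_fn (b : Ell) : (seriesZero b).diff.fn = derivSeries b := by
  refine eq_of_coef_eq (SmoothZero.continuous_fn _) (derivSeries b).continuous fun n => ?_
  rw [SmoothZero.coef_diff, coef_derivSeries]
  rcases eq_or_ne n 0 with rfl | hn
  · simp
  · rw [coef_seriesZero b hn]

/-! ### The branch of traveling waves -/

lemma exists_analytic_curve_eq_smul {Y : Type*} [NormedAddCommGroup Y] [NormedSpace ℝ Y]
    [CompleteSpace Y] {G : Y → Y} (hG : ContDiff ℝ ω G) :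
    ∃ δ > 0, ∃ W : ℝ → Y, W 0 = 0 ∧ ∀ ε ∈ Ioo (-δ) δ, ContDiffAt ℝ ω W ε ∧ W ε = ε • G (W ε) := by
  let F : ℝ × Y → Y := fun p => p.2 - p.1 • G p.2
  have hF : ContDiff ℝ ω F := contDiff_snd.sub (contDiff_fst.smul (hG.comp contDiff_snd))
  have hFd : fderiv ℝ F ((0 : ℝ), (0 : Y)) ∘L .inr ℝ ℝ Y = .id ℝ Y := by
    have hcomp := ((hF.differentiable (by simp)) ((0 : ℝ), (0 : Y))).hasFDerivAt.comp (0 : Y)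
      (ContinuousLinearMap.inr ℝ ℝ Y).hasFDerivAt
    have hid : F ∘ Prod.mk 0 = id := by
      funext w
      change w - (0 : ℝ) • G w = w
      rw [zero_smul, sub_zero]
    rw [hid] at hcomp
    exact hcomp.unique (hasFDerivAt_id _)
  have hinv : (fderiv ℝ F ((0 : ℝ), (0 : Y)) ∘L .inr ℝ ℝ Y).IsInvertible := by
    rw [hFd]; exact ⟨ContinuousLinearEquiv.refl ℝ Y, rfl⟩
  have hω : (ω : WithTop ℕ∞) ≠ 0 := by simp
  have hF0 : ContDiffAt ℝ ω F (0, 0) := hF.contDiffAt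
  let W := hF0.implicitFunction hω hinv
  have hWsmooth : ∀ᶠ ε in 𝓝 (0 : ℝ), ContDiffAt ℝ ω W ε :=
    (hF0.contDiffAt_implicitFunction hω hinv).eventually (by simp)
  obtain ⟨δ, hδ, h⟩ := Metric.eventually_nhds_iff_ball.1
    ((hF0.eventually_apply_implicitFunction hω hinv).and hWsmooth)
  refine ⟨δ, hδ, W, hF0.implicitFunction_apply_self hω hinv, fun ε hε => ?_⟩
  have hball : ε ∈ Metric.ball (0 : ℝ) δ := by rwa [Real.ball_eq_Ioo, zero_sub, zero_add]
  have hzero : W ε - ε • G (W ε) = (0 : Y) - (0 : ℝ) • G 0 := (h ε hball).1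
  rw [zero_smul, sub_zero, sub_eq_zero] at hzero
  exact ⟨(h ε hball).2, hzero⟩

/-- The sequence of the function `cos x`. -/
def cosVec : Ell := decay⁻¹ • unitVec 1

/-- The inverse of the multiplier `1 - |n|⁻¹` on the modes `n ≥ 2`; the modes `0` and `1` are
dropped. -/
def modeInv : Ell →L[ℝ] Ell :=
  diag (fun n => if n ≤ 1 then 0 else (n : ℝ) / (n - 1)) 2 fun n => by
    split_ifs with h
    · rw [abs_zero]; exact zero_le_two
    · have : (2 : ℝ) ≤ n := by exact_mod_cast (by omega : 2 ≤ n)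
      rw [abs_of_nonneg (div_nonneg (by linarith) (by linarith)), div_le_iff₀ (by linarith)]
      linarith

lemma coord_modeInv_of_le_one {n : ℕ} (hn : n ≤ 1) (b : Ell) : coord n (modeInv b) = 0 := by
  rw [modeInv, coord_diag, if_pos hn, zero_mul]

lemma coord_modeInv_mul {n : ℕ} (hn : 2 ≤ n) (b : Ell) :
    (1 - (n : ℝ)⁻¹) * coord n (modeInv b) = coord n b := by
  have h2 : (2 : ℝ) ≤ n := by exact_mod_cast hn
  have h0 : (n : ℝ) ≠ 0 := by positivity
  have h1 : (n : ℝ) - 1 ≠ 0 := by linarith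
  rw [modeInv, coord_diag, if_neg (by omega)]
  field_simp

/-- Half the square of the profile `cos x + w`. -/
def halfSq (w : Ell) : Ell := (1 / 2 : ℝ) • ellMul (cosVec + w) (cosVec + w)

/-- The right hand side of the fixed point equation `w = ε G(w)` for the profile `cos x + w`
of a wave of amplitude `ε`. It is the wave equation solved for the modes `n ≥ 2`, after the mode
`1` has been used to express the velocity by `w`. -/
def profileMap (w : Ell) : Ell :=
  modeInv ((decay * coord 1 (halfSq w)) • w - halfSq w)

lemma contDiff_halfSq : ContDiff ℝ ω halfSq := by
  have h : ContDiff ℝ ω fun w : Ell => cosVec + w := contDiff_const.add contDiff_id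
  exact ((ellMul.contDiff.comp h).clm_apply h).const_smul (1 / 2 : ℝ)

lemma contDiff_profileMap : ContDiff ℝ ω profileMap :=
  modeInv.contDiff.comp (((contDiff_const.mul ((coord 1).contDiff.comp contDiff_halfSq)).smul
    contDiff_id).sub contDiff_halfSq)

/-- `ε ↦ (b ε, ν ε)` describes the branch of traveling waves: the wave is the cosine series of
`ε • b ε` and its velocity is `ν ε`. -/
structure IsProfile (δ : ℝ) (b : ℝ → Ell) (ν : ℝ → ℝ) : Prop where
  pos : 0 < δ
  smooth : ∀ ε ∈ Ioo (-δ) δ, ContDiffAt ℝ ω b ε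
  smooth_vel : ∀ ε ∈ Ioo (-δ) δ, ContDiffAt ℝ ω ν ε
  at_zero : b 0 = cosVec
  vel_zero : ν 0 = -1
  coord_zero : ∀ ε ∈ Ioo (-δ) δ, coord 0 (b ε) = 0
  coord_one : ∀ ε ∈ Ioo (-δ) δ, coord 1 (b ε) = decay⁻¹
  eqn : ∀ ε ∈ Ioo (-δ) δ, ∃ κ : ℝ, (1 / 2 : ℝ) • ellMul (ε • b ε) (ε • b ε) - invLam (ε • b ε)
    - ν ε • (ε • b ε) = κ • unitVec 0

lemma coord_cosVec (n : ℕ) : coord n cosVec = if n = 1 then decay⁻¹ else 0 := by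
  rw [cosVec, map_smul, coord_unitVec, smul_eq_mul, mul_ite, mul_one, mul_zero]
  exact if_congr eq_comm rfl rfl

lemma coord_eq_zero_of_eq_smul_profileMap {ε : ℝ} {w : Ell} (hw : w = ε • profileMap w)
    {n : ℕ} (hn : n ≤ 1) : coord n w = 0 := by
  rw [hw, map_smul, profileMap, coord_modeInv_of_le_one hn, smul_zero]

lemma coord_mul_of_eq_smul_profileMap {ε : ℝ} {w : Ell} (hw : w = ε • profileMap w) {n : ℕ}
    (hn : 2 ≤ n) : (1 - (n : ℝ)⁻¹) * coord n w =
      ε * (decay * coord 1 (halfSq w) * coord n w - coord n (halfSq w)) := by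
  have h := congrArg (fun z => (1 - (n : ℝ)⁻¹) * coord n z) hw
  simp only [map_smul, smul_eq_mul, profileMap] at h
  rw [mul_left_comm, coord_modeInv_mul hn, map_sub, map_smul, smul_eq_mul] at h
  exact h

lemma profile_eqn_of_eq_smul_profileMap {ε : ℝ} {w : Ell} (hw : w = ε • profileMap w) :
    (1 / 2 : ℝ) • ellMul (ε • (cosVec + w)) (ε • (cosVec + w)) - invLam (ε • (cosVec + w)) -
        (-1 + ε * (decay * coord 1 (halfSq w))) • (ε • (cosVec + w)) =
      coord 0 (ε ^ 2 • halfSq w) • unitVec 0 := by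
  have hsq : (1 / 2 : ℝ) • ellMul (ε • (cosVec + w)) (ε • (cosVec + w)) = ε ^ 2 • halfSq w := by
    simp only [halfSq, map_smul, smul_apply, smul_smul]
    congr 1; ring
  rw [hsq]
  refine ext_coord fun n => ?_
  simp only [map_sub, map_smul, map_add, coord_invLam, coord_unitVec, coord_cosVec,
    smul_eq_mul]
  have hd := decay_pos.ne'
  rcases n with _ | _ | n
  · simp [coord_eq_zero_of_eq_smul_profileMap hw zero_le_one]
  · simp only [coord_eq_zero_of_eq_smul_profileMap hw le_rfl, zero_add]
    simp
    field_simp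
    ring
  · have h := coord_mul_of_eq_smul_profileMap hw (n := n + 1 + 1) (by omega)
    simp only [Nat.add_eq_right, Nat.add_eq_zero_iff, one_ne_zero, and_false, if_false, zero_add,
      reduceCtorEq, mul_zero]
    linear_combination ε * h

lemma exists_isProfile : ∃ δ b ν, IsProfile δ b ν := by
  obtain ⟨δ, hδ, W, hW0, hW⟩ := exists_analytic_curve_eq_smul contDiff_profileMap
  have hcoord : ∀ ε ∈ Ioo (-δ) δ, ∀ n ≤ 1, coord n (cosVec + W ε) = coord n cosVec :=
    fun ε hε n hn => by
      rw [map_add, coord_eq_zero_of_eq_smul_profileMap (hW ε hε).2 hn, add_zero]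
  refine ⟨δ, fun ε => cosVec + W ε, fun ε => -1 + ε * (decay * coord 1 (halfSq (W ε))), ?_⟩
  exact
    { pos := hδ
      smooth := fun ε hε => contDiffAt_const.add (hW ε hε).1
      smooth_vel := fun ε hε => by
        have h : ContDiffAt ℝ ω (fun ε => coord 1 (halfSq (W ε))) ε :=
          (coord 1).contDiff.contDiffAt.comp ε (contDiff_halfSq.contDiffAt.comp ε (hW ε hε).1)
        exact contDiffAt_const.add (contDiffAt_id.mul (contDiffAt_const.mul h))
      at_zero := by rw [hW0, add_zero]
      vel_zero := by rw [zero_mul, add_zero]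
      coord_zero := fun ε hε => by
        rw [hcoord ε hε 0 zero_le_one, coord_cosVec, if_neg zero_ne_one]
      coord_one := fun ε hε => by rw [hcoord ε hε 1 le_rfl, coord_cosVec, if_pos rfl]
      eqn := fun ε hε => ⟨_, profile_eqn_of_eq_smul_profileMap (hW ε hε).2⟩ }

lemma integral_mul_cosT_one {f : Torus → ℝ} (hf : Continuous f) :
    ((2 * ∫ x, f x * cosT 1 x ∂torusMeasure : ℝ) : ℂ) = coef f 1 + coef f (-1) := by
  have hi : ∀ n : ℤ, Integrable (fun x : Torus => fourier n x • (f x : ℂ)) torusMeasure := fun n =>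
    Continuous.integrable_of_hasCompactSupport (by fun_prop) (HasCompactSupport.of_compactSpace _)
  rw [coef, coef, fourierCoeff, fourierCoeff, ← integral_add (hi _) (hi _), ← integral_const_mul,
    ← integral_complex_ofReal]
  congr 1
  funext x
  change ((2 * (f x * (fourier 1 x : ℂ).re) : ℝ) : ℂ) = _
  rw [neg_neg, fourier_neg, smul_eq_mul, smul_eq_mul, Complex.ofReal_mul,
    Complex.ofReal_mul, Complex.re_eq_add_conj]
  push_cast
  ring

lemma SmoothZero.amplitude_eq (w : SmoothZero) :
    (((1 / π) * ∫ x in (0 : ℝ)..(2 * π), w x * cos x : ℝ) : ℂ) = coef w.fn 1 + coef w.fn (-1) := by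
  have h : ∫ x in (0 : ℝ)..(2 * π), w x * cos x =
      2 * π * ∫ x, w.fn x * cosT 1 x ∂torusMeasure := by
    rw [← intervalIntegral_coe_torus fun x => w.fn x * cosT 1 x]
    congr 1
    funext x
    rw [cosT_coe, Int.cast_one, one_mul]; rfl
  rw [← integral_mul_cosT_one w.continuous_fn, h]
  congr 1
  field_simp

lemma SmoothZero.coef_neg_of_even (w : SmoothZero) (h : ∀ x, w (-x) = w x) (n : ℤ) :
    coef w.fn (-n) = coef w.fn n := by
  rw [← coef_comp_neg]
  congr 1
  exact Torus.funext h

lemma SmoothZero.ext {w z : SmoothZero} (h : ∀ x, w x = z x) : w = z := by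
  cases w; cases z
  congr
  exact funext h

lemma derivSeries_unitVec_zero : derivSeries (unitVec 0) = 0 := by
  rw [derivSeries_unitVec]
  simp

namespace IsProfile

variable {δ : ℝ} {b : ℝ → Ell} {ν : ℝ → ℝ}

lemma coord_zero_wave (h : IsProfile δ b ν) {ε : ℝ} (hε : ε ∈ Ioo (-δ) δ) :
    coord 0 (ε • b ε) = 0 := by
  rw [map_smul, h.coord_zero ε hε, smul_zero]

lemma fn_eq (h : IsProfile δ b ν) {ε : ℝ} (hε : ε ∈ Ioo (-δ) δ) :
    (seriesZero (ε • b ε)).fn = cosSeries (ε • b ε) := by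
  funext x
  rw [seriesZero_fn, h.coord_zero_wave hε, sub_zero]

lemma wave_eq (h : IsProfile δ b ν) {ε : ℝ} (hε : ε ∈ Ioo (-δ) δ) :
    ν ε • derivSeries (ε • b ε) - cosSeries (ε • b ε) * derivSeries (ε • b ε) =
      sinSeries (ε • b ε) := by
  obtain ⟨κ, hκ⟩ := h.eqn ε hε
  generalize ε • b ε = A at hκ ⊢
  have hder := congrArg derivSeries hκ
  rw [map_sub, map_sub, map_smul _ κ, derivSeries_unitVec_zero, smul_zero, map_smul,
    derivSeries_ellMul, derivSeries_invLam, map_smul _ (ν ε), mul_comm (derivSeries A),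
    ← two_smul ℝ, smul_smul, one_div_mul_cancel two_ne_zero, one_smul, sub_eq_zero] at hder
  rw [← hder]
  abel

lemma coef_wave_one (h : IsProfile δ b ν) {ε : ℝ} (hε : ε ∈ Ioo (-δ) δ) :
    coef (cosSeries (ε • b ε)) 1 = ((ε / 2 : ℝ) : ℂ) := by
  have hcos := coef_cosSeries (ε • b ε) one_ne_zero
  rw [Int.natAbs_one, map_smul (coord 1), h.coord_one ε hε, smul_eq_mul] at hcos
  have hd : (decay : ℂ) ≠ 0 := by exact_mod_cast decay_pos.ne'
  rw [hcos]
  push_cast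
  field_simp

lemma isBifurcationCurve (h : IsProfile δ b ν) :
    IsBifurcationCurve δ (fun ε => seriesZero (ε • b ε)) ν where
  pos := h.pos
  analytic_u := by
    rintro ⟨ε, x⟩ ⟨hε, -⟩
    have hb : ContDiffAt ℝ ω (fun p : ℝ × ℝ => p.1 • b p.1) (ε, x) :=
      contDiffAt_fst.smul ((h.smooth ε hε).comp (ε, x) contDiffAt_fst)
    have heval : ContDiffAt ℝ ω (fun p : ℝ × ℝ => evalSeries p.2) (ε, x) :=
      contDiff_evalSeries.contDiffAt.comp (ε, x) contDiffAt_snd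
    exact ((heval.clm_apply hb).sub ((coord 0).contDiff.contDiffAt.comp _ hb)).analyticAt
  analytic_v := fun ε hε => (h.smooth_vel ε hε).analyticAt
  u_zero := fun x => by
    change evalSeries x ((0 : ℝ) • b 0) - coord 0 ((0 : ℝ) • b 0) = 0
    rw [zero_smul, map_zero, map_zero, sub_zero]
  v_zero := h.vel_zero
  wave := fun ε hε n => by
    rw [h.fn_eq hε, seriesZero_diff_fn, ← coef_sinSeries, ← h.wave_eq hε]
    rfl
  even := fun ε _ x => congrArg (· - coord 0 (ε • b ε)) (cosSeries_neg _ (x : Torus))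
  amplitude := fun ε hε => by
    have hneg : coef (cosSeries (ε • b ε)) (-1) = ((ε / 2 : ℝ) : ℂ) := by
      rw [← coef_comp_neg, funext (cosSeries_neg _), h.coef_wave_one hε]
    rw [← Complex.ofReal_inj, SmoothZero.amplitude_eq, h.fn_eq hε, h.coef_wave_one hε, hneg,
      ← Complex.ofReal_add, add_halves]

end IsProfile

/-! ### Uniqueness of the branch -/

/-- The function `w² / 2` minus its mean; it is the flux of the Burgers equation. -/
def SmoothZero.flux (w : SmoothZero) : SmoothZero where
  toFun := fun x => w x ^ 2 / 2 - (2 * π)⁻¹ * ∫ y in (0 : ℝ)..(2 * π), w y ^ 2 / 2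
  smooth := ((w.smooth.pow 2).div_const 2).sub contDiff_const
  periodic := fun x => by simp only [w.periodic x]
  mean_zero := by
    have hc : Continuous fun x => w x ^ 2 / 2 := (w.smooth.continuous.pow 2).div_const 2
    rw [intervalIntegral.integral_sub (hc.intervalIntegrable _ _) (by simp),
      intervalIntegral.integral_const, smul_eq_mul, sub_zero, ← mul_assoc,
      mul_inv_cancel₀ Real.two_pi_pos.ne', one_mul, sub_self]

lemma SmoothZero.flux_diff_fn (w : SmoothZero) :
    w.flux.diff.fn = fun x => w.fn x * w.diff.fn x :=
  Torus.funext fun x => by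
    have hw : HasDerivAt w (deriv w x) x := ((w.smooth.differentiable (by simp)) x).hasDerivAt
    refine (((hw.pow 2).div_const 2).sub_const _).deriv.trans ?_
    change _ = w x * deriv w x
    push_cast
    ring

lemma SmoothZero.coef_flux (w : SmoothZero) {n : ℤ} (hn : n ≠ 0) :
    coef w.flux.fn n = (1 / 2) * coef (fun x => w.fn x ^ 2) n := by
  let sq : C(Torus, ℝ) := ⟨fun x => w.fn x ^ 2, w.continuous_fn.pow 2⟩
  have h : w.flux.fn = fun x => ((1 / 2 : ℝ) • sq) x -
      (2 * π)⁻¹ * ∫ y in (0 : ℝ)..(2 * π), w y ^ 2 / 2 :=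
    Torus.funext fun x => by
      change w x ^ 2 / 2 - _ = (1 / 2) * w x ^ 2 - _
      ring
  rw [h, coef_sub_const _ _ hn, coef_continuousMap_smul]
  push_cast
  rfl

/-- `w` as a continuous function on the torus. -/
def SmoothZero.toC (w : SmoothZero) : C(Torus, ℝ) := ⟨w.fn, w.continuous_fn⟩

lemma intCast_sign_eq_mul_inv_abs {n : ℤ} (hn : n ≠ 0) :
    (n.sign : ℂ) = n * ((1 / |(n : ℝ)| : ℝ) : ℂ) := by
  have h : (n.sign : ℝ) = n * (1 / |(n : ℝ)|) := by
    have hn' : |(n : ℝ)| ≠ 0 := abs_ne_zero.2 (by exact_mod_cast hn)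
    field_simp
    exact_mod_cast Int.sign_mul_abs n
  exact_mod_cast h

lemma IsTravelingWave.coef_sq {u : SmoothZero} {v : ℝ} (h : IsTravelingWave u v) {n : ℤ}
    (hn : n ≠ 0) :
    (v + 1 / |(n : ℝ)| : ℝ) * coef u.fn n = (1 / 2) * coef (fun x => u.fn x ^ 2) n := by
  have hflux : (fun x => v * u.diff.fn x - u.fn x * u.diff.fn x) =
      (v • u.diff.toC - u.flux.diff.toC : C(Torus, ℝ)) := by
    funext x
    change _ = v * u.diff.fn x - u.flux.diff.fn x
    rw [u.flux_diff_fn]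
  have hwave := h n
  rw [hflux, ← coefC_apply, map_sub, map_smul, coefC_apply, coefC_apply] at hwave
  change (v : ℝ) • coef u.diff.fn n - coef u.flux.diff.fn n = _ at hwave
  rw [SmoothZero.coef_diff, SmoothZero.coef_diff, u.coef_flux hn, Complex.real_smul,
    intCast_sign_eq_mul_inv_abs hn] at hwave
  apply mul_left_cancel₀ (mul_ne_zero Complex.I_ne_zero (Int.cast_ne_zero.2 hn))
  push_cast at hwave ⊢
  linear_combination hwave

/-- The embedding of continuous functions into `L²`. -/
abbrev contToLp : C(Torus, ℝ) →L[ℝ] Lp ℝ 2 torusMeasure := ContinuousMap.toLp 2 torusMeasure ℝ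

lemma norm_contToLp_mul_le {f g : C(Torus, ℝ)} {K : ℝ} (hf : ∀ x, |f x| ≤ K) :
    ‖contToLp (f * g)‖ ≤ K * ‖contToLp g‖ := by
  refine Lp.norm_le_mul_norm_of_ae_le_mul ?_
  filter_upwards [ContinuousMap.coeFn_toLp (p := 2) (𝕜 := ℝ) torusMeasure (f * g),
    ContinuousMap.coeFn_toLp (p := 2) (𝕜 := ℝ) torusMeasure g] with x hfg hg
  rw [hfg, hg, ContinuousMap.mul_apply, norm_mul]
  exact mul_le_mul_of_nonneg_right (hf x) (norm_nonneg _)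

lemma norm_contToLp_le {f : C(Torus, ℝ)} {K : ℝ} (hf : ∀ x, |f x| ≤ K) : ‖contToLp f‖ ≤ K := by
  have h := Lp.norm_le_of_ae_bound (f := contToLp f) ((abs_nonneg _).trans (hf 0)) <|
    (ContinuousMap.coeFn_toLp (p := 2) (𝕜 := ℝ) torusMeasure f).mono fun x hx => by
      rw [hx]; exact hf x
  rwa [measureUnivNNReal, measure_univ, ENNReal.toNNReal_one, NNReal.coe_one,
    Real.one_rpow, one_mul] at h

lemma norm_le_of_norm_coef_le {f g : Lp ℝ 2 torusMeasure} {C : ℝ} (hC : 0 ≤ C)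
    (h : ∀ n, ‖coef f n‖ ≤ C * ‖coef g n‖) : ‖f‖ ≤ C * ‖g‖ := by
  have hsq := hasSum_le (fun n => by
    rw [← mul_pow]; exact pow_le_pow_left₀ (norm_nonneg _) (h n) 2)
    (hasSum_norm_coef_sq f) ((hasSum_norm_coef_sq g).mul_left (C ^ 2))
  rw [← mul_pow] at hsq
  exact le_of_sq_le_sq hsq (by positivity)

lemma contToLp_injective : Function.Injective contToLp :=
  ContinuousMap.toLp_injective (p := 2) (𝕜 := ℝ) torusMeasure

/-- The right-hand side of the equation for the difference of two traveling waves `U`, `W` whose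
velocities differ by `s`. -/
def waveDiffRhs (U W : C(Torus, ℝ)) (s : ℝ) : C(Torus, ℝ) :=
  ((1 / 2 : ℝ) • (U + W)) * (U - W) - s • W

lemma IsTravelingWave.coefC_sub {u w : SmoothZero} {v z : ℝ} (hu : IsTravelingWave u v)
    (hw : IsTravelingWave w z) {n : ℤ} (hn : n ≠ 0) :
    ((v + 1 / |(n : ℝ)| : ℝ) : ℂ) * coefC n (u.toC - w.toC) =
      coefC n (waveDiffRhs u.toC w.toC (v - z)) := by
  have hsq : ((1 / 2 : ℝ) • (u.toC + w.toC)) * (u.toC - w.toC) =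
      (1 / 2 : ℝ) • (u.toC ^ 2) - (1 / 2 : ℝ) • (w.toC ^ 2) := by
    ext x
    change (1 / 2) * (u.fn x + w.fn x) * (u.fn x - w.fn x) =
      (1 / 2) * u.fn x ^ 2 - (1 / 2) * w.fn x ^ 2
    ring
  have hu' := hu.coef_sq hn
  have hw' := hw.coef_sq hn
  have hcoef (s : SmoothZero) : coefC n s.toC = coef s.fn n := coefC_apply n s.toC
  have hcoef_sq (s : SmoothZero) : coefC n (s.toC ^ 2) = coef (fun x => s.fn x ^ 2) n :=
    coefC_apply n (s.toC ^ 2)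
  rw [waveDiffRhs, hsq, map_sub, map_sub, map_sub, map_smul, map_smul, map_smul, hcoef, hcoef,
    hcoef_sq, hcoef_sq, Complex.real_smul, Complex.real_smul, Complex.real_smul]
  push_cast at hu' hw' ⊢
  linear_combination hu' - hw'

/- The symbol `v + 1 / |n|` vanishes near `v = -1` only for `|n| = 1`. -/
lemma norm_contToLp_le_of_symbol {d R : C(Torus, ℝ)} {v : ℝ} (hv : |v + 1| ≤ 1 / 4)
    (hd : ∀ n : ℤ, |n| ≤ 1 → coefC n d = 0)
    (hR : ∀ n : ℤ, n ≠ 0 → ((v + 1 / |(n : ℝ)| : ℝ) : ℂ) * coefC n d = coefC n R) :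
    ‖contToLp d‖ ≤ 4 * ‖contToLp R‖ := by
  refine norm_le_of_norm_coef_le (by norm_num) fun n => ?_
  change ‖coefC n d‖ ≤ 4 * ‖coefC n R‖
  rcases le_or_gt |n| 1 with hn | hn
  · rw [hd n hn, norm_zero]
    positivity
  have hinv : 1 / |(n : ℝ)| ≤ 1 / 2 :=
    one_div_le_one_div_of_le (by norm_num) (by exact_mod_cast hn)
  have hsymbol : 1 / 4 ≤ |v + 1 / (|(n : ℝ)|)| := by
    rw [le_abs]; right
    linarith [(abs_le.1 hv).2]
  rw [← hR n (by rintro rfl; simp at hn), norm_mul, Complex.norm_real, norm_eq_abs]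
  nlinarith [norm_nonneg (coefC n d)]

section TwoWaves

variable {u w : SmoothZero} {v z ε K : ℝ}

lemma norm_half_add_mul_sub_le (hub : ∀ x, |u.fn x| ≤ K * |ε|) (hwb : ∀ x, |w.fn x| ≤ K * |ε|) :
    ‖contToLp (((1 / 2 : ℝ) • (u.toC + w.toC)) * (u.toC - w.toC))‖ ≤
      K * |ε| * ‖contToLp (u.toC - w.toC)‖ := by
  refine norm_contToLp_mul_le fun x => ?_
  change |(1 / 2) * (u.fn x + w.fn x)| ≤ _
  rw [abs_mul, abs_of_nonneg (by norm_num : (0 : ℝ) ≤ 1 / 2)]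
  linarith [abs_add_le (u.fn x) (w.fn x), hub x, hwb x]

lemma abs_velocity_sub_le (hε : ε ≠ 0) (hu : IsTravelingWave u v) (hw : IsTravelingWave w z)
    (hu1 : coef u.fn 1 = (ε / 2 : ℝ)) (hw1 : coef w.fn 1 = (ε / 2 : ℝ))
    (hub : ∀ x, |u.fn x| ≤ K * |ε|) (hwb : ∀ x, |w.fn x| ≤ K * |ε|) :
    |v - z| ≤ 2 * K * ‖contToLp (u.toC - w.toC)‖ := by
  have hd : coefC 1 (u.toC - w.toC) = 0 := by
    rw [map_sub, coefC_apply, coefC_apply]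
    exact sub_eq_zero.2 (hu1.trans hw1.symm)
  have heq := hu.coefC_sub hw one_ne_zero
  rw [hd, mul_zero, waveDiffRhs, map_sub, map_smul, eq_comm, sub_eq_zero,
    coefC_apply 1 w.toC] at heq
  have hQ := (norm_coef_le (contToLp _) 1).trans (norm_half_add_mul_sub_le hub hwb)
  change ‖coefC 1 _‖ ≤ _ at hQ
  rw [heq] at hQ
  change ‖(v - z) • coef w.fn 1‖ ≤ _ at hQ
  rw [hw1, norm_smul, Complex.norm_real, norm_eq_abs, norm_eq_abs, abs_div, abs_two] at hQ
  have hcancel : |ε| * (|v - z| / 2) ≤ |ε| * (K * ‖contToLp (u.toC - w.toC)‖) := by linarith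
  linarith [le_of_mul_le_mul_left hcancel (abs_pos.2 hε)]

lemma IsTravelingWave.eq_of_amplitude_eq (hε : ε ≠ 0) (hK : 0 ≤ K) (hu : IsTravelingWave u v)
    (hw : IsTravelingWave w z) (hu1 : ∀ n : ℤ, |n| = 1 → coef u.fn n = (ε / 2 : ℝ))
    (hw1 : ∀ n : ℤ, |n| = 1 → coef w.fn n = (ε / 2 : ℝ))
    (hub : ∀ x, |u.fn x| ≤ K * |ε|) (hwb : ∀ x, |w.fn x| ≤ K * |ε|) (hv : |v + 1| ≤ 1 / 4)
    (hsmall : 4 * (K + 2 * K ^ 2) * |ε| < 1) : u.fn = w.fn ∧ v = z := by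
  have hvz := abs_velocity_sub_le hε hu hw (hu1 1 abs_one) (hw1 1 abs_one) hub hwb
  have hlow : ∀ n : ℤ, |n| ≤ 1 → coefC n (u.toC - w.toC) = 0 := fun n hn => by
    rw [map_sub, coefC_apply, coefC_apply, sub_eq_zero]
    rcases eq_or_ne n 0 with rfl | hn0
    · exact u.coef_zero.trans w.coef_zero.symm
    · have hn1 : |n| = 1 := le_antisymm hn (Int.one_le_abs hn0)
      exact (hu1 n hn1).trans (hw1 n hn1).symm
  have hR : ‖contToLp (waveDiffRhs u.toC w.toC (v - z))‖ ≤
      (K + 2 * K ^ 2) * |ε| * ‖contToLp (u.toC - w.toC)‖ := by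
    rw [waveDiffRhs, map_sub, map_smul]
    refine (norm_sub_le _ _).trans ?_
    rw [norm_smul, norm_eq_abs]
    have hW : ‖contToLp w.toC‖ ≤ K * |ε| := norm_contToLp_le hwb
    linarith [mul_le_mul hvz hW (norm_nonneg _) (by positivity), norm_half_add_mul_sub_le hub hwb]
  have hd := norm_contToLp_le_of_symbol hv hlow fun n hn => hu.coefC_sub hw hn
  have hzero : ‖contToLp (u.toC - w.toC)‖ = 0 := by
    by_contra h
    nlinarith [lt_of_le_of_ne (norm_nonneg _) (Ne.symm h)]
  refine ⟨?_, ?_⟩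
  · rw [norm_eq_zero, map_sub, sub_eq_zero] at hzero
    exact congrArg DFunLike.coe (contToLp_injective hzero)
  · rw [hzero, mul_zero] at hvz
    exact sub_eq_zero.1 (abs_nonpos_iff.1 hvz)

end TwoWaves

namespace IsBifurcationCurve

variable {δ : ℝ} {u : ℝ → SmoothZero} {v : ℝ → ℝ}

lemma exists_bound (h : IsBifurcationCurve δ u v) :
    ∃ K : ℝ, 0 ≤ K ∧ ∀ ε, |ε| ≤ δ / 2 → ∀ x : Torus, |(u ε).fn x| ≤ K * |ε| := by
  have hδ := h.pos
  have hlip : LocallyLipschitzOn (Icc (-(δ / 2)) (δ / 2) ×ˢ Icc 0 (2 * π))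
      (fun p : ℝ × ℝ => u p.1 p.2) := by
    intro p hp
    have ha := h.analytic_u p ⟨⟨by linarith [hp.1.1], by linarith [hp.1.2]⟩, mem_univ _⟩
    obtain ⟨K, t, ht, hK⟩ := (ha.contDiffAt (n := 1)).exists_lipschitzOnWith
    exact ⟨K, t, mem_nhdsWithin_of_mem_nhds ht, hK⟩
  obtain ⟨K, hK⟩ := hlip.exists_lipschitzOnWith_of_compact (isCompact_Icc.prod isCompact_Icc)
  refine ⟨K, K.2, fun ε hε x => ?_⟩
  obtain ⟨y, hy, rfl⟩ : ∃ y ∈ Icc 0 (2 * π), (y : Torus) = x := by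
    obtain ⟨y, hy, hyx⟩ := AddCircle.coe_image_Icc_eq (2 * π) 0 ▸ mem_univ x
    rw [zero_add] at hy
    exact ⟨y, hy, hyx⟩
  have hdist := hK.dist_le_mul (ε, y) ⟨abs_le.1 hε, hy⟩ (0, y)
    ⟨⟨by linarith, by linarith⟩, hy⟩
  simp only [h.u_zero, Prod.dist_eq, dist_self, Real.dist_eq, sub_zero] at hdist
  rw [max_eq_left (abs_nonneg _)] at hdist
  exact hdist

lemma coef_one (h : IsBifurcationCurve δ u v) {ε : ℝ} (hε : ε ∈ Ioo (-δ) δ) (n : ℤ)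
    (hn : |n| = 1) : coef (u ε).fn n = (ε / 2 : ℝ) := by
  have hamp := (u ε).amplitude_eq
  rw [h.amplitude ε hε, SmoothZero.coef_neg_of_even _ (h.even ε hε)] at hamp
  have hone : coef (u ε).fn 1 = (ε / 2 : ℝ) := by
    push_cast
    linear_combination (-1 / 2 : ℂ) * hamp
  rcases (abs_eq zero_le_one).1 hn with rfl | rfl
  · exact hone
  · rw [SmoothZero.coef_neg_of_even _ (h.even ε hε), hone]

lemma eventually_abs_velocity_add_one_le (h : IsBifurcationCurve δ u v) :
    ∀ᶠ ε : ℝ in 𝓝 0, |v ε + 1| ≤ 1 / 4 := by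
  have hc : ContinuousAt (fun ε => |v ε + 1|) 0 :=
    (((h.analytic_v 0 ⟨by linarith [h.pos], h.pos⟩).continuousAt).add continuousAt_const).abs
  have h0 : (fun ε => |v ε + 1|) 0 < 1 / 4 := by simp [h.v_zero]
  exact (hc.eventually_lt_const h0).mono fun _ => le_of_lt

lemma eventually_eq {δ' : ℝ} {u' : ℝ → SmoothZero} {v' : ℝ → ℝ} (h : IsBifurcationCurve δ u v)
    (h' : IsBifurcationCurve δ' u' v') :
    ∀ᶠ ε in 𝓝 (0 : ℝ), u ε = u' ε ∧ v ε = v' ε := by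
  obtain ⟨K, hK0, hK⟩ := h.exists_bound
  obtain ⟨K', -, hK'⟩ := h'.exists_bound
  let M := max K K'
  have habs : Tendsto (fun ε : ℝ => |ε|) (𝓝 0) (𝓝 0) := by
    simpa using! continuous_abs.tendsto (0 : ℝ)
  have hsmall : ∀ᶠ ε : ℝ in 𝓝 0, 4 * (M + 2 * M ^ 2) * |ε| < 1 := by
    have := habs.const_mul (4 * (M + 2 * M ^ 2))
    rw [mul_zero] at this
    exact this.eventually_lt_const one_pos
  filter_upwards [habs.eventually_lt_const (half_pos h.pos),
    habs.eventually_lt_const (half_pos h'.pos), hsmall, h.eventually_abs_velocity_add_one_le]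
    with ε hδ hδ' hM hv
  have hm : ε ∈ Ioo (-δ) δ := abs_lt.1 (by linarith [h.pos])
  have hm' : ε ∈ Ioo (-δ') δ' := abs_lt.1 (by linarith [h'.pos])
  rcases eq_or_ne ε 0 with rfl | hε
  · exact ⟨SmoothZero.ext fun x => by rw [h.u_zero, h'.u_zero], by rw [h.v_zero, h'.v_zero]⟩
  obtain ⟨hfn, hvel⟩ := (h.wave ε hm).eq_of_amplitude_eq hε (hK0.trans (le_max_left _ _))
    (h'.wave ε hm') (h.coef_one hm) (h'.coef_one hm')
    (fun x => (hK ε hδ.le x).trans (mul_le_mul_of_nonneg_right (le_max_left _ _) (abs_nonneg _)))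
    (fun x => (hK' ε hδ'.le x).trans (mul_le_mul_of_nonneg_right (le_max_right _ _) (abs_nonneg _)))
    hv hM
  exact ⟨SmoothZero.ext fun x => congrFun hfn (x : Torus), hvel⟩

end IsBifurcationCurve

/-! ### Sobolev spaces -/

lemma mem_L2Zero_iff (f : Lp ℝ 2 torusMeasure) : f ∈ L2Zero ↔ coef f 0 = 0 := by
  rw [coef_zero_eq_integral, Complex.ofReal_eq_zero]
  rfl

lemma L2Zero.coefL_zero_apply (f : L2Zero) : coefL 0 f = 0 := (mem_L2Zero_iff f.1).1 f.2

lemma isClosed_L2Zero : IsClosed (L2Zero : Set (Lp ℝ 2 torusMeasure)) := by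
  rw [Set.ext mem_L2Zero_iff]
  exact isClosed_eq (coefLp 0).continuous continuous_const

instance : CompleteSpace L2Zero := isClosed_L2Zero.completeSpace_coe

lemma isClosed_Sob (k : ℕ) : IsClosed (Sob k : Set (PiLp 2 fun _ : Fin (k + 1) => L2Zero)) := by
  have hinter : (Sob k : Set (PiLp 2 fun _ : Fin (k + 1) => L2Zero)) =
      ⋂ (j : Fin k) (n : ℤ), {F | L2Zero.coefL n (F j.succ) =
        Complex.I * n * L2Zero.coefL n (F j.castSucc)} := by
    ext F
    simp only [mem_iInter]
    rfl
  rw [hinter]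
  refine isClosed_iInter fun j => isClosed_iInter fun n => isClosed_eq ?_ ?_
  · exact (L2Zero.coefL n).continuous.comp (PiLp.continuous_apply 2 _ _)
  · exact continuous_const.mul ((L2Zero.coefL n).continuous.comp (PiLp.continuous_apply 2 _ _))

/-- The Sobolev space `H^k`. This synonym of `Sob k` carries its normed space structure as a single
instance; instance problems about operators on the submodule `Sob k` itself are too slow. -/
def HSob (k : ℕ) : Type := Sob k

instance (k : ℕ) : NormedAddCommGroup (HSob k) := inferInstanceAs (NormedAddCommGroup (Sob k))

instance (k : ℕ) : NormedSpace ℝ (HSob k) := inferInstanceAs (NormedSpace ℝ (Sob k))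

instance (k : ℕ) : CompleteSpace (HSob k) := (isClosed_Sob k).completeSpace_coe

lemma L2Zero.hasSum_inner (f g : L2Zero) :
    HasSum (fun n : ℤ => coefL n f * conj (coefL n g)) ((inner ℝ f g : ℝ) : ℂ) :=
  hasSum_coef_mul_conj f.1 g.1

namespace HSob

variable {k : ℕ}

lemma norm_sq_eq (F : HSob k) : ‖F‖ ^ 2 = ∑ i, ‖F.1 i‖ ^ 2 :=
  PiLp.norm_sq_eq_of_L2 _ F.1

/-- The `i`-th derivative as a continuous linear map from `H^k` to `L²`, `i ≤ k`. -/
def comp (i : Fin (k + 1)) : HSob k →L[ℝ] L2Zero :=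
  (PiLp.proj 2 (fun _ : Fin (k + 1) => L2Zero) i).comp (Sob k).subtypeL

lemma norm_comp_le (i : Fin (k + 1)) (F : HSob k) : ‖comp i F‖ ≤ ‖F‖ :=
  PiLp.norm_apply_le F.1 i

lemma ext_comp {F G : HSob k} (h : ∀ i, comp i F = comp i G) : F = G :=
  Subtype.ext (PiLp.ext h)

lemma coef_succ (F : HSob k) (i : Fin k) (n : ℤ) :
    L2Zero.coefL n (comp i.succ F) = Complex.I * n * L2Zero.coefL n (comp i.castSucc F) := F.2 i n

lemma coef_comp (F : HSob k) (i : Fin (k + 1)) (n : ℤ) :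
    L2Zero.coefL n (comp i F) = (Complex.I * n) ^ (i : ℕ) * L2Zero.coefL n (comp 0 F) := by
  induction i using Fin.induction with
  | zero => rw [Fin.val_zero, pow_zero, one_mul]
  | succ i ih =>
    rw [coef_succ, ih, Fin.val_succ, Fin.val_castSucc, pow_succ]
    ring

lemma ext_coef {F G : HSob k}
    (h : ∀ n, L2Zero.coefL n (comp 0 F) = L2Zero.coefL n (comp 0 G)) : F = G :=
  ext_comp fun i => L2Zero.ext_coef fun n => by rw [coef_comp, coef_comp G, h]

lemma norm_le_sum (F : HSob k) : ‖F‖ ≤ ∑ i, ‖comp i F‖ := by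
  refine le_of_sq_le_sq ?_ (Finset.sum_nonneg fun i _ => norm_nonneg _)
  rw [norm_sq_eq]
  exact Finset.sum_sq_le_sq_sum_of_nonneg fun i _ => norm_nonneg _

/-- The continuous linear map into `H^k` whose components, the derivatives of the zeroth one, are
the given maps into `L²`. -/
def lift {E : Type*} [NormedAddCommGroup E] [NormedSpace ℝ E] (A : Fin (k + 1) → E →L[ℝ] L2Zero)
    (hA : ∀ x (i : Fin k) (n : ℤ), L2Zero.coefL n (A i.succ x) =
      Complex.I * n * L2Zero.coefL n (A i.castSucc x)) : E →L[ℝ] HSob k :=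
  ((PiLp.continuousLinearEquiv 2 ℝ fun _ : Fin (k + 1) => L2Zero).symm.toContinuousLinearMap.comp
    (ContinuousLinearMap.pi A)).codRestrict (Sob k) hA

lemma continuous_of_comp {Z : Type*} [TopologicalSpace Z] {f : Z → HSob k}
    (h : ∀ i, Continuous fun z => comp i (f z)) : Continuous f :=
  continuous_induced_rng.2 <|
    (PiLp.continuous_toLp 2 fun _ : Fin (k + 1) => L2Zero).comp (continuous_pi h)

/-- The inclusion `H^k ⊆ H^j`, `j ≤ k`, as a continuous linear map. -/
def incl {j : ℕ} (h : j ≤ k) : HSob k →L[ℝ] HSob j :=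
  lift (fun i => comp (i.castLE (Nat.succ_le_succ h))) fun F i n => coef_succ F (i.castLE h) n

/-- The derivative `H^{k+1} → H^k`. -/
def der : HSob (k + 1) →L[ℝ] HSob k :=
  lift (fun i => comp i.succ) fun F i n => coef_succ F i.succ n

lemma comp_zero_incl {j : ℕ} (h : j ≤ k) (F : HSob k) : comp 0 (incl h F) = comp 0 F := rfl

lemma coef_der (F : HSob (k + 1)) (n : ℤ) :
    L2Zero.coefL n (comp 0 (der F)) = Complex.I * n * L2Zero.coefL n (comp 0 F) := coef_succ F 0 n

end HSob

/-! ### Translations -/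

/-- The translation `f ↦ f(· - a)` on `L²`. -/
def transLp (a : Torus) : Lp ℝ 2 torusMeasure →ₗᵢ[ℝ] Lp ℝ 2 torusMeasure :=
  Lp.compMeasurePreservingₗᵢ ℝ (fun x => x - a) (measurePreserving_sub_right torusMeasure a)

lemma transLp_ae (a : Torus) (f : Lp ℝ 2 torusMeasure) :
    transLp a f =ᵐ[torusMeasure] fun x => f (x - a) :=
  Lp.coeFn_compMeasurePreserving f (measurePreserving_sub_right torusMeasure a)

lemma coef_transLp (a : Torus) (f : Lp ℝ 2 torusMeasure) (n : ℤ) :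
    coef (transLp a f) n = fourier (-n) a * coef f n := by
  rw [coef_congr_ae (transLp_ae a f), coef_comp_sub]

lemma continuous_transLp (f : Lp ℝ 2 torusMeasure) : Continuous fun a : Torus => transLp a f := by
  let g : C(Torus, C(Torus, Torus)) :=
    (ContinuousMap.mk (fun p : Torus × Torus => p.2 - p.1)
      (continuous_snd.sub continuous_fst)).curry
  exact continuous_const.compMeasurePreservingLp (g := g) g.continuous
    (fun a => measurePreserving_sub_right torusMeasure a) (by norm_num)

lemma transLp_mem_L2Zero (a : Torus) {f : Lp ℝ 2 torusMeasure} (hf : f ∈ L2Zero) :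
    transLp a f ∈ L2Zero := by
  rw [mem_L2Zero_iff] at hf ⊢
  rw [coef_transLp, hf, mul_zero]

namespace L2Zero

/-- The translation `f ↦ f(· - a)` on `L²` functions of mean zero. -/
def trans (a : ℝ) : L2Zero →ₗᵢ[ℝ] L2Zero where
  toFun f := ⟨transLp a f.1, transLp_mem_L2Zero a f.2⟩
  map_add' f g := Subtype.ext ((transLp a).map_add f.1 g.1)
  map_smul' c f := Subtype.ext ((transLp a).map_smul c f.1)
  norm_map' f := (transLp a).norm_map f.1

lemma coef_trans (a : ℝ) (f : L2Zero) (n : ℤ) :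
    coefL n (trans a f) = fourier (-n) (a : Torus) * coefL n f :=
  coef_transLp a f.1 n

lemma trans_ae (a : ℝ) (f : L2Zero) :
    l2fn (trans a f) =ᵐ[torusMeasure] fun x => l2fn f (x - a) := transLp_ae a f.1

lemma continuous_trans (f : L2Zero) : Continuous fun a : ℝ => trans a f :=
  continuous_induced_rng.2 <|
    (continuous_transLp f.1).comp (AddCircle.continuous_mk' (2 * π))

end L2Zero

lemma hasDerivAt_of_hasDerivAt_apply {X Y : Type*} [NormedAddCommGroup X] [NormedSpace ℝ X]
    [NormedAddCommGroup Y] [NormedSpace ℝ Y] {T S : ℝ → X →L[ℝ] Y}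
    (hT : ∀ F t, HasDerivAt (fun s => T s F) (S t F) t) {t : ℝ} (hS : ContinuousAt S t) :
    HasDerivAt T (S t) t := by
  refine hasDerivAt_iff_isLittleO.2 (Asymptotics.isLittleO_iff.2 fun ε hε => ?_)
  obtain ⟨r, hr, hball⟩ := Metric.continuousAt_iff.1 hS ε hε
  filter_upwards [Metric.ball_mem_nhds t hr] with s hs
  refine ContinuousLinearMap.opNorm_le_bound _ (by positivity) fun F => ?_
  have hmean := (convex_ball t r).norm_image_sub_le_of_norm_hasDerivWithin_le
    (f := fun s => T s F - s • S t F) (f' := fun s => S s F - (1 : ℝ) • S t F) (C := ε * ‖F‖)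
    (fun x _ => ((hT F x).sub ((hasDerivAt_id x).smul_const (S t F))).hasDerivWithinAt)
    (fun x hx => by
      rw [one_smul, ← sub_apply]
      exact (S x - S t).le_of_opNorm_le (dist_eq_norm (S x) (S t) ▸ (hball hx).le) F)
    (Metric.mem_ball_self hr) hs
  calc ‖(T s - T t - (s - t) • S t) F‖ = ‖T s F - s • S t F - (T t F - t • S t F)‖ := by
        congr 1
        simp only [sub_apply, smul_apply, sub_smul]
        abel
    _ ≤ ε * ‖F‖ * ‖s - t‖ := hmean
    _ = ε * ‖s - t‖ * ‖F‖ := by ring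

lemma hasFDerivAt_apply_of_hasDerivAt_apply {X Y : Type*} [NormedAddCommGroup X]
    [NormedSpace ℝ X] [NormedAddCommGroup Y] [NormedSpace ℝ Y] {T : ℝ → X →L[ℝ] Y} {a : ℝ} {F : X}
    {y : Y} (hT : ContinuousAt T a) (hy : HasDerivAt (fun t => T t F) y a) :
    HasFDerivAt (fun p : ℝ × X => T p.1 p.2)
      ((ContinuousLinearMap.fst ℝ ℝ X).smulRight y +
        (T a).comp (ContinuousLinearMap.snd ℝ ℝ X)) (a, F) := by
  have hbase : HasFDerivAt (fun p : ℝ × X => T p.1 F)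
      ((ContinuousLinearMap.fst ℝ ℝ X).smulRight y) (a, F) :=
    (HasFDerivAt.comp (f := Prod.fst) (a, F) hy.hasFDerivAt hasFDerivAt_fst).congr_fderiv
      (by ext <;> simp)
  have hfibre : HasFDerivAt (fun p : ℝ × X => T a p.2)
      ((T a).comp (ContinuousLinearMap.snd ℝ ℝ X)) (a, F) :=
    (T a).hasFDerivAt.comp (a, F) hasFDerivAt_snd
  have hmixed : HasFDerivAt (fun p : ℝ × X => (T p.1 - T a) (p.2 - F))
      (0 : ℝ × X →L[ℝ] Y) (a, F) := by
    refine HasFDerivAt.of_isLittleO (Asymptotics.isLittleO_iff.2 fun ε hε => ?_)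
    have hnear : ∀ᶠ p : ℝ × X in 𝓝 (a, F), dist (T p.1) (T a) < ε :=
      (hT.comp (f := Prod.fst) continuousAt_fst).eventually (Metric.ball_mem_nhds _ hε)
    filter_upwards [hnear] with p hp
    simp only [sub_self, map_zero, sub_zero, zero_apply]
    rw [dist_eq_norm] at hp
    exact ((T p.1 - T a).le_of_opNorm_le hp.le _).trans
      (mul_le_mul_of_nonneg_left (norm_snd_le (p - (a, F))) hε.le)
  have hsum := ((hbase.add hfibre).add hmixed).sub_const (T a F)
  rw [add_zero] at hsum
  refine hsum.congr_of_eventuallyEq (Eventually.of_forall fun p => ?_)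
  simp only [Pi.add_apply, map_sub, sub_apply]
  abel

lemma hasDerivAt_fourier_neg_torus (n : ℤ) (t : ℝ) :
    HasDerivAt (fun t : ℝ => (fourier (-n) (t : Torus) : ℂ))
      (-(Complex.I * n) * fourier (-n) (t : Torus)) t := by
  refine (hasDerivAt_fourier_neg (2 * π) n t).congr_deriv ?_
  have hpi : (π : ℂ) ≠ 0 := by exact_mod_cast Real.pi_ne_zero
  push_cast
  field_simp

namespace HSob

variable {k m : ℕ}

/-- The translation `f ↦ f(· - a)` as a continuous linear map on `H^k`. -/
def transL (a : ℝ) : HSob k →L[ℝ] HSob k :=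
  lift (fun i => (L2Zero.trans a).toContinuousLinearMap.comp (comp i)) fun F i n => by
    change L2Zero.coefL n (L2Zero.trans a (comp i.succ F)) =
      Complex.I * n * L2Zero.coefL n (L2Zero.trans a (comp i.castSucc F))
    rw [L2Zero.coef_trans, L2Zero.coef_trans, coef_succ]
    ring

lemma comp_transL (a : ℝ) (F : HSob k) (i : Fin (k + 1)) :
    comp i (transL a F) = L2Zero.trans a (comp i F) := rfl

lemma norm_transL (a : ℝ) (F : HSob k) : ‖transL a F‖ = ‖F‖ := by
  refine (sq_eq_sq₀ (norm_nonneg _) (norm_nonneg _)).1 ?_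
  rw [norm_sq_eq (transL a F), norm_sq_eq F]
  exact Finset.sum_congr rfl fun i _ => congrArg (· ^ 2) ((L2Zero.trans a).norm_map (comp i F))

lemma coef_transL (a : ℝ) (F : HSob k) (n : ℤ) :
    L2Zero.coefL n (comp 0 (transL a F)) =
      fourier (-n) (a : Torus) * L2Zero.coefL n (comp 0 F) := by
  rw [comp_transL, L2Zero.coef_trans]

lemma transL_zero (F : HSob k) : transL 0 F = F :=
  ext_coef fun n => by rw [coef_transL, QuotientAddGroup.mk_zero, fourier_eval_zero, one_mul]

lemma continuous_transL_left (F : HSob k) : Continuous fun a : ℝ => transL a F :=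
  continuous_of_comp fun i => L2Zero.continuous_trans (comp i F)

lemma continuous_transL : Continuous fun p : ℝ × HSob k => transL p.1 p.2 :=
  continuous_prod_of_continuous_lipschitzWith' _ 1 (fun a =>
    LipschitzWith.of_dist_le_mul fun F G => by
      change dist (transL a F) (transL a G) ≤ _
      rw [dist_eq_norm, dist_eq_norm, ← map_sub, norm_transL, NNReal.coe_one, one_mul])
    continuous_transL_left

/- Both sides have the same Fourier coefficients, since these solve the same linear differential
equation in `t`. -/
lemma transL_eq_sub_integral (F : HSob (k + 1)) (t : ℝ) :
    transL t (incl k.le_succ F) = incl k.le_succ F - ∫ s in (0 : ℝ)..t, transL s (der F) := by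
  refine ext_coef fun n => ?_
  let ℓ : HSob k →L[ℝ] ℂ := (L2Zero.coefL n).comp (comp 0)
  change ℓ (transL t (incl k.le_succ F)) =
    ℓ (incl k.le_succ F - ∫ s in (0 : ℝ)..t, transL s (der F))
  have hint (t : ℝ) : HasDerivAt (fun t => ℓ (incl k.le_succ F -
      ∫ s in (0 : ℝ)..t, transL s (der F))) (ℓ (-(transL t (der F)))) t :=
    ℓ.hasFDerivAt.comp_hasDerivAt t
      (((continuous_transL_left (der F)).integral_hasStrictDerivAt 0 t).hasDerivAt.const_sub _)
  have htrans (t : ℝ) : HasDerivAt (fun t => ℓ (transL t (incl k.le_succ F)))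
      (ℓ (-(transL t (der F)))) t := by
    rw [funext fun t : ℝ => show ℓ (transL t (incl k.le_succ F)) =
      fourier (-n) (t : Torus) * L2Zero.coefL n (comp 0 F) from coef_transL t _ n]
    refine ((hasDerivAt_fourier_neg_torus n t).mul_const _).congr_deriv ?_
    rw [map_neg]
    change _ = -L2Zero.coefL n (comp 0 (transL t (der F)))
    rw [coef_transL, coef_der]
    ring
  have hdiff (t : ℝ) : HasDerivAt (fun t => ℓ (transL t (incl k.le_succ F)) -
      ℓ (incl k.le_succ F - ∫ s in (0 : ℝ)..t, transL s (der F))) 0 t := by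
    simpa only [sub_self] using (htrans t).fun_sub (hint t)
  have hconst := is_const_of_deriv_eq_zero (fun t => (hdiff t).differentiableAt)
    (fun t => (hdiff t).deriv) t 0
  simp only [intervalIntegral.integral_same, sub_zero, transL_zero, sub_self] at hconst
  exact sub_eq_zero.1 hconst

lemma hasDerivAt_transL (F : HSob (k + 1)) (t : ℝ) :
    HasDerivAt (fun t => transL t (incl k.le_succ F)) (-(transL t (der F))) t := by
  rw [funext (transL_eq_sub_integral F)]
  exact ((continuous_transL_left (der F)).integral_hasStrictDerivAt 0 t).hasDerivAt.const_sub
    (incl k.le_succ F)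

/-- The translation `f ↦ f(· - a)` as a map from `H^k` to `H^m`, `m ≤ k`. -/
def transIncl (h : m ≤ k) (a : ℝ) : HSob k →L[ℝ] HSob m :=
  (incl h).comp (transL a)

lemma norm_transIncl_apply_le (h : m ≤ k) (a : ℝ) (F : HSob k) :
    ‖transIncl h a F‖ ≤ ‖incl h‖ * ‖F‖ :=
  norm_transL a F ▸ (incl h).le_opNorm (transL a F)

lemma hasDerivAt_transIncl_apply (h : m ≤ k) (F : HSob (k + 1)) (t : ℝ) :
    HasDerivAt (fun t => transIncl (h.trans k.le_succ) t F) (-(transIncl h t (der F))) t :=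
  map_neg (incl h) (transL t (der F)) ▸
    (incl h).hasFDerivAt.comp_hasDerivAt t (hasDerivAt_transL F t)

lemma norm_transIncl_sub_le (h : m ≤ k) (F : HSob (k + 1)) (s t : ℝ) :
    ‖transIncl (h.trans k.le_succ) t F - transIncl (h.trans k.le_succ) s F‖ ≤
      ‖incl h‖ * ‖der F‖ * |t - s| :=
  convex_univ.norm_image_sub_le_of_norm_hasDerivWithin_le
    (f := fun t => transIncl (h.trans k.le_succ) t F)
    (fun x _ => (hasDerivAt_transIncl_apply h F x).hasDerivWithinAt)
    (fun x _ => norm_neg (transIncl h x (der F)) ▸ norm_transIncl_apply_le h x (der F))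
    (mem_univ s) (mem_univ t)

lemma continuous_transIncl (h : m < k) :
    Continuous fun t => (transIncl h.le t : HSob k →L[ℝ] HSob m) := by
  obtain ⟨k, rfl⟩ := Nat.exists_eq_add_one_of_ne_zero h.ne_bot
  have hm : m ≤ k := Nat.lt_succ_iff.1 h
  let C := ‖(incl hm : HSob k →L[ℝ] HSob m)‖ * ‖(der : HSob (k + 1) →L[ℝ] HSob k)‖
  have hC : 0 ≤ C := mul_nonneg (norm_nonneg _) (norm_nonneg _)
  refine (LipschitzWith.of_dist_le_mul (K := ⟨C, hC⟩) fun t s => ?_).continuous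
  rw [dist_eq_norm, dist_eq_norm]
  refine ContinuousLinearMap.opNorm_le_bound _ (mul_nonneg hC (norm_nonneg _)) fun F => ?_
  calc ‖transIncl h.le t F - transIncl h.le s F‖
      ≤ ‖(incl hm : HSob k →L[ℝ] HSob m)‖ * ‖der F‖ * |t - s| := norm_transIncl_sub_le hm F s t
    _ ≤ ‖(incl hm : HSob k →L[ℝ] HSob m)‖ * (‖(der : HSob (k + 1) →L[ℝ] HSob k)‖ * ‖F‖) *
          |t - s| := by
        gcongr
        exact ContinuousLinearMap.le_opNorm _ F
    _ = C * ‖t - s‖ * ‖F‖ := by rw [norm_eq_abs]; ring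

lemma hasDerivAt_transIncl (h : m < k) (t : ℝ) :
    HasDerivAt (fun t => (transIncl (h.le.trans k.le_succ) t : HSob (k + 1) →L[ℝ] HSob m))
      (-((transIncl h.le t : HSob k →L[ℝ] HSob m).comp der)) t :=
  hasDerivAt_of_hasDerivAt_apply
    (S := fun t => -((transIncl h.le t : HSob k →L[ℝ] HSob m).comp der))
    (fun F t => hasDerivAt_transIncl_apply h.le F t)
    ((continuous_transIncl h).clm_comp continuous_const).neg.continuousAt

lemma contDiff_transIncl (j : ℕ) : ∀ {m k : ℕ} (h : m ≤ k), m + j + 1 ≤ k →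
    ContDiff ℝ j fun t => (transIncl h t : HSob k →L[ℝ] HSob m) := by
  induction j with
  | zero => exact fun h hj => contDiff_zero.2 (continuous_transIncl hj)
  | succ j ih =>
    intro m k h hj
    obtain ⟨k, rfl⟩ : ∃ k', k = k' + 1 := ⟨k - 1, by omega⟩
    have hd (t : ℝ) := hasDerivAt_transIncl (show m < k by omega) t
    rw [Nat.cast_add, Nat.cast_one, contDiff_succ_iff_deriv]
    refine ⟨fun t => (hd t).differentiableAt, fun h => absurd h (by simp), ?_⟩
    rw [funext fun t => (hd t).deriv]
    exact ((ih (by omega) (by omega)).clm_comp contDiff_const).neg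

/- Each derivative in `a` costs one derivative of `f`. -/
lemma contDiff_transIncl_uncurry (j : ℕ) : ∀ {m k : ℕ} (h : m ≤ k), m + j ≤ k →
    ContDiff ℝ j fun p : ℝ × HSob k => transIncl h p.1 p.2 := by
  induction j with
  | zero =>
    intro m k h _
    exact contDiff_zero.2 ((incl h).continuous.comp continuous_transL)
  | succ j ih =>
    intro m k h hj
    obtain ⟨k, rfl⟩ : ∃ k', k = k' + 1 := ⟨k - 1, by omega⟩
    have hm : m ≤ k := by omega
    rw [Nat.cast_add, Nat.cast_one, contDiff_succ_iff_hasFDerivAt]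
    refine ⟨fun p => (ContinuousLinearMap.fst ℝ ℝ (HSob (k + 1))).smulRight
      (-(transIncl hm p.1 (der p.2))) +
      (transIncl h p.1).comp (ContinuousLinearMap.snd ℝ ℝ (HSob (k + 1))), ?_, fun p =>
      hasFDerivAt_apply_of_hasDerivAt_apply (T := fun t => transIncl h t)
        (continuous_transIncl (Nat.lt_succ_iff.2 hm)).continuousAt
        (hasDerivAt_transIncl_apply hm p.2 p.1)⟩
    have hbase : ContDiff ℝ j fun p : ℝ × HSob (k + 1) => -(transIncl hm p.1 (der p.2)) :=
      ((ih hm (by omega)).comp (contDiff_fst.prodMk (der.contDiff.comp contDiff_snd))).neg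
    have hfibre : ContDiff ℝ j fun p : ℝ × HSob (k + 1) =>
        (transIncl h p.1 : HSob (k + 1) →L[ℝ] HSob m) :=
      (contDiff_transIncl j h (by omega)).comp contDiff_fst
    exact (contDiff_const.smulRight hbase).add (hfibre.clm_comp contDiff_const)

end HSob

/-! ### Series as elements of `L²` and `H^k` -/

lemma coef_contToLp (f : C(Torus, ℝ)) (n : ℤ) : coef (contToLp f) n = coef f n :=
  coef_congr_ae (ContinuousMap.coeFn_toLp torusMeasure f) n

lemma cosT_zero : cosT 0 = 1 := ContinuousMap.ext fun x => by
  change (fourier 0 x).re = 1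
  rw [fourier_zero, Complex.one_re]

lemma coef_one (n : ℤ) : coef (1 : C(Torus, ℝ)) n = if n = 0 then 1 else 0 := by
  rw [← cosT_zero, coef_cosT, neg_zero]
  split_ifs
  · norm_num
  · norm_num

/-- The map `f ↦ f - ∫ f` from continuous functions to `L²` functions of mean zero. -/
def zeroMean : C(Torus, ℝ) →L[ℝ] L2Zero :=
  (contToLp - (Complex.reCLM.comp (coefC 0)).smulRight (contToLp 1)).codRestrict L2Zero fun f => by
    have hre : ((coefC 0 f).re : ℂ) = coef f 0 := by
      rw [coefC_apply, coef_zero_eq_integral, Complex.ofReal_re]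
    change contToLp f - (coefC 0 f).re • contToLp 1 ∈ L2Zero
    rw [mem_L2Zero_iff]
    change coefLp 0 _ = 0
    rw [map_sub, map_smul, Complex.real_smul, hre]
    change coef (contToLp f) 0 - _ * coef (contToLp 1) 0 = 0
    rw [coef_contToLp, coef_contToLp, coef_one, if_pos rfl, mul_one, sub_self]

lemma coefL_zeroMean {n : ℤ} (hn : n ≠ 0) (f : C(Torus, ℝ)) :
    L2Zero.coefL n (zeroMean f) = coef f n := by
  change coefLp n (contToLp f - (coefC 0 f).re • contToLp 1) = _
  rw [map_sub, map_smul]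
  change coef (contToLp f) n - _ • coef (contToLp 1) n = _
  rw [coef_contToLp, coef_contToLp, coef_one, if_neg hn, smul_zero, sub_zero]

lemma coefL_zeroMean_of_coef_zero {f : C(Torus, ℝ)} (hf : coef f 0 = 0) (n : ℤ) :
    L2Zero.coefL n (zeroMean f) = coef f n := by
  rcases eq_or_ne n 0 with rfl | hn
  · rw [L2Zero.coefL_zero_apply, hf]
  · exact coefL_zeroMean hn f

lemma zeroMean_ae {f : C(Torus, ℝ)} (hf : coef f 0 = 0) :
    l2fn (zeroMean f) =ᵐ[torusMeasure] f :=
  ae_eq_of_coef_eq (Lp.memLp _) (memLp_of_continuous f.continuous)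
    (coefL_zeroMean_of_coef_zero hf)

lemma L2Zero.norm_le_of_norm_coefL_le {f g : L2Zero} {C : ℝ} (hC : 0 ≤ C)
    (h : ∀ n, ‖coefL n f‖ ≤ C * ‖coefL n g‖) : ‖f‖ ≤ C * ‖g‖ :=
  norm_le_of_norm_coef_le (f := f.1) (g := g.1) hC h

lemma norm_zeroMean_le {f : C(Torus, ℝ)} {K : ℝ} (hf : ∀ x, |f x| ≤ K) : ‖zeroMean f‖ ≤ K := by
  have h : ‖(zeroMean f).1‖ ≤ 1 * ‖contToLp f‖ :=
    norm_le_of_norm_coef_le zero_le_one fun n => by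
      change ‖L2Zero.coefL n (zeroMean f)‖ ≤ _
      rw [one_mul]
      rcases eq_or_ne n 0 with rfl | hn
      · rw [L2Zero.coefL_zero_apply, norm_zero]
        exact norm_nonneg _
      · rw [coefL_zeroMean hn, coef_contToLp]
  rw [one_mul] at h
  exact h.trans (norm_contToLp_le hf)

/-- The series `cosSeries` in `L²`, without its constant term. -/
def cosSeriesL2 : Ell →L[ℝ] L2Zero := zeroMean.comp cosSeries

/-- The series `derivSeries` in `L²`. -/
def derivSeriesL2 : Ell →L[ℝ] L2Zero := zeroMean.comp derivSeries

/-- The series `antiderivSeries` in `L²`. -/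
def antiderivSeriesL2 : Ell →L[ℝ] L2Zero := zeroMean.comp antiderivSeries

lemma coefL_cosSeriesL2 (b : Ell) {n : ℤ} (hn : n ≠ 0) :
    L2Zero.coefL n (cosSeriesL2 b) = coef (cosSeries b) n := coefL_zeroMean hn _

lemma coefL_derivSeriesL2 (b : Ell) (n : ℤ) :
    L2Zero.coefL n (derivSeriesL2 b) = Complex.I * n * L2Zero.coefL n (cosSeriesL2 b) := by
  rcases eq_or_ne n 0 with rfl | hn
  · rw [L2Zero.coefL_zero_apply, Int.cast_zero, mul_zero, zero_mul]
  · rw [coefL_cosSeriesL2 b hn, ← coef_derivSeries]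
    exact coefL_zeroMean hn _

lemma coefL_cosSeriesL2_eq (b : Ell) (n : ℤ) :
    L2Zero.coefL n (cosSeriesL2 b) = Complex.I * n * L2Zero.coefL n (antiderivSeriesL2 b) := by
  rcases eq_or_ne n 0 with rfl | hn
  · rw [L2Zero.coefL_zero_apply, Int.cast_zero, mul_zero, zero_mul]
  · rw [coefL_cosSeriesL2 b hn, coef_cosSeries_eq_coef_antiderivSeries b hn]
    exact congrArg _ (coefL_zeroMean hn _).symm

lemma SmoothZero.coefL_toL2 (w : SmoothZero) (n : ℤ) : L2Zero.coefL n w.toL2 = coef w.fn n :=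
  coef_congr_ae w.memLp.coeFn_toLp n

lemma toL2_seriesZero (b : Ell) : (seriesZero b).toL2 = cosSeriesL2 b :=
  L2Zero.ext_coef fun n => by
    rw [SmoothZero.coefL_toL2]
    rcases eq_or_ne n 0 with rfl | hn
    · rw [SmoothZero.coef_zero, L2Zero.coefL_zero_apply]
    · rw [coef_seriesZero b hn, coefL_cosSeriesL2 b hn]

lemma coefL_neg_cosSeriesL2 (b : Ell) (n : ℤ) :
    L2Zero.coefL (-n) (cosSeriesL2 b) = L2Zero.coefL n (cosSeriesL2 b) := by
  rcases eq_or_ne n 0 with rfl | hn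
  · rw [neg_zero]
  · rw [coefL_cosSeriesL2 b hn, coefL_cosSeriesL2 b (neg_ne_zero.2 hn), ← coef_comp_neg,
      funext (cosSeries_neg b)]

lemma coefL_neg_antiderivSeriesL2 (b : Ell) (n : ℤ) :
    L2Zero.coefL (-n) (antiderivSeriesL2 b) = -L2Zero.coefL n (antiderivSeriesL2 b) := by
  rcases eq_or_ne n 0 with rfl | hn
  · rw [neg_zero, L2Zero.coefL_zero_apply, neg_zero]
  · have h := coefL_neg_cosSeriesL2 b n
    rw [coefL_cosSeriesL2_eq, coefL_cosSeriesL2_eq b n] at h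
    have hI : Complex.I * n ≠ 0 := mul_ne_zero Complex.I_ne_zero (by exact_mod_cast hn)
    apply mul_left_cancel₀ hI
    push_cast at h
    linear_combination -h

lemma L2Zero.inner_eq_zero_of_coefL_neg {f g : L2Zero} (hf : ∀ n, coefL (-n) f = coefL n f)
    (hg : ∀ n, coefL (-n) g = -coefL n g) : inner ℝ f g = 0 := by
  have h := hasSum_inner f g
  have hneg := ((Equiv.neg ℤ).hasSum_iff.2 h).congr_fun (g := fun n =>
    -(coefL n f * conj (coefL n g))) fun n => by
      change _ = coefL (-n) f * conj (coefL (-n) g)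
      rw [hf, hg, map_neg, mul_neg]
  have heq := hneg.unique h.neg
  rw [← Complex.ofReal_neg, Complex.ofReal_inj] at heq
  linarith

lemma inner_cosSeriesL2_antiderivSeriesL2 (b c : Ell) :
    inner ℝ (cosSeriesL2 b) (antiderivSeriesL2 c) = 0 :=
  L2Zero.inner_eq_zero_of_coefL_neg (coefL_neg_cosSeriesL2 b) (coefL_neg_antiderivSeriesL2 c)

lemma inner_cosSeriesL2_derivSeriesL2 (b c : Ell) :
    inner ℝ (cosSeriesL2 b) (derivSeriesL2 c) = 0 :=
  L2Zero.inner_eq_zero_of_coefL_neg (coefL_neg_cosSeriesL2 b) fun n => by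
    rw [coefL_derivSeriesL2, coefL_derivSeriesL2, coefL_neg_cosSeriesL2]
    push_cast
    ring

lemma inner_derivSeriesL2_antiderivSeriesL2 (b c : Ell) :
    inner ℝ (derivSeriesL2 b) (antiderivSeriesL2 c) =
      -inner ℝ (cosSeriesL2 b) (cosSeriesL2 c) := by
  have h := (L2Zero.hasSum_inner (derivSeriesL2 b) (antiderivSeriesL2 c)).unique <|
    (L2Zero.hasSum_inner (cosSeriesL2 b) (cosSeriesL2 c)).neg.congr_fun fun n => by
      rw [coefL_derivSeriesL2, coefL_cosSeriesL2_eq c, map_mul, map_mul, Complex.conj_I,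
        map_intCast]
      ring
  exact_mod_cast h

lemma coefL_cosSeriesL2_cosVec (n : ℤ) :
    L2Zero.coefL n (cosSeriesL2 cosVec) = if n ∈ ({1, -1} : Finset ℤ) then 1 / 2 else 0 := by
  simp only [Finset.mem_insert, Finset.mem_singleton]
  rcases eq_or_ne n 0 with rfl | hn
  · rw [L2Zero.coefL_zero_apply, if_neg (by norm_num)]
  · rw [coefL_cosSeriesL2 _ hn, coef_cosSeries _ hn, coord_cosVec]
    have hd : (decay : ℂ) ≠ 0 := by exact_mod_cast decay_pos.ne'
    by_cases h : n.natAbs = 1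
    · rw [if_pos h, if_pos (by omega), h, pow_one, Complex.ofReal_inv]
      field_simp
    · rw [if_neg h, if_neg (by omega), Complex.ofReal_zero, mul_zero]

lemma norm_sq_cosSeriesL2_cosVec : ‖cosSeriesL2 cosVec‖ ^ 2 = 1 / 2 := by
  have h := (L2Zero.hasSum_inner (cosSeriesL2 cosVec) (cosSeriesL2 cosVec)).unique <|
    hasSum_sum_of_ne_finset_zero (L := .unconditional ℤ) (s := {1, -1}) fun n hn => by
      rw [coefL_cosSeriesL2_cosVec, if_neg hn, zero_mul]
  rw [Finset.sum_pair (by norm_num), coefL_cosSeriesL2_cosVec, coefL_cosSeriesL2_cosVec,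
    if_pos (by simp), if_pos (by simp), real_inner_self_eq_norm_sq, map_div₀, map_one,
    Complex.conj_ofNat] at h
  have h' : ((‖cosSeriesL2 cosVec‖ ^ 2 : ℝ) : ℂ) = ((1 / 2 : ℝ) : ℂ) := by
    rw [h]
    norm_num
  exact_mod_cast h'

lemma norm_cosSeriesL2_unitVec_le (n : ℕ) : ‖cosSeriesL2 (unitVec n)‖ ≤ decay ^ n :=
  norm_zeroMean_le fun x => by
    change |cosSeries (unitVec n) x| ≤ _
    rw [cosSeries_unitVec, ContinuousMap.smul_apply, smul_eq_mul, abs_mul,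
      abs_of_nonneg (pow_nonneg decay_pos.le n)]
    exact mul_le_of_le_one_right (pow_nonneg decay_pos.le n)
      (((cosT n).norm_coe_le_norm x).trans (norm_cosT_le n))

lemma coefL_cosSeriesL2_unitVec_eq_zero {n : ℕ} {m : ℤ} (h : m.natAbs ≠ n) :
    L2Zero.coefL m (cosSeriesL2 (unitVec n)) = 0 := by
  rcases eq_or_ne m 0 with rfl | hm
  · exact L2Zero.coefL_zero_apply _
  · rw [coefL_cosSeriesL2 _ hm, coef_cosSeries _ hm, coord_unitVec, if_neg (Ne.symm h),
      Complex.ofReal_zero, mul_zero]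

lemma exists_pow_mul_decay_pow_le (i : ℕ) : ∃ C : ℝ, ∀ n : ℕ, (n : ℝ) ^ i * decay ^ n ≤ C := by
  obtain ⟨C, hC⟩ := (tendsto_pow_const_mul_const_pow_of_abs_lt_one i (r := decay)
    (by norm_num [decay])).bddAbove_range
  exact ⟨C, fun n => hC ⟨n, rfl⟩⟩

/-- A smooth function as an element of `H^k`; the same as `SmoothZero.toSob`, with values in
`HSob k`. -/
def SmoothZero.toHSob (k : ℕ) (w : SmoothZero) : HSob k := w.toSob k

lemma comp_zero_toHSob_seriesZero (k : ℕ) (b : Ell) :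
    HSob.comp 0 ((seriesZero b).toHSob k) = cosSeriesL2 b := toL2_seriesZero b

lemma norm_comp_toHSob_seriesZero_unitVec_le {k : ℕ} (i : Fin (k + 1)) (n : ℕ) :
    ‖HSob.comp i ((seriesZero (unitVec n)).toHSob k)‖ ≤ (n : ℝ) ^ (i : ℕ) * decay ^ n := by
  refine le_trans (L2Zero.norm_le_of_norm_coefL_le (g := cosSeriesL2 (unitVec n))
    (C := (n : ℝ) ^ (i : ℕ)) (by positivity) fun m => ?_)
    (mul_le_mul_of_nonneg_left (norm_cosSeriesL2_unitVec_le n) (by positivity))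
  rw [HSob.coef_comp, comp_zero_toHSob_seriesZero, norm_mul, norm_pow, norm_mul, Complex.norm_I,
    one_mul]
  by_cases hm : m.natAbs = n
  · rw [Complex.norm_intCast, ← Int.cast_abs, ← Int.natCast_natAbs, hm, Int.cast_natCast]
  · rw [coefL_cosSeriesL2_unitVec_eq_zero hm, norm_zero, mul_zero, mul_zero]

lemma exists_norm_toHSob_seriesZero_unitVec_le (k : ℕ) :
    ∃ C : ℝ, ∀ n, ‖(seriesZero (unitVec n)).toHSob k‖ ≤ C := by
  choose C hC using exists_pow_mul_decay_pow_le
  exact ⟨∑ i : Fin (k + 1), C i, fun n => (HSob.norm_le_sum _).trans <|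
    Finset.sum_le_sum fun i _ => (norm_comp_toHSob_seriesZero_unitVec_le i n).trans (hC i n)⟩

/-- The series `cosSeries` in `H^k`, without its constant term. -/
def cosSeriesSob (k : ℕ) : Ell →L[ℝ] HSob k :=
  lift (fun n => (seriesZero (unitVec n)).toHSob k)
    (exists_norm_toHSob_seriesZero_unitVec_le k).choose
    (exists_norm_toHSob_seriesZero_unitVec_le k).choose_spec

lemma comp_zero_cosSeriesSob (k : ℕ) (b : Ell) :
    HSob.comp 0 (cosSeriesSob k b) = cosSeriesL2 b := by
  have : (HSob.comp 0).comp (cosSeriesSob k) = cosSeriesL2 := Ell.hom_ext fun n => by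
    rw [ContinuousLinearMap.comp_apply, cosSeriesSob, lift_unitVec,
      comp_zero_toHSob_seriesZero]
  exact DFunLike.congr_fun this b

lemma toHSob_seriesZero (k : ℕ) (b : Ell) : (seriesZero b).toHSob k = cosSeriesSob k b :=
  HSob.ext_coef fun n => by
    rw [comp_zero_cosSeriesSob, comp_zero_toHSob_seriesZero]

/-! ### The linearized operator -/

lemma hasSum_inner_zeroMean (g : L2Zero) (f : C(Torus, ℝ)) :
    HasSum (fun n : ℤ => L2Zero.coefL n g * conj (coef f n)) ((inner ℝ g (zeroMean f) : ℝ) : ℂ) :=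
  (L2Zero.hasSum_inner g (zeroMean f)).congr_fun fun n => by
    rcases eq_or_ne n 0 with rfl | hn
    · rw [L2Zero.coefL_zero_apply, zero_mul, zero_mul]
    · rw [coefL_zeroMean hn]

lemma inner_zeroMean_eq_integral (g : L2Zero) (f : C(Torus, ℝ)) :
    inner ℝ g (zeroMean f) = ∫ x, l2fn g x * f x ∂torusMeasure := by
  have h := (hasSum_inner_zeroMean g f).unique
    (hasSum_coef_mul_conj_of_memLp (Lp.memLp _) (memLp_of_continuous f.continuous))
  exact_mod_cast h

lemma zeroMean_smul_one (c : ℝ) : zeroMean (c • 1) = 0 := L2Zero.ext_coef fun n => by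
  rw [map_zero]
  rcases eq_or_ne n 0 with rfl | hn
  · exact L2Zero.coefL_zero_apply _
  · rw [coefL_zeroMean hn, coef_continuousMap_smul, coef_one, if_neg hn, mul_zero]

lemma memLp_mul_l2fn (f : C(Torus, ℝ)) (g : L2Zero) :
    MemLp (fun x => f x * l2fn g x) 2 torusMeasure := by
  have hg : MemLp (l2fn g) 2 torusMeasure := Lp.memLp _
  refine MemLp.of_le_mul (c := ‖f‖) hg
    (f.continuous.aestronglyMeasurable.mul hg.aestronglyMeasurable) (ae_of_all _ fun x => ?_)
  rw [norm_mul]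
  exact mul_le_mul_of_nonneg_right (f.norm_coe_le_norm x) (norm_nonneg _)

/-- The graph of the operator `g ↦ (f g)' + H g` on `L²`, with a weak derivative; for `f = u - v`
this is the linearized operator. -/
def IsFluxHilbert (f : C(Torus, ℝ)) (g w : L2Zero) : Prop :=
  ∀ n : ℤ, L2Zero.coefL n w = Complex.I * n * coef (fun x => f x * l2fn g x) n
    - Complex.I * (n.sign : ℂ) * L2Zero.coefL n g

lemma isFluxHilbert_zeroMean {f p : C(Torus, ℝ)} {w : L2Zero} (hp : coef p 0 = 0)
    (h : ∀ n : ℤ, L2Zero.coefL n w =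
      Complex.I * n * coef (f * p : C(Torus, ℝ)) n - Complex.I * (n.sign : ℂ) * coef p n) :
    IsFluxHilbert f (zeroMean p) w := fun n => by
  have hmul : coef (fun x => f x * l2fn (zeroMean p) x) n = coef (f * p : C(Torus, ℝ)) n :=
    coef_congr_ae ((zeroMean_ae hp).mono fun x hx => congrArg (f x * ·) hx) n
  rw [hmul, coefL_zeroMean_of_coef_zero hp, h n]

namespace IsFluxHilbert

variable {f : C(Torus, ℝ)} {g w g' w' : L2Zero}

lemma add (h : IsFluxHilbert f g w) (h' : IsFluxHilbert f g' w') :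
    IsFluxHilbert f (g + g') (w + w') := fun n => by
  have hcoef : coef (fun x => f x * l2fn (g + g') x) n =
      coef (fun x => f x * l2fn g x) n + coef (fun x => f x * l2fn g' x) n := by
    rw [← coef_add ((memLp_mul_l2fn f g).integrable (by norm_num))
      ((memLp_mul_l2fn f g').integrable (by norm_num))]
    refine coef_congr_ae ((Lp.coeFn_add g.1 g'.1).mono fun x hx => ?_) n
    change f x * _ = f x * _ + f x * _
    rw [← mul_add]
    exact congrArg (f x * ·) hx
  rw [map_add, map_add, h n, h' n, hcoef]
  ring

lemma smul (h : IsFluxHilbert f g w) (c : ℝ) : IsFluxHilbert f (c • g) (c • w) := fun n => by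
  have hcoef : coef (fun x => f x * l2fn (c • g) x) n = c * coef (fun x => f x * l2fn g x) n := by
    rw [← coef_smul]
    refine coef_congr_ae ((Lp.coeFn_smul c g.1).mono fun x hx => ?_) n
    change f x * _ = c * (f x * _)
    rw [mul_left_comm]
    exact congrArg (f x * ·) hx
  rw [map_smul, map_smul, h n, hcoef, Complex.real_smul, Complex.real_smul]
  ring

lemma inner_zeroMean (h : IsFluxHilbert f g w) {p p' hp : C(Torus, ℝ)}
    (hderiv : ∀ n, coef p' n = Complex.I * n * coef p n) (hhilbert : IsHilbertTransform p hp) :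
    inner ℝ w (zeroMean p) = -inner ℝ g (zeroMean (f * p' + hp)) := by
  have hmul : HasSum (fun n : ℤ => coef (fun x => f x * l2fn g x) n * conj (coef p' n))
      ((inner ℝ g (zeroMean (f * p')) : ℝ) : ℂ) := by
    rw [inner_zeroMean_eq_integral]
    convert hasSum_coef_mul_conj_of_memLp (memLp_mul_l2fn f g)
      (memLp_of_continuous p'.continuous) using 4 with x
    rw [ContinuousMap.mul_apply]
    ring
  have heq := (hasSum_inner_zeroMean w p).unique <|
    (hmul.add (hasSum_inner_zeroMean g hp)).neg.congr_fun fun n => by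
      rw [h n, hderiv, hhilbert]
      simp only [map_mul, map_neg, Complex.conj_I, map_intCast]
      ring
  rw [map_add, inner_add_right]
  exact_mod_cast heq

end IsFluxHilbert

/-! ### The linearization along the branch -/

lemma map_eq_zero_of_hasDerivAt {E F : Type*} [NormedAddCommGroup E] [NormedSpace ℝ E]
    [NormedAddCommGroup F] [NormedSpace ℝ F] {γ : ℝ → E} {γ' : E} {t : ℝ}
    (h : HasDerivAt γ γ' t) (ℓ : E →L[ℝ] F) (hℓ : ∀ᶠ s in 𝓝 t, ℓ (γ s) = 0) : ℓ γ' = 0 :=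
  (ℓ.hasFDerivAt.comp_hasDerivAt t h).unique
    ((hasDerivAt_const t (0 : F)).congr_of_eventuallyEq hℓ)

lemma eq_coord_zero_smul_unitVec {c : Ell} (h : ∀ n ≠ 0, coord n c = 0) :
    c = coord 0 c • unitVec 0 := ext_coord fun n => by
  rw [map_smul (coord n), coord_unitVec, smul_eq_mul]
  rcases eq_or_ne n 0 with rfl | hn
  · rw [if_pos rfl, mul_one]
  · rw [h n hn, if_neg hn.symm, mul_zero]

lemma coef_derivSeries_zero (c : Ell) : coef (derivSeries c) 0 = 0 := by
  rw [coef_derivSeries, Int.cast_zero, mul_zero, zero_mul]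

lemma coef_cosSeries_invLam (c : Ell) (k : ℤ) :
    coef (cosSeries (invLam c)) k = Complex.I * (k.sign : ℂ) * coef (antiderivSeries c) k := by
  rcases eq_or_ne k 0 with rfl | hk
  · rw [coef_cosSeries_zero, coord_invLam, coef_antiderivSeries_zero]
    simp
  · have hI : Complex.I * k ≠ 0 := mul_ne_zero Complex.I_ne_zero (by exact_mod_cast hk)
    apply mul_left_cancel₀ hI
    rw [← coef_derivSeries, derivSeries_invLam, ← neg_one_smul ℝ, coef_continuousMap_smul,
      coef_sinSeries, coef_cosSeries_eq_coef_antiderivSeries c hk]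
    push_cast
    ring

/-- The derivative `∂_ε (ε • b ε)`, which describes `∂_ε u_ε` as a cosine series. -/
def waveDer (b : ℝ → Ell) (ε : ℝ) : Ell := deriv (fun e => e • b e) ε

/-- The coefficient `u_ε - v_ε` of the linearized operator. -/
def linCoeff (b : ℝ → Ell) (ν : ℝ → ℝ) (ε : ℝ) : C(Torus, ℝ) := cosSeries (ε • b ε) - ν ε • 1

lemma linCoeff_mul (b : ℝ → Ell) (ν : ℝ → ℝ) (ε : ℝ) (f : C(Torus, ℝ)) :
    linCoeff b ν ε * f = cosSeries (ε • b ε) * f - ν ε • f := by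
  rw [linCoeff, sub_mul, smul_mul_assoc, one_mul]

namespace IsProfile

variable {δ : ℝ} {b : ℝ → Ell} {ν : ℝ → ℝ} {ε : ℝ}

lemma zero_mem (h : IsProfile δ b ν) : (0 : ℝ) ∈ Ioo (-δ) δ := ⟨neg_neg_of_pos h.pos, h.pos⟩

lemma eventually_mem (hε : ε ∈ Ioo (-δ) δ) : ∀ᶠ e in 𝓝 ε, e ∈ Ioo (-δ) δ :=
  isOpen_Ioo.mem_nhds hε

lemma contDiffAt_wave (h : IsProfile δ b ν) (hε : ε ∈ Ioo (-δ) δ) :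
    ContDiffAt ℝ ω (fun e => e • b e) ε := contDiffAt_id.smul (h.smooth ε hε)

lemma hasDerivAt_wave (h : IsProfile δ b ν) (hε : ε ∈ Ioo (-δ) δ) :
    HasDerivAt (fun e => e • b e) (waveDer b ε) ε :=
  ((h.contDiffAt_wave hε).differentiableAt (by simp)).hasDerivAt

lemma hasDerivAt_vel (h : IsProfile δ b ν) (hε : ε ∈ Ioo (-δ) δ) : HasDerivAt ν (deriv ν ε) ε :=
  ((h.smooth_vel ε hε).differentiableAt (by simp)).hasDerivAt

lemma contDiffAt_waveDer (h : IsProfile δ b ν) (hε : ε ∈ Ioo (-δ) δ) :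
    ContDiffAt ℝ ∞ (waveDer b) ε := by
  have hwave : ContDiffOn ℝ ∞ (fun e => e • b e) (Ioo (-δ) δ) := fun e he =>
    ((h.contDiffAt_wave he).of_le le_top).contDiffWithinAt
  exact (hwave.deriv_of_isOpen isOpen_Ioo (by simp)).contDiffAt (isOpen_Ioo.mem_nhds hε)

lemma waveDer_zero (h : IsProfile δ b ν) : waveDer b 0 = cosVec := by
  have hderiv := ((hasDerivAt_id (0 : ℝ)).smul
    ((h.smooth 0 h.zero_mem).differentiableAt (by simp)).hasDerivAt).deriv
  simp only [id, zero_smul, zero_add, one_smul, h.at_zero] at hderiv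
  exact hderiv

lemma coord_zero_waveDer (h : IsProfile δ b ν) (hε : ε ∈ Ioo (-δ) δ) : coord 0 (waveDer b ε) = 0 :=
  map_eq_zero_of_hasDerivAt (h.hasDerivAt_wave hε) (coord 0) <|
    (eventually_mem hε).mono fun _ he => h.coord_zero_wave he

lemma coef_cosSeries_waveDer_zero (h : IsProfile δ b ν) (hε : ε ∈ Ioo (-δ) δ) :
    coef (cosSeries (waveDer b ε)) 0 = 0 := by
  rw [coef_cosSeries_zero, h.coord_zero_waveDer hε, Complex.ofReal_zero]

lemma hasDerivAt_eqn (h : IsProfile δ b ν) (hε : ε ∈ Ioo (-δ) δ) :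
    HasDerivAt (fun e => (1 / 2 : ℝ) • ellMul (e • b e) (e • b e) - invLam (e • b e) -
        ν e • (e • b e))
      (ellMul (ε • b ε) (waveDer b ε) - invLam (waveDer b ε) -
        (ν ε • waveDer b ε + deriv ν ε • (ε • b ε))) ε := by
  have hwave := h.hasDerivAt_wave hε
  have hmul : HasDerivAt (fun e => ellMul (e • b e)) (ellMul (waveDer b ε)) ε :=
    ellMul.hasFDerivAt.comp_hasDerivAt ε hwave
  have hsq := (hmul.clm_apply hwave).const_smul (1 / 2 : ℝ)
  rw [ellMul_comm (waveDer b ε), ← two_smul ℝ (ellMul (ε • b ε) (waveDer b ε)), smul_smul,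
    one_div_mul_cancel two_ne_zero, one_smul] at hsq
  exact (hsq.sub (invLam.hasFDerivAt.comp_hasDerivAt ε hwave)).sub
    ((h.hasDerivAt_vel hε).smul hwave)

lemma linCoeff_mul_waveDer (h : IsProfile δ b ν) (hε : ε ∈ Ioo (-δ) δ) :
    ∃ κ : ℝ, linCoeff b ν ε * cosSeries (waveDer b ε) =
      cosSeries (invLam (waveDer b ε)) + deriv ν ε • cosSeries (ε • b ε) + κ • 1 := by
  have hκ := eq_coord_zero_smul_unitVec fun n hn =>
    map_eq_zero_of_hasDerivAt (h.hasDerivAt_eqn hε) (coord n) <|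
      (eventually_mem hε).mono fun e he => by
        obtain ⟨κ, hκ⟩ := h.eqn e he
        refine (congrArg (coord n) hκ).trans ?_
        rw [map_smul, coord_unitVec, if_neg hn.symm, smul_zero]
  generalize coord 0 _ = κ at hκ
  refine ⟨κ, ?_⟩
  have hseries := congrArg cosSeries hκ
  rw [linCoeff_mul]
  generalize ε • b ε = A at hseries ⊢
  rw [map_sub, map_sub, map_add, map_smul _ κ, cosSeries_ellMul, map_smul _ (ν ε),
    map_smul _ (deriv ν ε), cosSeries_unitVec, pow_zero, one_smul, Nat.cast_zero,
    cosT_zero] at hseries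
  rw [← hseries]
  abel

lemma linCoeff_mul_derivSeries (h : IsProfile δ b ν) (hε : ε ∈ Ioo (-δ) δ) :
    linCoeff b ν ε * derivSeries (ε • b ε) = -sinSeries (ε • b ε) := by
  rw [linCoeff_mul, ← h.wave_eq hε]
  abel

lemma isLinearization_iff (h : IsProfile δ b ν) (hε : ε ∈ Ioo (-δ) δ) (g w : L2Zero) :
    IsLinearization (seriesZero (ε • b ε)) (ν ε) g w ↔ IsFluxHilbert (linCoeff b ν ε) g w := by
  have hcoeff : (fun x => ((seriesZero (ε • b ε)).fn x - ν ε) * l2fn g x) =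
      fun x => linCoeff b ν ε x * l2fn g x := funext fun x => by
    rw [h.fn_eq hε, linCoeff, ContinuousMap.sub_apply, ContinuousMap.smul_apply,
      ContinuousMap.one_apply, smul_eq_mul, mul_one]
  unfold IsLinearization
  rw [hcoeff]
  rfl

lemma isFluxHilbert_derivSeriesL2 (h : IsProfile δ b ν) (hε : ε ∈ Ioo (-δ) δ) :
    IsFluxHilbert (linCoeff b ν ε) (derivSeriesL2 (ε • b ε)) 0 :=
  isFluxHilbert_zeroMean (p := derivSeries (ε • b ε)) (coef_derivSeries_zero _) fun n => by
    rw [h.linCoeff_mul_derivSeries hε, ← neg_one_smul ℝ, coef_continuousMap_smul, coef_sinSeries,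
      coef_derivSeries, map_zero]
    push_cast
    ring

lemma isFluxHilbert_cosSeriesL2 (h : IsProfile δ b ν) (hε : ε ∈ Ioo (-δ) δ) :
    IsFluxHilbert (linCoeff b ν ε) (cosSeriesL2 (waveDer b ε))
      (deriv ν ε • derivSeriesL2 (ε • b ε)) :=
  isFluxHilbert_zeroMean (p := cosSeries (waveDer b ε))
      (h.coef_cosSeries_waveDer_zero hε) fun n => by
    obtain ⟨κ, hκ⟩ := h.linCoeff_mul_waveDer hε
    have hderiv : L2Zero.coefL n (derivSeriesL2 (ε • b ε)) =
        Complex.I * n * coef (cosSeries (ε • b ε)) n := by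
      rw [← coef_derivSeries]
      exact coefL_zeroMean_of_coef_zero (coef_derivSeries_zero _) n
    have hhilbert : Complex.I * n * coef (cosSeries (invLam (waveDer b ε))) n =
        Complex.I * (n.sign : ℂ) * coef (cosSeries (waveDer b ε)) n := by
      rw [← coef_derivSeries, derivSeries_invLam, ← neg_one_smul ℝ, coef_continuousMap_smul,
        coef_sinSeries]
      push_cast
      ring
    have hconst : Complex.I * n * coef (1 : C(Torus, ℝ)) n = 0 := by
      rw [coef_one]
      split_ifs with hn
      · rw [hn, Int.cast_zero, mul_zero, zero_mul]
      · rw [mul_zero]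
    generalize ε • b ε = A at hκ hderiv ⊢
    rw [hκ, map_smul, hderiv, ← coefC_apply n (_ + _), map_add, map_add, map_smul, map_smul,
      coefC_apply, coefC_apply, coefC_apply, Complex.real_smul, Complex.real_smul,
      Complex.real_smul]
    linear_combination -hhilbert - (κ : ℂ) * hconst

lemma inner_cosSeriesL2_eq_zero (h : IsProfile δ b ν) (hε : ε ∈ Ioo (-δ) δ) {g w : L2Zero}
    (hl : IsFluxHilbert (linCoeff b ν ε) g w) : inner ℝ w (cosSeriesL2 (ε • b ε)) = 0 := by
  refine (hl.inner_zeroMean (coef_derivSeries _) (coef_sinSeries _)).trans ?_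
  rw [h.linCoeff_mul_derivSeries hε, neg_add_cancel, map_zero, inner_zero_right, neg_zero]

lemma inner_antiderivSeriesL2 (h : IsProfile δ b ν) (hε : ε ∈ Ioo (-δ) δ) {g w : L2Zero}
    (hl : IsFluxHilbert (linCoeff b ν ε) g w) :
    inner ℝ w (antiderivSeriesL2 (waveDer b ε)) =
      -(deriv ν ε * inner ℝ g (cosSeriesL2 (ε • b ε))) := by
  obtain ⟨κ, hκ⟩ := h.linCoeff_mul_waveDer hε
  have hderiv : ∀ n : ℤ, coef (cosSeries (waveDer b ε)) n =
      Complex.I * n * coef (antiderivSeries (waveDer b ε)) n := fun n => by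
    rcases eq_or_ne n 0 with rfl | hn
    · rw [h.coef_cosSeries_waveDer_zero hε, Int.cast_zero, mul_zero, zero_mul]
    · exact coef_cosSeries_eq_coef_antiderivSeries _ hn
  have hhilbert : IsHilbertTransform (antiderivSeries (waveDer b ε))
      ((-1 : ℝ) • cosSeries (invLam (waveDer b ε)) : C(Torus, ℝ)) := fun n => by
    rw [coef_continuousMap_smul, coef_cosSeries_invLam]
    push_cast
    ring
  have hadjoint : linCoeff b ν ε * cosSeries (waveDer b ε) +
      (-1 : ℝ) • cosSeries (invLam (waveDer b ε)) = deriv ν ε • cosSeries (ε • b ε) + κ • 1 := by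
    rw [hκ, neg_one_smul]
    abel
  refine (hl.inner_zeroMean hderiv hhilbert).trans ?_
  rw [hadjoint, map_add, zeroMean_smul_one, add_zero, map_smul zeroMean, real_inner_smul_right]
  rfl

end IsProfile

/-! ### The spectral projections -/

lemma ae_torusMeasure_iff {p : Torus → Prop} :
    (∀ᵐ x ∂torusMeasure, p x) ↔ ∀ᵐ x : Torus, p x := by
  rw [AddCircle.volume_eq_smul_haarAddCircle]
  exact (Measure.ae_ennreal_smul_measure_iff
    (ENNReal.ofReal_pos.2 Real.two_pi_pos).ne').symm

lemma ae_real_iff_ae_torus {p : Torus → Prop} (hp : MeasurableSet {x | p x}) :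
    (∀ᵐ x : ℝ, p x) ↔ ∀ᵐ x ∂torusMeasure, p x := by
  rw [ae_torusMeasure_iff]
  have hperiod : ∀ t : ℝ, (∀ᵐ x : ℝ ∂(volume.restrict (Ioc t (t + 2 * π))), p (x : Torus)) ↔
      ∀ᵐ x : Torus, p x := fun t => by
    rw [← (AddCircle.measurePreserving_mk (2 * π) t).map_eq]
    exact (ae_map_iff (AddCircle.measurePreserving_mk (2 * π) t).measurable.aemeasurable hp).symm
  refine ⟨fun h => (hperiod 0).1 (ae_restrict_of_ae h), fun h => ?_⟩
  rw [← Measure.restrict_univ (μ := (volume : Measure ℝ)), ← iUnion_Ioc_zsmul Real.two_pi_pos,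
    ae_restrict_iUnion_iff]
  intro n
  rw [add_smul, one_smul]
  exact (hperiod (n • (2 * π))).2 h

lemma ae_eq_mul_iff_eq_smul_zeroMean {f : C(Torus, ℝ)} (hf : coef f 0 = 0) (w : L2Zero) (c : ℝ) :
    (∀ᵐ x : ℝ, l2fn w (x : Torus) = c * f x) ↔ w = c • zeroMean f := by
  have hw : StronglyMeasurable (l2fn w) := Lp.stronglyMeasurable _
  rw [ae_real_iff_ae_torus (p := fun x => l2fn w x = c * f x)
    (measurableSet_eq_fun hw.measurable (f.continuous.measurable.const_mul c))]
  constructor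
  · intro h
    refine L2Zero.ext_coef fun n => ?_
    rw [map_smul, coefL_zeroMean_of_coef_zero hf, Complex.real_smul, ← coef_smul]
    exact coef_congr_ae h n
  · rintro rfl
    filter_upwards [zeroMean_ae hf, Lp.coeFn_smul c (zeroMean f).1] with x hx hsmul
    rw [← hx]
    exact hsmul

lemma exists_smulRight_eq_iff {E : Type*} [NormedAddCommGroup E] [NormedSpace ℝ E] {ℓ : E →L[ℝ] ℝ}
    {z : E} (h : ℓ z = 1) (w : E) : (∃ g, ℓ.smulRight z g = w) ↔ ∃ c : ℝ, w = c • z := by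
  constructor
  · rintro ⟨g, rfl⟩
    exact ⟨ℓ g, rfl⟩
  · rintro ⟨c, rfl⟩
    exact ⟨c • z, by rw [ContinuousLinearMap.smulRight_apply, map_smul, h, smul_eq_mul, mul_one]⟩

lemma smulRight_smulRight {E : Type*} [NormedAddCommGroup E] [NormedSpace ℝ E] (ℓ ℓ' : E →L[ℝ] ℝ)
    (z z' g : E) : ℓ.smulRight z (ℓ'.smulRight z' g) = (ℓ' g * ℓ z') • z := by
  rw [ContinuousLinearMap.smulRight_apply, ContinuousLinearMap.smulRight_apply, map_smul,
    smul_eq_mul]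

/-- The pairing of `ε⁻¹ u_ε` and `∂_ε u_ε` in `L²`; the normalization of `P₀^±(ε)`. -/
def pairing (b : ℝ → Ell) (ε : ℝ) : ℝ := inner ℝ (cosSeriesL2 (b ε)) (cosSeriesL2 (waveDer b ε))

/-- The coefficient of `φ₀⁺(ε) = ∂_ε u_ε` in `P₀⁺(ε) g`, as a functional of `g`. -/
def coordPlus (b : ℝ → Ell) (ε : ℝ) : L2Zero →L[ℝ] ℝ :=
  (pairing b ε)⁻¹ • innerSL ℝ (cosSeriesL2 (b ε))

/-- The coefficient of `φ₀⁻(ε) = -ε⁻¹ u_ε'` in `P₀⁻(ε) g`, as a functional of `g`. -/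
def coordMinus (b : ℝ → Ell) (ε : ℝ) : L2Zero →L[ℝ] ℝ :=
  (pairing b ε)⁻¹ • innerSL ℝ (antiderivSeriesL2 (waveDer b ε))

/-- The projection `P₀⁺(ε)`. -/
def projPlus (b : ℝ → Ell) (ε : ℝ) : L2Zero →L[ℝ] L2Zero :=
  (coordPlus b ε).smulRight (cosSeriesL2 (waveDer b ε))

/-- The projection `P₀⁻(ε)`. -/
def projMinus (b : ℝ → Ell) (ε : ℝ) : L2Zero →L[ℝ] L2Zero :=
  (coordMinus b ε).smulRight (-derivSeriesL2 (b ε))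

lemma coordPlus_apply (b : ℝ → Ell) (ε : ℝ) (g : L2Zero) :
    coordPlus b ε g = (pairing b ε)⁻¹ * inner ℝ g (cosSeriesL2 (b ε)) := by
  rw [real_inner_comm]
  rfl

lemma coordMinus_apply (b : ℝ → Ell) (ε : ℝ) (g : L2Zero) :
    coordMinus b ε g = (pairing b ε)⁻¹ * inner ℝ g (antiderivSeriesL2 (waveDer b ε)) := by
  rw [real_inner_comm]
  rfl

section Biorthogonality

variable {b : ℝ → Ell} {ε : ℝ}

lemma coordPlus_cosSeriesL2 (hD : pairing b ε ≠ 0) :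
    coordPlus b ε (cosSeriesL2 (waveDer b ε)) = 1 := inv_mul_cancel₀ hD

lemma coordPlus_derivSeriesL2 : coordPlus b ε (-derivSeriesL2 (b ε)) = 0 := by
  rw [map_neg, coordPlus_apply, real_inner_comm, inner_cosSeriesL2_derivSeriesL2, mul_zero,
    neg_zero]

lemma coordMinus_cosSeriesL2 : coordMinus b ε (cosSeriesL2 (waveDer b ε)) = 0 := by
  rw [coordMinus_apply, inner_cosSeriesL2_antiderivSeriesL2, mul_zero]

lemma coordMinus_derivSeriesL2 (hD : pairing b ε ≠ 0) :
    coordMinus b ε (-derivSeriesL2 (b ε)) = 1 := by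
  rw [map_neg, coordMinus_apply, inner_derivSeriesL2_antiderivSeriesL2, ← pairing, mul_neg,
    neg_neg, inv_mul_cancel₀ hD]

end Biorthogonality

namespace IsProfile

variable {δ : ℝ} {b : ℝ → Ell} {ν : ℝ → ℝ} {ε : ℝ}

lemma eventually_pairing_pos (h : IsProfile δ b ν) : ∀ᶠ ε in 𝓝 (0 : ℝ), 0 < pairing b ε := by
  have hcont : ContinuousAt (pairing b) 0 :=
    ContinuousAt.inner
      (cosSeriesL2.continuous.continuousAt.comp (h.smooth 0 h.zero_mem).continuousAt)
      (cosSeriesL2.continuous.continuousAt.comp (h.contDiffAt_waveDer h.zero_mem).continuousAt)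
  refine hcont.eventually_const_lt ?_
  rw [pairing, h.at_zero, h.waveDer_zero, real_inner_self_eq_norm_sq, norm_sq_cosSeriesL2_cosVec]
  norm_num

lemma isFluxHilbert_proj (h : IsProfile δ b ν) (hε : ε ∈ Ioo (-δ) δ) (hε0 : ε ≠ 0) {g w : L2Zero}
    (hl : IsFluxHilbert (linCoeff b ν ε) g w) :
    IsFluxHilbert (linCoeff b ν ε) (projPlus b ε g + projMinus b ε g)
      (projPlus b ε w + projMinus b ε w) := by
  have hscale (z : L2Zero) : inner ℝ z (cosSeriesL2 (ε • b ε)) =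
      ε * inner ℝ z (cosSeriesL2 (b ε)) := by
    rw [map_smul]
    exact real_inner_smul_right z _ ε
  have hplus : inner ℝ w (cosSeriesL2 (b ε)) = 0 :=
    (mul_eq_zero.1 ((hscale w).symm.trans (h.inner_cosSeriesL2_eq_zero hε hl))).resolve_left hε0
  have hminus := h.inner_antiderivSeriesL2 hε hl
  rw [hscale] at hminus
  convert ((h.isFluxHilbert_cosSeriesL2 hε).smul (coordPlus b ε g)).add
    ((h.isFluxHilbert_derivSeriesL2 hε).smul (-(coordMinus b ε g * ε⁻¹))) using 1
  · rw [projPlus, projMinus, ContinuousLinearMap.smulRight_apply,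
      ContinuousLinearMap.smulRight_apply, map_smul, smul_smul, neg_mul, inv_mul_cancel_right₀ hε0,
      neg_smul, smul_neg]
  · rw [projPlus, projMinus, ContinuousLinearMap.smulRight_apply,
      ContinuousLinearMap.smulRight_apply, coordPlus_apply, coordPlus_apply, coordMinus_apply,
      hplus, hminus, map_smul, smul_smul, smul_smul, mul_zero, zero_smul, zero_add, smul_zero,
      add_zero, smul_neg, ← neg_smul]
    congr 1
    ring

lemma deriv_seriesZero_amplitude (h : IsProfile δ b ν) (hε : ε ∈ Ioo (-δ) δ) (x : ℝ) :
    deriv (fun e => seriesZero (e • b e) x) ε = cosSeries (waveDer b ε) (x : Torus) := by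
  have hderiv : HasDerivAt (fun e => evalSeries x (e • b e) - coord 0 (e • b e))
      (evalSeries x (waveDer b ε) - coord 0 (waveDer b ε)) ε :=
    ((evalSeries x).hasFDerivAt.comp_hasDerivAt ε (h.hasDerivAt_wave hε)).sub
      ((coord 0).hasFDerivAt.comp_hasDerivAt ε (h.hasDerivAt_wave hε))
  rw [h.coord_zero_waveDer hε, sub_zero, evalSeries_apply] at hderiv
  exact hderiv.deriv

lemma isZeroModeProjection (h : IsProfile δ b ν) (hε : ε ∈ Ioo (-δ) δ) (hε0 : ε ≠ 0)
    (hD : pairing b ε ≠ 0) {u : ℝ → SmoothZero} {v : ℝ → ℝ}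
    (hu : ∀ᶠ e in 𝓝 ε, u e = seriesZero (e • b e)) (hv : v ε = ν ε) :
    IsZeroModeProjection u v ε (projPlus b ε) (projMinus b ε) where
  idem_plus g := by
    rw [projPlus, smulRight_smulRight, coordPlus_cosSeriesL2 hD, mul_one]
    rfl
  idem_minus g := by
    rw [projMinus, smulRight_smulRight, coordMinus_derivSeriesL2 hD, mul_one]
    rfl
  plus_minus g := by
    rw [projPlus, projMinus, smulRight_smulRight, coordPlus_derivSeriesL2, mul_zero, zero_smul]
  minus_plus g := by
    rw [projPlus, projMinus, smulRight_smulRight, coordMinus_cosSeriesL2, mul_zero, zero_smul]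
  range_plus w := by
    have hderiv : ∀ x : ℝ, deriv (fun e => u e x) ε = cosSeries (waveDer b ε) (x : Torus) :=
      fun x => by
        rw [← h.deriv_seriesZero_amplitude hε]
        exact EventuallyEq.deriv_eq (hu.mono fun e he => congrArg (fun z : SmoothZero => z x) he)
    simp only [hderiv, ae_eq_mul_iff_eq_smul_zeroMean (h.coef_cosSeries_waveDer_zero hε)]
    exact exists_smulRight_eq_iff (coordPlus_cosSeriesL2 hD) w
  range_minus w := by
    have hderiv : ∀ x : ℝ, -ε⁻¹ * deriv (u ε) x = (-derivSeries (b ε)) (x : Torus) := fun x => by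
      have hd : deriv (seriesZero (ε • b ε)) x = derivSeries (ε • b ε) (x : Torus) :=
        congrFun (seriesZero_diff_fn (ε • b ε)) (x : Torus)
      rw [hu.self_of_nhds, hd, map_smul, ContinuousMap.smul_apply, smul_eq_mul, neg_mul,
        inv_mul_cancel_left₀ hε0, ContinuousMap.neg_apply]
    have hmean : coef ((-derivSeries (b ε) : C(Torus, ℝ))) 0 = 0 := by
      rw [← map_neg derivSeries (b ε), coef_derivSeries_zero]
    simp only [hderiv, ae_eq_mul_iff_eq_smul_zeroMean hmean, map_neg]
    exact exists_smulRight_eq_iff (coordMinus_derivSeriesL2 hD) w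
  commute g w hl := by
    rw [hu.self_of_nhds, hv] at hl ⊢
    exact (h.isLinearization_iff hε _ _).2
      (h.isFluxHilbert_proj hε hε0 ((h.isLinearization_iff hε _ _).1 hl))

end IsProfile

/-! ### Smooth implicit functions -/

lemma eventually_isInvertible_of_continuousAt {X 𝕜 E F : Type*} [TopologicalSpace X]
    [NontriviallyNormedField 𝕜] [NormedAddCommGroup E] [NormedSpace 𝕜 E] [CompleteSpace E]
    [NormedAddCommGroup F] [NormedSpace 𝕜 F] {A : X → E →L[𝕜] F} {x : X} (hA : ContinuousAt A x)
    (hx : (A x).IsInvertible) : ∀ᶠ y in 𝓝 x, (A y).IsInvertible := by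
  obtain ⟨e, he⟩ := hx
  exact hA (he ▸ ContinuousLinearEquiv.nhds e)

section ImplicitFunction

variable {E₁ E₂ F : Type*} [NormedAddCommGroup E₁] [NormedSpace ℝ E₁] [CompleteSpace E₁]
  [NormedAddCommGroup E₂] [NormedSpace ℝ E₂] [CompleteSpace E₂] [NormedAddCommGroup F]
  [NormedSpace ℝ F] [CompleteSpace F] {f : E₁ × E₂ → F} {n : WithTop ℕ∞}

lemma contDiffAt_of_eventually_apply_eq {Φ : E₁ → E₂} {q : E₁} (hf : ContDiffAt ℝ n f (q, Φ q))
    (hn : n ≠ 0) (hinv : (fderiv ℝ f (q, Φ q) ∘L .inr ℝ E₁ E₂).IsInvertible)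
    (hΦ : ContinuousAt Φ q) (hsol : ∀ᶠ q' in 𝓝 q, f (q', Φ q') = f (q, Φ q)) :
    ContDiffAt ℝ n Φ q := by
  have hgraph : Tendsto (fun q' => (q', Φ q')) (𝓝 q) (𝓝 (q, Φ q)) := continuousAt_id.prodMk hΦ
  refine (hf.contDiffAt_implicitFunction hn hinv).congr_of_eventuallyEq ?_
  filter_upwards [hgraph.eventually (hf.eventually_apply_eq_iff_implicitFunction hn hinv), hsol]
    with q' hiff hq'
  exact (hiff.1 hq').symm

lemma eventually_contDiffAt_implicitFunction {u : E₁ × E₂} (hf : ∀ᶠ p in 𝓝 u, ContDiffAt ℝ n f p)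
    (hn : n ≠ 0) (hinv : (fderiv ℝ f u ∘L .inr ℝ E₁ E₂).IsInvertible) :
    ∀ᶠ q in 𝓝 u.1, ContDiffAt ℝ n (hf.self_of_nhds.implicitFunction hn hinv) q := by
  have hfu := hf.self_of_nhds
  have hfu₁ : ContDiffAt ℝ 1 f u := hfu.of_le (ENat.one_le_iff_ne_zero_withTop.2 hn)
  set Φ := hfu.implicitFunction hn hinv
  have hΦ : ContDiffAt ℝ 1 Φ u.1 :=
    (hfu.contDiffAt_implicitFunction hn hinv).of_le (ENat.one_le_iff_ne_zero_withTop.2 hn)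
  have hopen : ∀ᶠ p in 𝓝 u, (fderiv ℝ f p ∘L .inr ℝ E₁ E₂).IsInvertible :=
    eventually_isInvertible_of_continuousAt
      ((hfu₁.fderiv_right (m := 0) (by simp)).continuousAt.clm_comp continuousAt_const) hinv
  have hΦu : Φ u.1 = u.2 := hfu.implicitFunction_apply_self hn hinv
  have hgraph : Tendsto (fun q => (q, Φ q)) (𝓝 u.1) (𝓝 u) :=
    tendsto_id.prodMk_nhds (hΦu ▸ hΦ.continuousAt.tendsto)
  filter_upwards [hgraph.eventually hf, hgraph.eventually hopen, hΦ.eventually (by simp),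
    (hfu.eventually_apply_implicitFunction hn hinv).eventually_nhds] with q hfq hinvq hΦq hsol
  exact contDiffAt_of_eventually_apply_eq hfq hn hinvq hΦq.continuousAt
    (hsol.mono fun q' hq' => hq'.trans hsol.self_of_nhds.symm)

end ImplicitFunction

/-! ### Translates of series -/

namespace L2Zero

lemma trans_zero (f : L2Zero) : trans 0 f = f := L2Zero.ext_coef fun n => by
  rw [coef_trans, QuotientAddGroup.mk_zero, fourier_eval_zero, one_mul]

lemma trans_trans_neg (a : ℝ) (f : L2Zero) : trans a (trans (-a) f) = f :=
  L2Zero.ext_coef fun n => by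
    have hneg : fourier (-n) ((-a : ℝ) : Torus) = fourier n (a : Torus) := by
      rw [fourier_apply, fourier_apply, QuotientAddGroup.mk_neg, smul_neg, neg_smul, neg_neg]
    rw [coef_trans, coef_trans, hneg, ← mul_assoc, ← fourier_add, neg_add_cancel, fourier_zero,
      one_mul]

lemma inner_trans (a : ℝ) (f g : L2Zero) : inner ℝ (trans a f) g = inner ℝ f (trans (-a) g) := by
  conv_lhs => rw [← trans_trans_neg a g]
  exact (trans a).inner_map_map f _

/- Translation is only strongly continuous on `L²`; norm smoothness comes from the regularity of
the range of `A`. -/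
lemma contDiff_trans_comp {E : Type*} [NormedAddCommGroup E] [NormedSpace ℝ E] {A : E →L[ℝ] L2Zero}
    (S : ∀ k : ℕ, E →L[ℝ] HSob k) (hS : ∀ k c, HSob.comp 0 (S k c) = A c) :
    ContDiff ℝ ∞ fun a => (trans a).toContinuousLinearMap.comp A := by
  refine contDiff_infty.2 fun j => ?_
  have hsmooth : ContDiff ℝ j fun a => (HSob.comp 0).comp
      ((HSob.transIncl (Nat.zero_le (j + 1)) a).comp (S (j + 1))) :=
    contDiff_const.clm_comp ((HSob.contDiff_transIncl j (Nat.zero_le (j + 1)) (by omega)).clm_comp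
      contDiff_const)
  convert hsmooth using 2 with a
  ext1 c
  exact congrArg (trans a) (hS (j + 1) c).symm

lemma hasDerivAt_inner_trans_neg (f : L2Zero) (F : HSob 1) :
    HasDerivAt (fun a : ℝ => (inner ℝ f (trans (-a) (HSob.comp 0 F)) : ℝ))
      (inner ℝ f (HSob.comp 0 (HSob.der F))) 0 := by
  have htrans : HasDerivAt (fun t => trans t (HSob.comp 0 F)) (-HSob.comp 0 (HSob.der F))
      (-(0 : ℝ)) := by
    have := (HSob.comp 0).hasFDerivAt.comp_hasDerivAt (0 : ℝ) (HSob.hasDerivAt_transL F 0)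
    rw [HSob.transL_zero, map_neg] at this
    rwa [neg_zero]
  have hneg := htrans.scomp (0 : ℝ) (hasDerivAt_neg (0 : ℝ))
  rw [neg_one_smul, neg_neg] at hneg
  exact (innerSL ℝ f).hasFDerivAt.comp_hasDerivAt (0 : ℝ) hneg

end L2Zero

/-- The antiderivative of the cosine series in `H^k`; the sign comes from
`sin (n x) / n = -(cos (n x) / n ^ 2)'`. -/
def antiderivSeriesSob (k : ℕ) : Ell →L[ℝ] HSob k :=
  -((HSob.der.comp (cosSeriesSob (k + 1))).comp (invLam.comp invLam))

lemma coef_antiderivSeries_eq (c : Ell) (n : ℤ) :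
    coef (antiderivSeries c) n =
      -(Complex.I * n * coef (cosSeries (invLam (invLam c))) n) := by
  rcases eq_or_ne n 0 with rfl | hn
  · rw [coef_antiderivSeries_zero, Int.cast_zero, mul_zero, zero_mul, neg_zero]
  · have hsign : (n.sign : ℂ) * n.sign = 1 := by
      have : n.sign * n.sign = 1 := by
        rw [← Int.sign_mul, Int.sign_eq_one_of_pos (mul_self_pos.2 hn)]
      exact_mod_cast this
    rw [← coef_derivSeries, derivSeries_invLam, ← neg_one_smul ℝ (sinSeries _),
      coef_continuousMap_smul, coef_sinSeries, coef_cosSeries_invLam]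
    push_cast
    linear_combination (coef (antiderivSeries c) n * Complex.I ^ 2) * hsign +
      coef (antiderivSeries c) n * Complex.I_sq

lemma comp_zero_antiderivSeriesSob (k : ℕ) (c : Ell) :
    HSob.comp 0 (antiderivSeriesSob k c) = antiderivSeriesL2 c := L2Zero.ext_coef fun n => by
  change L2Zero.coefL n (-HSob.comp 0 (HSob.der (cosSeriesSob (k + 1) (invLam (invLam c))))) = _
  rw [map_neg, HSob.coef_der, comp_zero_cosSeriesSob]
  rcases eq_or_ne n 0 with rfl | hn
  · rw [L2Zero.coefL_zero_apply, L2Zero.coefL_zero_apply, mul_zero, neg_zero]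
  · rw [coefL_cosSeriesL2 _ hn, ← coef_antiderivSeries_eq]
    exact (coefL_zeroMean hn _).symm

lemma comp_zero_der_cosSeriesSob (k : ℕ) (c : Ell) :
    HSob.comp 0 (HSob.der (cosSeriesSob (k + 1) c)) = derivSeriesL2 c :=
  L2Zero.ext_coef fun n => by rw [HSob.coef_der, coefL_derivSeriesL2, comp_zero_cosSeriesSob]

lemma comp_zero_der_antiderivSeriesSob (k : ℕ) (c : Ell) :
    HSob.comp 0 (HSob.der (antiderivSeriesSob (k + 1) c)) = cosSeriesL2 c :=
  L2Zero.ext_coef fun n => by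
    rw [HSob.coef_der, coefL_cosSeriesL2_eq, comp_zero_antiderivSeriesSob]

/-! ### The modulation equations -/

/-- The equations `P₀^± g = 0` for `f(x) = σ b(x + a) + g(x + a)`, where `b` is the profile with
parameter `εσ`; here `p = ((ε, f), (σ, a))`. Dividing the decomposition by `ε` in this way makes
the equations nondegenerate at `ε = 0`. The translation acts on the series and not on `f`, because
`a ↦ f(· - a)` is not differentiable in `L²`. -/
def modEq (b : ℝ → Ell) (p : (ℝ × L2Zero) × (ℝ × ℝ)) : ℝ × ℝ :=
  (inner ℝ p.1.2 (L2Zero.trans (-p.2.2) (cosSeriesL2 (b (p.1.1 * p.2.1)))) -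
    p.2.1 * inner ℝ (cosSeriesL2 (b (p.1.1 * p.2.1))) (cosSeriesL2 (b (p.1.1 * p.2.1))),
   inner ℝ p.1.2 (L2Zero.trans (-p.2.2) (antiderivSeriesL2 (waveDer b (p.1.1 * p.2.1)))))

lemma modEq_self (b : ℝ → Ell) (ε : ℝ) : modEq b ((ε, cosSeriesL2 (b ε)), (1, 0)) = 0 := by
  simp only [modEq, neg_zero, mul_one, one_mul, L2Zero.trans_zero, sub_self,
    inner_cosSeriesL2_antiderivSeriesL2, Prod.mk_zero_zero]

lemma inner_self_cosSeriesL2_cosVec :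
    inner ℝ (cosSeriesL2 cosVec) (cosSeriesL2 cosVec) = (1 / 2 : ℝ) := by
  rw [real_inner_self_eq_norm_sq, norm_sq_cosSeriesL2_cosVec]

namespace IsProfile

variable {δ : ℝ} {b : ℝ → Ell} {ν : ℝ → ℝ}

lemma contDiffAt_modEq (h : IsProfile δ b ν) {p : (ℝ × L2Zero) × (ℝ × ℝ)}
    (hp : p.1.1 * p.2.1 ∈ Ioo (-δ) δ) : ContDiffAt ℝ ∞ (modEq b) p := by
  have he : ContDiffAt ℝ ∞ (fun p : (ℝ × L2Zero) × (ℝ × ℝ) => p.1.1 * p.2.1) p := by fun_prop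
  have ha : ContDiffAt ℝ ∞ (fun p : (ℝ × L2Zero) × (ℝ × ℝ) => -p.2.2) p := by fun_prop
  have hf : ContDiffAt ℝ ∞ (fun p : (ℝ × L2Zero) × (ℝ × ℝ) => p.1.2) p := by fun_prop
  have hσ : ContDiffAt ℝ ∞ (fun p : (ℝ × L2Zero) × (ℝ × ℝ) => p.2.1) p := by fun_prop
  have hb := ((h.smooth _ hp).of_le le_top).comp p he
  have hcos := cosSeriesL2.contDiff.contDiffAt.comp p hb
  have htransCos :=
    ((L2Zero.contDiff_trans_comp cosSeriesSob comp_zero_cosSeriesSob).contDiffAt.comp p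
      ha).clm_apply hb
  have htransAnti :=
    ((L2Zero.contDiff_trans_comp antiderivSeriesSob comp_zero_antiderivSeriesSob).contDiffAt.comp p
      ha).clm_apply ((h.contDiffAt_waveDer hp).comp p he)
  exact ((hf.inner ℝ htransCos).sub (hσ.mul (hcos.inner ℝ hcos))).prodMk (hf.inner ℝ htransAnti)

lemma eventually_contDiffAt_modEq (h : IsProfile δ b ν) :
    ∀ᶠ p in 𝓝 (((0 : ℝ), cosSeriesL2 cosVec), ((1 : ℝ), (0 : ℝ))),
      ContDiffAt ℝ ∞ (modEq b) p := by
  have hmul : Tendsto (fun p : (ℝ × L2Zero) × (ℝ × ℝ) => p.1.1 * p.2.1)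
      (𝓝 ((0, cosSeriesL2 cosVec), (1, 0))) (𝓝 0) :=
    Continuous.tendsto' (by fun_prop) _ _ (zero_mul 1)
  exact (hmul.eventually (eventually_mem h.zero_mem)).mono fun p hp => h.contDiffAt_modEq hp

lemma modEq_zero_cosVec (h : IsProfile δ b ν) (y : ℝ × ℝ) :
    modEq b ((0, cosSeriesL2 cosVec), y) =
      (inner ℝ (cosSeriesL2 cosVec) (L2Zero.trans (-y.2) (cosSeriesL2 cosVec)) - y.1 * (1 / 2),
        inner ℝ (cosSeriesL2 cosVec) (L2Zero.trans (-y.2) (antiderivSeriesL2 cosVec))) := by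
  simp only [modEq, zero_mul, h.at_zero, h.waveDer_zero, inner_self_cosSeriesL2_cosVec]

lemma hasFDerivAt_modEq_zero_cosVec (h : IsProfile δ b ν) :
    HasFDerivAt (fun y : ℝ × ℝ => modEq b ((0, cosSeriesL2 cosVec), y))
      (((-(1 / 2) : ℝ) • ContinuousLinearMap.fst ℝ ℝ ℝ).prod
        ((1 / 2 : ℝ) • ContinuousLinearMap.snd ℝ ℝ ℝ)) (1, 0) := by
  have hsnd : HasFDerivAt (fun y : ℝ × ℝ => y.2) (.snd ℝ ℝ ℝ) ((1 : ℝ), (0 : ℝ)) :=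
    hasFDerivAt_snd
  have hcos := L2Zero.hasDerivAt_inner_trans_neg (cosSeriesL2 cosVec) (cosSeriesSob 1 cosVec)
  rw [comp_zero_cosSeriesSob, comp_zero_der_cosSeriesSob, inner_cosSeriesL2_derivSeriesL2] at hcos
  have hanti := L2Zero.hasDerivAt_inner_trans_neg (cosSeriesL2 cosVec) (antiderivSeriesSob 1 cosVec)
  rw [comp_zero_antiderivSeriesSob, comp_zero_der_antiderivSeriesSob,
    inner_self_cosSeriesL2_cosVec] at hanti
  have hfirst := (HasDerivAt.comp_hasFDerivAt ((1 : ℝ), (0 : ℝ)) hcos hsnd).sub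
    (hasFDerivAt_fst.mul_const (1 / 2 : ℝ))
  have hsecond := HasDerivAt.comp_hasFDerivAt ((1 : ℝ), (0 : ℝ)) hanti hsnd
  rw [funext h.modEq_zero_cosVec]
  refine (hfirst.congr_fderiv ?_).prodMk hsecond
  rw [zero_smul, zero_sub]
  exact (neg_smul _ _).symm

lemma isInvertible_fderiv_modEq (h : IsProfile δ b ν) :
    (fderiv ℝ (modEq b) ((0, cosSeriesL2 cosVec), (1, 0)) ∘L
      .inr ℝ (ℝ × L2Zero) (ℝ × ℝ)).IsInvertible := by
  have hpartial := (h.eventually_contDiffAt_modEq.self_of_nhds.differentiableAt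
    (by simp)).hasFDerivAt.comp ((1 : ℝ), (0 : ℝ)) (hasFDerivAt_prodMk_right _ _)
  rw [hpartial.unique h.hasFDerivAt_modEq_zero_cosVec]
  refine ⟨ContinuousLinearEquiv.equivOfInverse
    (((-(1 / 2) : ℝ) • ContinuousLinearMap.fst ℝ ℝ ℝ).prod
      ((1 / 2 : ℝ) • ContinuousLinearMap.snd ℝ ℝ ℝ))
    (((-2 : ℝ) • ContinuousLinearMap.fst ℝ ℝ ℝ).prod
      ((2 : ℝ) • ContinuousLinearMap.snd ℝ ℝ ℝ)) ?_ ?_, rfl⟩ <;>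
  · rintro ⟨x, y⟩
    ext <;> simp

lemma continuousAt_cosSeriesL2 (h : IsProfile δ b ν) :
    ContinuousAt (fun ε => cosSeriesL2 (b ε)) 0 :=
  cosSeriesL2.continuous.continuousAt.comp (h.smooth 0 h.zero_mem).continuousAt

lemma exists_modulation (h : IsProfile δ b ν) :
    ∃ K : ℝ, 0 ≤ K ∧ ∃ Φ : ℝ × L2Zero → ℝ × ℝ, ∀ᶠ q : ℝ × L2Zero in 𝓝 (0, 0),
      ContDiffAt ℝ ∞ Φ (q.1, cosSeriesL2 (b q.1) + q.2) ∧
      ‖Φ (q.1, cosSeriesL2 (b q.1) + q.2) - (1, 0)‖ ≤ K * ‖q.2‖ ∧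
      modEq b ((q.1, cosSeriesL2 (b q.1) + q.2), Φ (q.1, cosSeriesL2 (b q.1) + q.2)) = 0 := by
  have hsmooth := h.eventually_contDiffAt_modEq
  have hbase : modEq b ((0, cosSeriesL2 cosVec), (1, 0)) = 0 := h.at_zero ▸ modEq_self b 0
  have hsol := hsmooth.self_of_nhds.eventually_apply_implicitFunction (by simp)
    h.isInvertible_fderiv_modEq
  have huniq := hsmooth.self_of_nhds.eventually_apply_eq_iff_implicitFunction (by simp)
    h.isInvertible_fderiv_modEq
  have hΦ := eventually_contDiffAt_implicitFunction hsmooth (by simp) h.isInvertible_fderiv_modEq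
  set Φ := hsmooth.self_of_nhds.implicitFunction (by simp) h.isInvertible_fderiv_modEq
  rw [hbase] at hsol huniq
  obtain ⟨K, s, hs, hK⟩ :=
    (hΦ.self_of_nhds.of_le (m := 1) (by simp)).exists_lipschitzOnWith
  have hfst : Tendsto Prod.fst (𝓝 ((0 : ℝ), (0 : L2Zero))) (𝓝 0) := continuousAt_fst
  have hwave : Tendsto (fun q : ℝ × L2Zero => cosSeriesL2 (b q.1)) (𝓝 (0, 0))
      (𝓝 (cosSeriesL2 cosVec)) := h.at_zero ▸ h.continuousAt_cosSeriesL2.tendsto.comp hfst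
  have hcentre := hfst.prodMk_nhds hwave
  have hshift : Tendsto (fun q : ℝ × L2Zero => (q.1, cosSeriesL2 (b q.1) + q.2)) (𝓝 (0, 0))
      (𝓝 (0, cosSeriesL2 cosVec)) :=
    hfst.prodMk_nhds (add_zero (cosSeriesL2 cosVec) ▸ hwave.add continuousAt_snd.tendsto)
  refine ⟨K, K.2, Φ, ?_⟩
  filter_upwards [hshift.eventually hΦ, hshift.eventually hsol, hshift.eventually hs,
    hcentre.eventually hs, (hcentre.prodMk_nhds tendsto_const_nhds).eventually huniq]
    with q hsmoothq hsolq hq hq₀ hiff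
  refine ⟨hsmoothq, ?_, hsolq⟩
  have hdist := hK.dist_le_mul _ hq _ hq₀
  rwa [hiff.1 (modEq_self b q.1), dist_eq_norm, Prod.dist_eq, dist_self, dist_eq_norm,
    add_sub_cancel_left, max_eq_right (norm_nonneg _)] at hdist

end IsProfile

/-! ### The modulated decomposition -/

/-- The remainder `f(· - a) - u_e` in the decomposition of `f`. -/
def remainder (b : ℝ → Ell) {k : ℕ} (e a : ℝ) (F : HSob k) : HSob k :=
  HSob.transL a F - cosSeriesSob k (e • b e)

lemma incl_cosSeriesSob {m k : ℕ} (h : m ≤ k) (c : Ell) :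
    HSob.incl h (cosSeriesSob k c) = cosSeriesSob m c :=
  HSob.ext_coef fun n => by
    rw [HSob.comp_zero_incl, comp_zero_cosSeriesSob, comp_zero_cosSeriesSob]

lemma incl_remainder (b : ℝ → Ell) {m k : ℕ} (h : m ≤ k) (e a : ℝ) (F : HSob k) :
    HSob.incl h (remainder b e a F) = remainder b e a (HSob.incl h F) := by
  rw [remainder, map_sub, incl_cosSeriesSob]
  rfl

lemma comp_zero_remainder (b : ℝ → Ell) {k : ℕ} (e a : ℝ) (F : HSob k) :
    HSob.comp 0 (remainder b e a F) =
      L2Zero.trans a (HSob.comp 0 F) - cosSeriesL2 (e • b e) := by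
  rw [remainder, map_sub, comp_zero_cosSeriesSob, HSob.comp_transL]

lemma exists_norm_transL_cosSeriesSob_sub_le (m : ℕ) :
    ∃ C : ℝ, 0 ≤ C ∧ ∀ (a : ℝ) (c : Ell),
      ‖HSob.transL a (cosSeriesSob m c) - cosSeriesSob m c‖ ≤ C * ‖c‖ * |a| := by
  let D : Ell →L[ℝ] HSob m := HSob.der.comp (cosSeriesSob (m + 1))
  let I : HSob m →L[ℝ] HSob m := HSob.incl le_rfl
  have htrans (t : ℝ) (c : Ell) : HSob.transIncl m.le_succ t (cosSeriesSob (m + 1) c) =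
      HSob.transL t (cosSeriesSob m c) := by
    rw [← incl_cosSeriesSob m.le_succ]
    rfl
  refine ⟨‖I‖ * ‖D‖, by positivity, fun a c => ?_⟩
  have hdiff := HSob.norm_transIncl_sub_le le_rfl (cosSeriesSob (m + 1) c) 0 a
  rw [htrans, htrans, HSob.transL_zero, sub_zero] at hdiff
  calc _ ≤ ‖I‖ * ‖D c‖ * |a| := hdiff
    _ ≤ ‖I‖ * (‖D‖ * ‖c‖) * |a| := by gcongr; exact D.le_opNorm c
    _ = ‖I‖ * ‖D‖ * ‖c‖ * |a| := by ring

/- The `L²` distance from `f` to `u_ε` controls the parameters, hence the remainder in every `H^m`: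
write it as the translate of `f - u_ε`, plus the increment of `u_ε` under translation, plus
`u_ε - u_e`. -/
lemma exists_norm_remainder_le {b : ℝ → Ell} {ρ L : ℝ} {K : NNReal}
    (hK : LipschitzOnWith K (fun e => e • b e) (Metric.ball 0 ρ)) (m : ℕ) :
    ∃ C : ℝ, ∀ (ε e a : ℝ) (F : HSob m), |ε| < ρ → |e| < ρ →
      |e - ε| ≤ L * ‖HSob.comp 0 F - cosSeriesL2 (ε • b ε)‖ →
      |ε| * |a| ≤ L * ‖HSob.comp 0 F - cosSeriesL2 (ε • b ε)‖ →
      |e - ε| + ‖remainder b e a F‖ ≤ C * ‖F - cosSeriesSob m (ε • b ε)‖ := by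
  obtain ⟨C, hC0, hC⟩ := exists_norm_transL_cosSeriesSob_sub_le m
  refine ⟨1 + |L| * (1 + C * K + ‖cosSeriesSob m‖ * K), fun ε e a F hε he hparam htransl => ?_⟩
  set x := ‖F - cosSeriesSob m (ε • b ε)‖
  have hx : ‖HSob.comp 0 F - cosSeriesL2 (ε • b ε)‖ ≤ x := by
    rw [← comp_zero_cosSeriesSob m, ← map_sub]
    exact HSob.norm_comp_le _ _
  have hLx : L * ‖HSob.comp 0 F - cosSeriesL2 (ε • b ε)‖ ≤ |L| * x :=
    mul_le_mul (le_abs_self L) hx (norm_nonneg _) (abs_nonneg L)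
  have hball {t : ℝ} (ht : |t| < ρ) : t ∈ Metric.ball (0 : ℝ) ρ := mem_ball_zero_iff.2 ht
  have hnorm : ‖ε • b ε‖ ≤ K * |ε| := by
    have := hK.norm_sub_le (hball hε) (hball (abs_zero.trans_lt ((abs_nonneg ε).trans_lt hε)))
    rwa [zero_smul, sub_zero, sub_zero] at this
  have hwave : ‖cosSeriesSob m (ε • b ε - e • b e)‖ ≤ ‖cosSeriesSob m‖ * K * (|L| * x) := by
    rw [mul_assoc]
    refine (cosSeriesSob m).le_opNorm_of_le ((hK.norm_sub_le (hball hε) (hball he)).trans ?_)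
    rw [norm_sub_rev]
    exact mul_le_mul_of_nonneg_left (hparam.trans hLx) K.2
  have htrans : ‖HSob.transL a (cosSeriesSob m (ε • b ε)) - cosSeriesSob m (ε • b ε)‖ ≤
      C * K * (|L| * x) := calc
    _ ≤ C * (K * |ε|) * |a| := (hC a (ε • b ε)).trans (by gcongr)
    _ = C * K * (|ε| * |a|) := by ring
    _ ≤ C * K * (|L| * x) := mul_le_mul_of_nonneg_left (htransl.trans hLx) (by positivity)
  have hsplit : remainder b e a F = HSob.transL a (F - cosSeriesSob m (ε • b ε)) +
      (HSob.transL a (cosSeriesSob m (ε • b ε)) - cosSeriesSob m (ε • b ε)) +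
      cosSeriesSob m (ε • b ε - e • b e) := by
    rw [map_sub (HSob.transL a), map_sub (cosSeriesSob m), remainder]
    abel
  have hsum := hsplit ▸ norm_add₃_le (a := HSob.transL a (F - cosSeriesSob m (ε • b ε)))
  rw [HSob.norm_transL] at hsum
  linarith [hparam.trans hLx]

lemma exists_norm_incl_remainder_le {b : ℝ → Ell} {ρ L : ℝ} {K : NNReal}
    (hK : LipschitzOnWith K (fun e => e • b e) (Metric.ball 0 ρ)) (m : ℕ) :
    ∃ C : ℝ, ∀ (k : ℕ) (hm : m ≤ k) (ε e a : ℝ) (F : HSob k), |ε| < ρ → |e| < ρ →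
      |e - ε| ≤ L * ‖HSob.comp 0 F - cosSeriesL2 (ε • b ε)‖ →
      |ε| * |a| ≤ L * ‖HSob.comp 0 F - cosSeriesL2 (ε • b ε)‖ →
      |e - ε| + ‖HSob.incl hm (remainder b e a F)‖ ≤
        C * ‖HSob.incl hm (F - cosSeriesSob k (ε • b ε))‖ := by
  obtain ⟨C, hC⟩ := exists_norm_remainder_le (L := L) hK m
  refine ⟨C, fun k hm ε e a F hε he hparam htransl => ?_⟩
  rw [incl_remainder, map_sub, incl_cosSeriesSob]
  exact hC ε e a (HSob.incl hm F) hε he hparam htransl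

lemma projPlus_eq_zero_of_modEq {b : ℝ → Ell} {ε σ a : ℝ} {f : L2Zero} (hε : ε ≠ 0)
    (h : modEq b ((ε, ε⁻¹ • f), (σ, a)) = 0) :
    projPlus b (ε * σ) (L2Zero.trans a f - cosSeriesL2 ((ε * σ) • b (ε * σ))) = 0 := by
  have hfst : ε⁻¹ * inner ℝ (L2Zero.trans a f) (cosSeriesL2 (b (ε * σ))) -
      σ * inner ℝ (cosSeriesL2 (b (ε * σ))) (cosSeriesL2 (b (ε * σ))) = 0 := by
    rw [L2Zero.inner_trans, ← real_inner_smul_left]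
    exact congrArg Prod.fst h
  rw [sub_eq_zero, inv_mul_eq_iff_eq_mul₀ hε] at hfst
  have hcoord : coordPlus b (ε * σ) (L2Zero.trans a f - cosSeriesL2 ((ε * σ) • b (ε * σ))) = 0 := by
    rw [map_sub, map_smul, map_smul, coordPlus_apply, coordPlus_apply, hfst, smul_eq_mul]
    ring
  rw [projPlus, ContinuousLinearMap.smulRight_apply, hcoord, zero_smul]

lemma projMinus_eq_zero_of_modEq {b : ℝ → Ell} {ε σ a : ℝ} {f : L2Zero} (hε : ε ≠ 0)
    (h : modEq b ((ε, ε⁻¹ • f), (σ, a)) = 0) :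
    projMinus b (ε * σ) (L2Zero.trans a f - cosSeriesL2 ((ε * σ) • b (ε * σ))) = 0 := by
  have hsnd : ε⁻¹ * inner ℝ (L2Zero.trans a f) (antiderivSeriesL2 (waveDer b (ε * σ))) = 0 := by
    rw [L2Zero.inner_trans, ← real_inner_smul_left]
    exact congrArg Prod.snd h
  rw [projMinus, ContinuousLinearMap.smulRight_apply, coordMinus_apply, inner_sub_left,
    inner_cosSeriesL2_antiderivSeriesL2, sub_zero,
    (mul_eq_zero.1 hsnd).resolve_left (inv_ne_zero hε), mul_zero, zero_smul]

lemma abs_mul_abs_le_of_abs_le {ε x K d : ℝ} (hε : ε ≠ 0) (h : |x| ≤ K * (|ε|⁻¹ * d)) :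
    |ε| * |x| ≤ K * d := by
  rwa [mul_left_comm, ← div_eq_inv_mul, le_div_iff₀' (abs_pos.2 hε)] at h

lemma abs_pos_and_abs_lt_of_abs_sub_lt {e ε ρ : ℝ} (h : |e - ε| < |ε| / 2) (hε : |ε| < ρ / 2) :
    0 < |e| ∧ |e| < ρ := by
  have hlower := abs_sub_abs_le_abs_sub ε e
  have hupper := abs_sub_abs_le_abs_sub e ε
  rw [abs_sub_comm] at hlower
  constructor <;> linarith

namespace IsProfile

variable {δ : ℝ} {b : ℝ → Ell} {ν : ℝ → ℝ}

lemma remainder_ae (h : IsProfile δ b ν) {k : ℕ} {e : ℝ} (he : e ∈ Ioo (-δ) δ) (a : ℝ)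
    (F : HSob k) :
    ∀ᵐ x : Torus, l2fn (HSob.comp 0 F) x = (seriesZero (e • b e)).fn (x + (a : Torus)) +
      l2fn (HSob.comp 0 (remainder b e a F)) (x + (a : Torus)) := by
  have hshifted : ∀ᵐ y ∂torusMeasure, l2fn (HSob.comp 0 F) (y - (a : Torus)) =
      (seriesZero (e • b e)).fn y + l2fn (HSob.comp 0 (remainder b e a F)) y := by
    have hsum : L2Zero.trans a (HSob.comp 0 F) =
        cosSeriesL2 (e • b e) + HSob.comp 0 (remainder b e a F) := by
      rw [comp_zero_remainder, add_sub_cancel]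
    have hmean : coef (cosSeries (e • b e)) 0 = 0 := by
      rw [coef_cosSeries_zero, h.coord_zero_wave he, Complex.ofReal_zero]
    filter_upwards [L2Zero.trans_ae a (HSob.comp 0 F), zeroMean_ae hmean,
      Lp.coeFn_add (cosSeriesL2 (e • b e)).1 (HSob.comp 0 (remainder b e a F)).1]
      with y htrans hwave hadd
    rw [h.fn_eq he, ← hwave, ← htrans, hsum]
    exact hadd
  rw [← ae_torusMeasure_iff]
  filter_upwards [(measurePreserving_add_right torusMeasure
    (a : Torus)).quasiMeasurePreserving.ae hshifted] with x hx
  rwa [add_sub_cancel_right] at hx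

lemma contDiffAt_remainder (h : IsProfile δ b ν) {k j : ℕ} (hj : j ≤ k) {e a : HSob k → ℝ}
    {F : HSob k} (he : ContDiffAt ℝ ∞ e F) (ha : ContDiffAt ℝ ∞ a F) (heδ : e F ∈ Ioo (-δ) δ) :
    ContDiffAt ℝ j (fun F => HSob.incl (Nat.sub_le k j) (remainder b (e F) (a F) F)) F := by
  have hj' : (j : WithTop ℕ∞) ≤ (∞ : WithTop ℕ∞) := by exact_mod_cast le_top
  have htrans : ContDiffAt ℝ j (fun F => HSob.transIncl (Nat.sub_le k j) (a F) F) F :=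
    ContDiffAt.comp F (g := fun p : ℝ × HSob k => HSob.transIncl (Nat.sub_le k j) p.1 p.2)
      (HSob.contDiff_transIncl_uncurry j (Nat.sub_le k j) (by omega)).contDiffAt
      (f := fun F => (a F, F)) ((ha.of_le hj').prodMk contDiffAt_id)
  have hwave : ContDiffAt ℝ j (fun F => e F • b (e F)) F :=
    ContDiffAt.comp F (g := fun e => e • b e) ((h.contDiffAt_wave heδ).of_le le_top) (he.of_le hj')
  have hseries : ContDiffAt ℝ j (fun F => cosSeriesSob (k - j) (e F • b (e F))) F :=
    ContDiffAt.comp F (cosSeriesSob (k - j)).contDiff.contDiffAt hwave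
  have hincl : (fun F => HSob.incl (Nat.sub_le k j) (remainder b (e F) (a F) F)) = fun F =>
      HSob.transIncl (Nat.sub_le k j) (a F) F - cosSeriesSob (k - j) (e F • b (e F)) :=
    funext fun F => by
      rw [remainder, map_sub, incl_cosSeriesSob]
      rfl
  rw [hincl]
  exact htrans.sub hseries

lemma contDiffOn_remainder (h : IsProfile δ b ν) {k j : ℕ} (hj : j ≤ k) {e a : L2Zero → ℝ}
    {s : Set L2Zero} (he : ∀ f ∈ s, ContDiffAt ℝ ∞ e f) (ha : ∀ f ∈ s, ContDiffAt ℝ ∞ a f)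
    (heδ : MapsTo e s (Ioo (-δ) δ)) :
    ContDiffOn ℝ j (fun F : HSob k => HSob.incl (Nat.sub_le k j)
      (remainder b (e (HSob.comp 0 F)) (a (HSob.comp 0 F)) F)) (HSob.comp 0 ⁻¹' s) := by
  intro F hF
  have hcomp : ContDiffAt ℝ ∞ (HSob.comp 0) F := (HSob.comp 0).contDiff.contDiffAt
  exact (h.contDiffAt_remainder hj (ContDiffAt.comp (f := HSob.comp 0) F (he _ hF) hcomp)
    (ContDiffAt.comp (f := HSob.comp 0) F (ha _ hF) hcomp) (heδ hF)).contDiffWithinAt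

lemma exists_modulation_scaled (h : IsProfile δ b ν) :
    ∃ r : ℝ, 0 < r ∧ ∃ K : ℝ, 0 ≤ K ∧ ∃ Φ : ℝ × L2Zero → ℝ × ℝ, ∀ (ε : ℝ) (f : L2Zero), |ε| < r →
      ‖f - cosSeriesL2 (ε • b ε)‖ < r * |ε| →
        ContDiffAt ℝ ∞ Φ (ε, ε⁻¹ • f) ∧
        ‖Φ (ε, ε⁻¹ • f) - (1, 0)‖ ≤ K * (|ε|⁻¹ * ‖f - cosSeriesL2 (ε • b ε)‖) ∧
        modEq b ((ε, ε⁻¹ • f), Φ (ε, ε⁻¹ • f)) = 0 := by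
  obtain ⟨K, hK0, Φ, hΦ⟩ := h.exists_modulation
  obtain ⟨r, hr, hΦ⟩ := Metric.eventually_nhds_iff.1 hΦ
  refine ⟨r, hr, K, hK0, Φ, fun ε f hε hf => ?_⟩
  have hpos : 0 < |ε| := pos_of_mul_pos_right ((norm_nonneg _).trans_lt hf) hr.le
  have hscaled : cosSeriesL2 (b ε) + ε⁻¹ • (f - cosSeriesL2 (ε • b ε)) = ε⁻¹ • f := by
    rw [map_smul, smul_sub, inv_smul_smul₀ (abs_pos.1 hpos), add_sub_cancel]
  have hnorm : ‖ε⁻¹ • (f - cosSeriesL2 (ε • b ε))‖ = |ε|⁻¹ * ‖f - cosSeriesL2 (ε • b ε)‖ := by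
    rw [norm_smul, norm_inv, norm_eq_abs]
  rw [← hscaled, ← hnorm]
  refine hΦ (y := (ε, ε⁻¹ • (f - cosSeriesL2 (ε • b ε)))) ?_
  rw [Prod.mk_zero_zero, dist_zero_right, Prod.norm_mk, hnorm, max_lt_iff,
    inv_mul_lt_iff₀ hpos]
  exact ⟨hε, hf.trans_eq (mul_comm _ _)⟩

/- The parameters depend on `f` as an element of `L²` only, and so does the radius, because no
derivative of `f` enters the modulation equations. -/
lemma exists_parameters (h : IsProfile δ b ν) {ρ : ℝ} (hρ : 0 < ρ) :
    ∃ r : ℝ, 0 < r ∧ r ≤ ρ ∧ ∃ K : ℝ, ∀ ε₀ : ℝ, |ε₀| < r → ∃ e a : L2Zero → ℝ,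
      ∀ f : L2Zero, ‖f - cosSeriesL2 (ε₀ • b ε₀)‖ < r * |ε₀| →
        (ContDiffAt ℝ ∞ e f ∧ ContDiffAt ℝ ∞ a f) ∧ (0 < |e f| ∧ |e f| < ρ) ∧
        projPlus b (e f) (L2Zero.trans (a f) f - cosSeriesL2 (e f • b (e f))) = 0 ∧
        projMinus b (e f) (L2Zero.trans (a f) f - cosSeriesL2 (e f • b (e f))) = 0 ∧
        |e f - ε₀| ≤ K * ‖f - cosSeriesL2 (ε₀ • b ε₀)‖ ∧
        |ε₀| * |a f| ≤ K * ‖f - cosSeriesL2 (ε₀ • b ε₀)‖ := by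
  obtain ⟨r₁, hr₁, K, hK0, Φ, hΦ⟩ := h.exists_modulation_scaled
  obtain ⟨r, hr0, hr⟩ := exists_between
    (show 0 < min r₁ (min (ρ / 2) (1 / (2 * (K + 1)))) by positivity)
  obtain ⟨hrr₁, hrρ, hrK⟩ : r < r₁ ∧ r < ρ / 2 ∧ r < 1 / (2 * (K + 1)) := by
    simpa only [lt_min_iff] using hr
  refine ⟨r, hr0, by linarith, K, fun ε₀ hε₀ => ⟨fun f => ε₀ * (Φ (ε₀, ε₀⁻¹ • f)).1,
    fun f => (Φ (ε₀, ε₀⁻¹ • f)).2, fun f hf => ?_⟩⟩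
  have hne : ε₀ ≠ 0 :=
    abs_pos.1 (pos_of_mul_pos_right ((norm_nonneg _).trans_lt hf) hr0.le)
  obtain ⟨hsmooth, hclose, hsol⟩ := hΦ ε₀ f (hε₀.trans hrr₁) (hf.trans_le (by gcongr))
  have hΦf : ContDiffAt ℝ ∞ (fun f => Φ (ε₀, ε₀⁻¹ • f)) f :=
    ContDiffAt.comp f hsmooth (contDiffAt_const.prodMk (contDiffAt_id.const_smul ε₀⁻¹))
  have he : |ε₀ * (Φ (ε₀, ε₀⁻¹ • f)).1 - ε₀| ≤ K * ‖f - cosSeriesL2 (ε₀ • b ε₀)‖ := by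
    rw [← mul_sub_one, abs_mul]
    exact abs_mul_abs_le_of_abs_le hne ((norm_fst_le (Φ (ε₀, ε₀⁻¹ • f) - (1, 0))).trans hclose)
  have ha : |ε₀| * |(Φ (ε₀, ε₀⁻¹ • f)).2| ≤ K * ‖f - cosSeriesL2 (ε₀ • b ε₀)‖ := by
    have := (norm_snd_le (Φ (ε₀, ε₀⁻¹ • f) - (1, 0))).trans hclose
    rw [Prod.snd_sub, sub_zero] at this
    exact abs_mul_abs_le_of_abs_le hne this
  have hhalf : K * ‖f - cosSeriesL2 (ε₀ • b ε₀)‖ < |ε₀| / 2 := by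
    rw [lt_div_iff₀ (by positivity)] at hrK
    nlinarith [norm_nonneg (f - cosSeriesL2 (ε₀ • b ε₀))]
  exact ⟨⟨contDiffAt_const.mul hΦf.fst, hΦf.snd⟩,
    abs_pos_and_abs_lt_of_abs_sub_lt (he.trans_lt hhalf) (hε₀.trans hrρ),
    projPlus_eq_zero_of_modEq hne hsol, projMinus_eq_zero_of_modEq hne hsol, he, ha⟩

lemma exists_radius {δ₁ : ℝ} {u : ℝ → SmoothZero} {v : ℝ → ℝ} (h : IsProfile δ b ν)
    (huv : IsBifurcationCurve δ₁ u v) :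
    ∃ ρ : ℝ, 0 < ρ ∧ ρ ≤ δ₁ ∧
      (∃ K, LipschitzOnWith K (fun e => e • b e) (Metric.ball 0 ρ)) ∧
      ∀ e : ℝ, |e| < ρ →
        e ∈ Ioo (-δ) δ ∧ u e = seriesZero (e • b e) ∧ v e = ν e ∧ 0 < pairing b e := by
  obtain ⟨K, s, hs, hK⟩ :=
    ((h.contDiffAt_wave h.zero_mem).of_le (m := 1) le_top).exists_lipschitzOnWith
  obtain ⟨ρ, hρ, hball⟩ := Metric.eventually_nhds_iff.1 ((eventually_mem h.zero_mem).and
    ((huv.eventually_eq h.isBifurcationCurve).and (h.eventually_pairing_pos.and hs)))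
  refine ⟨min ρ δ₁, lt_min hρ huv.pos, min_le_right _ _, ⟨K, hK.mono fun e he => ?_⟩,
    fun e he => ?_⟩
  · exact (hball (he.trans_le (min_le_left _ _))).2.2.2
  · rw [← norm_eq_abs, ← dist_zero_right] at he
    obtain ⟨hmem, hcurve, hpos, -⟩ := hball (he.trans_le (min_le_left _ _))
    exact ⟨hmem, hcurve.1, hcurve.2, hpos⟩

end IsProfile

lemma mapsTo_sobToL2_ball (w : SmoothZero) (k : ℕ) (r : ℝ) :
    MapsTo sobToL2 (Metric.ball (w.toSob k) r) (Metric.ball w.toL2 r) := fun f hf =>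
  mem_ball_iff_norm.2 <| (HSob.norm_comp_le 0 (f - w.toSob k : Sob k)).trans_lt
    (mem_ball_iff_norm.1 hf)

lemma contDiffOn_comp_sobToL2 {e : L2Zero → ℝ} {w : SmoothZero} {r : ℝ} {n : WithTop ℕ∞}
    (he : ContDiffOn ℝ n e (Metric.ball w.toL2 r)) (k : ℕ) :
    ContDiffOn ℝ n (fun f => e (sobToL2 f)) (Metric.ball (w.toSob k) r) :=
  ContDiffOn.comp (E := HSob k) (g := e) (f := HSob.comp 0) he (HSob.comp 0).contDiff.contDiffOn
    (mapsTo_sobToL2_ball w k r)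

end BurgersHilbert

end

open BurgersHilbert in
theorem mainTheorem8_general :
    (∃ (δ : ℝ) (u : ℝ → SmoothZero) (v : ℝ → ℝ), IsBifurcationCurve δ u v) ∧
    ∀ (δ : ℝ) (u : ℝ → SmoothZero) (v : ℝ → ℝ), IsBifurcationCurve δ u v →
    ∃ ρ : ℝ, 0 < ρ ∧ ρ ≤ δ ∧ ∃ Pp Pm : ℝ → (L2Zero →L[ℝ] L2Zero),
      (∀ ε : ℝ, 0 < |ε| → |ε| < ρ → IsZeroModeProjection u v ε (Pp ε) (Pm ε)) ∧
      ∃ r : ℝ, 0 < r ∧ r ≤ ρ ∧ ∃ C : ℕ → ℝ, ∀ ε₀ : ℝ, |ε₀| < r →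
        ∃ (e a : L2Zero → ℝ) (g : (k : ℕ) → Sob k → Sob k),
          (∀ (k : ℕ) (f : Sob k), sobToL2 f ∈ Metric.ball (u ε₀).toL2 (r * |ε₀|) →
            (0 < |e (sobToL2 f)| ∧ |e (sobToL2 f)| < ρ) ∧
            (∀ᵐ x : Torus, sobFn f x =
              (u (e (sobToL2 f))).fn (x + (a (sobToL2 f) : Torus)) +
                sobFn (g k f) (x + (a (sobToL2 f) : Torus))) ∧
            Pp (e (sobToL2 f)) (sobToL2 (g k f)) = 0 ∧ Pm (e (sobToL2 f)) (sobToL2 (g k f)) = 0 ∧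
            ∀ (m : ℕ) (hm : m ≤ k), |e (sobToL2 f) - ε₀| + ‖sobIncl hm (g k f)‖ ≤
              C m * ‖sobIncl hm (f - (u ε₀).toSob k)‖) ∧
          ContDiffOn ℝ ∞ e (Metric.ball (u ε₀).toL2 (r * |ε₀|)) ∧
          ContDiffOn ℝ ∞ a (Metric.ball (u ε₀).toL2 (r * |ε₀|)) ∧
          ∀ k j : ℕ, j ≤ k → ContDiffOn ℝ j (fun f => sobIncl (Nat.sub_le k j) (g k f))
            (sobToL2 ⁻¹' Metric.ball (u ε₀).toL2 (r * |ε₀|)) := by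
  obtain ⟨δ₁, b, ν, h⟩ := exists_isProfile
  refine ⟨⟨δ₁, _, ν, h.isBifurcationCurve⟩, fun δ u v huv => ?_⟩
  obtain ⟨ρ, hρ, hρδ, ⟨K, hK⟩, hcurve⟩ := h.exists_radius huv
  obtain ⟨r, hr, hrρ, L, hparam⟩ := h.exists_parameters hρ
  choose C hC using exists_norm_incl_remainder_le (L := L) hK
  refine ⟨ρ, hρ, hρδ, projPlus b, projMinus b, fun ε hε₀ hε => ?_, r, hr, hrρ, C,
    fun ε₀ hε₀ => ?_⟩
  · exact h.isZeroModeProjection (hcurve ε hε).1 (abs_pos.1 hε₀) (hcurve ε hε).2.2.2.ne'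
      ((continuous_abs.continuousAt.eventually_lt_const hε).mono fun e he => (hcurve e he).2.1)
      (hcurve ε hε).2.2.1
  obtain ⟨e, a, hea⟩ := hparam ε₀ hε₀
  have hcenter : (u ε₀).toL2 = cosSeriesL2 (ε₀ • b ε₀) := by
    rw [(hcurve ε₀ (hε₀.trans_le hrρ)).2.1, toL2_seriesZero]
  replace hea f (hf : f ∈ Metric.ball (u ε₀).toL2 (r * |ε₀|)) :=
    hea f (mem_ball_iff_norm.1 (hcenter ▸ hf))
  refine ⟨e, a, fun k F => remainder b (e (HSob.comp 0 F)) (a (HSob.comp 0 F)) F,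
    fun k f hf => ?_, fun f hf => (hea f hf).1.1.contDiffWithinAt,
    fun f hf => (hea f hf).1.2.contDiffWithinAt,
    fun k j hj => h.contDiffOn_remainder hj (fun f hf => (hea f hf).1.1)
      (fun f hf => (hea f hf).1.2) fun f hf => (hcurve _ (hea f hf).2.1.2).1⟩
  obtain ⟨-, hlt, hplus, hminus, he, ha⟩ := hea (sobToL2 f) hf
  have hwave : (u ε₀).toSob k = cosSeriesSob k (ε₀ • b ε₀) := by
    rw [(hcurve ε₀ (hε₀.trans_le hrρ)).2.1]
    exact toHSob_seriesZero k _
  rw [(hcurve _ hlt.2).2.1, hwave]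
  exact ⟨hlt, h.remainder_ae (hcurve _ hlt.2).1 _ f,
    (congrArg (projPlus b _) (comp_zero_remainder b _ _ f)).trans hplus,
    (congrArg (projMinus b _) (comp_zero_remainder b _ _ f)).trans hminus,
    fun m hm => hC m k hm ε₀ _ _ f (hε₀.trans_le hrρ) hlt.2 he ha⟩

open BurgersHilbert in
theorem mainTheorem8 :
    -- the curve of traveling waves exists
    (∃ (δ : ℝ) (u : ℝ → SmoothZero) (v : ℝ → ℝ), IsBifurcationCurve δ u v) ∧
    ∀ (δ : ℝ) (u : ℝ → SmoothZero) (v : ℝ → ℝ), IsBifurcationCurve δ u v →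
    -- the spectral projections `P₀^±(ε)` exist for `0 < |ε| < ρ`
    ∃ ρ : ℝ, 0 < ρ ∧ ρ ≤ δ ∧ ∃ Pp Pm : ℝ → (L2Zero →L[ℝ] L2Zero),
      (∀ ε : ℝ, 0 < |ε| → |ε| < ρ → IsZeroModeProjection u v ε (Pp ε) (Pm ε)) ∧
      ∀ (k : ℕ) (hk : 2 ≤ k), ∃ r : ℝ, 0 < r ∧ r ≤ ρ ∧ ∃ C : ℝ,
        ∀ ε₀ : ℝ, |ε₀| < r →
        ∃ (e a : Sob k → ℝ) (g : Sob k → Sob k),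
          (∀ f : Sob k, ‖f - (u ε₀).toSob k‖ < r * |ε₀| →
            0 < |e f| ∧ |e f| < ρ ∧
            (∀ᵐ x : Torus, sobFn f x = (u (e f)).fn (x + (a f : Torus)) +
              sobFn (g f) (x + (a f : Torus))) ∧
            Pp (e f) (sobToL2 (g f)) = 0 ∧ Pm (e f) (sobToL2 (g f)) = 0 ∧
            |e f - ε₀| + ‖sobIncl hk (g f)‖ ≤ C * ‖sobIncl hk (f - (u ε₀).toSob k)‖ ∧
            |e f - ε₀| + ‖g f‖ ≤ C * ‖f - (u ε₀).toSob k‖) ∧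
          ContDiffOn ℝ ∞ e (Metric.ball ((u ε₀).toSob k) (r * |ε₀|)) ∧
          ContDiffOn ℝ ∞ a (Metric.ball ((u ε₀).toSob k) (r * |ε₀|)) ∧
          ∀ j : ℕ, j ≤ k →
            ContDiffOn ℝ j (fun f => sobIncl (Nat.sub_le k j) (g f))
              (Metric.ball ((u ε₀).toSob k) (r * |ε₀|)) := by
  refine mainTheorem8_general.imp_right fun hgeneral δ u v huv => ?_
  obtain ⟨ρ, hρ, hρδ, Pp, Pm, hP, r, hr, hrρ, C, hdecomp⟩ := hgeneral δ u v huv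
  refine ⟨ρ, hρ, hρδ, Pp, Pm, hP, fun k hk => ⟨r, hr, hrρ, max (C 2) (C k), fun ε₀ hε₀ => ?_⟩⟩
  obtain ⟨e, a, g, hg, he, ha, hsmooth⟩ := hdecomp ε₀ hε₀
  have hball := mapsTo_sobToL2_ball (u ε₀) k (r * |ε₀|)
  refine ⟨fun f => e (sobToL2 f), fun f => a (sobToL2 f), g k, fun f hf => ?_,
    contDiffOn_comp_sobToL2 he k, contDiffOn_comp_sobToL2 ha k,
    fun j hj => (hsmooth k j hj).mono hball⟩
  obtain ⟨⟨hpos, hlt⟩, hae, hplus, hminus, hbound⟩ := hg k f (hball (mem_ball_iff_norm.2 hf))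
  exact ⟨hpos, hlt, hae, hplus, hminus,
    (hbound 2 hk).trans (mul_le_mul_of_nonneg_right (le_max_left _ _) (norm_nonneg _)),
    (hbound k le_rfl).trans (mul_le_mul_of_nonneg_right (le_max_right _ _) (norm_nonneg _))⟩
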